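/- Let $\lambda<0$, $p>0$ with $p\neq 1$, $\tau>0$, and let $\beta\ge 1$ be an integer. Then there is a constant $\Lambda=\Lambda(\lambda,p,\beta,\tau)>0$ such that for every $\mu>0$ there are $0<x_1<x_2$ (depending only on $\lambda,p,\beta,\tau,\mu$) with the following properties. Put $$F(x)=\tfrac{\lambda}{2}x^2+\tfrac{\mu}{p+1}|x|^{p+1},\qquad \mathcal H(x,y)=\tfrac12y^2+F(x).$$ (A) $F(x_1)>0$ and, for every $x\in[x_1,x_2]$, $F'(x)>0$ and $F<F(x)$ on $(-x,x)$. Thus $\mathcal A=\{(x,y): |x|\le x_2,\ F(x_1)\le\mathcal H(x,y)\le F(x_2)\}$ is an annulus filled with closed orbits around the origin of $x'=y$, $y'=-\lambda x-\mu|x|^{p-1}x$. (B) Let $m\ge 0$ be an integer and $\varsigma>\Lambda$. Put $t_i=i(\tau+\varsigma)$, $s_i=t_i+\tau$ for $0\le i\le m$, and $L=s_m$; let $a=\mu$ on $\bigcup_{i=0}^m[t_i,s_i]$ and $a=0$ elsewhere in $[0,L]$. Let $\hat r_0,\hat r_L\subset\mathbb R^2$ be unbounded arcs linking the origin to infinity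 (images of continuous injective curves $\rho:[0,\infty)\to\mathbb R^2$ with $\rho(0)=0$ and $|\rho(s)|\to\infty$ as $s\to\infty$), contained in closed quadrants $q_0$ and $q_L$, respectively. Then the problem $$-u''=\lambda u+a(t)|u|^{p-1}u\ \text{ in }[0,L],\qquad (u(0),u'(0))\in\hat r_0,\quad (u(L),u'(L))\in\hat r_L$$ (where $u\in C^1[0,L]$, $u'$ is absolutely continuous, and the equation holds almost everywhere) has at least $4^m\beta^{m+1}$ nontrivial solutions. (C) In the setting of (B), these solutions can be classified by their itineraries and nodal properties, as follows. An itinerary consists of integers $j_i\in\{1,\dots,\beta\}$ $(0\le i\le m)$ and quadrants $b_i\in\{II,IV\}$, $\kappa_{i+1}\in\{I,III\}$ $(0\le i\le m-1)$; put $\kappa_0=q_0$ and $b_m=q_L$. There are $4^m\beta^{m+1}$ itineraries. To every itinerary one can assign a solution $u$ of the problem, distinct itineraries receiving distinct solutions, such that: 1. $(u(t_i),u'(t_i))\in\mathcal A\cap\kappa_i$ and $(u(s_i),u'(s_i))\in\mathcal A\cap b_i$ for $0\le i\le m$, where quadrants are closed; for $0\le i\le m-1$, $(u(s_i),u'(s_i))$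 and $(u(t_{i+1}),u'(t_{i+1}))$ lie in the interiors of $b_i$ and $\kappa_{i+1}$, respectively. 2. For $0\le i\le m-1$: in $(s_i,t_{i+1})$, if $(b_i,\kappa_{i+1})$ is $(II,I)$ or $(IV,III)$, then $u$ has exactly one zero and $u'$ has none; if it is $(II,III)$ or $(IV,I)$, then $u$ has no zero and $u'$ has exactly one. 3. For $0\le i\le m$, number the quadrants $I,IV,III,II$ (the clockwise order) by $0,1,2,3$, and let $D_i$ be $4j_i$, $4j_i+1$, $4j_i-2$ or $4j_i-1$ according to whether the number of $b_i$ minus that of $\kappa_i$ is congruent to $0$, $1$, $2$ or $3$ modulo $4$. Then on the hump $[t_i,s_i]$ the point $(u,u')$ crosses $D_i$ half-axes: if $\kappa_i\in\{I,III\}$, then $u$ has exactly $\lfloor D_i/2\rfloor$ zeros and $u'$ has exactly $\lfloor (D_i+1)/2\rfloor$ zeros; if $\kappa_i\in\{II,IV\}$, these two numbers are interchanged. Here zeros in $(t_i,s_i)$ are counted, and zeros at the end points as follows: a zero of $u$ at $t_i$ counts if and only if $\kappa_i\in\{II,IV\}$, and one at $s_i$ if and only if $b_i\in\{I,III\}$;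 a zero of $u'$ at $t_i$ counts if and only if $\kappa_i\in\{I,III\}$, and one at $s_i$ if and only if $b_i\in\{II,IV\}$. In particular, for $\kappa_i\in\{I,III\}$ and $b_i\in\{II,IV\}$, $u$ has $2j_i-1$ zeros in $(t_i,s_i)$ and $u'$ has $2j_i$ zeros in $[t_i,s_i]$ if $(\kappa_i,b_i)\in\{(I,II),(III,IV)\}$, and these numbers are $2j_i$ and $2j_i+1$ if $(\kappa_i,b_i)\in\{(I,IV),(III,II)\}$. -/

import Mathlib

open Set Filter Topology MeasureTheory

noncomputable section

/-! ### The weight and the boundary value problem -/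

namespace MooreNehari

/-- The left end `t_i` of the `i`-th hump `[t_i, s_i]`, when all humps have length `τ` and all gaps
have length `ς`. -/
def humpStart (τ ς : ℝ) (i : ℕ) : ℝ := i * (τ + ς)

/-- The right end `s_i = t_i + τ` of the `i`-th hump. -/
def humpEnd (τ ς : ℝ) (i : ℕ) : ℝ := humpStart τ ς i + τ

/-- The right end `L = s_m` of the interval `[0, L]`. -/
def len (τ ς : ℝ) (m : ℕ) : ℝ := humpEnd τ ς m

/-- The stepwise weight: `a = μ` on the `m + 1` humps `[t_i, s_i]`, and `a = 0` elsewhere. -/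
def weight (μ τ ς : ℝ) (m : ℕ) : ℝ → ℝ :=
  (⋃ i : Fin (m + 1), Icc (humpStart τ ς i) (humpEnd τ ς i)).indicator fun _ => μ

/-- The derivative of `u` on the interval `[0, L]` (one-sided at the end points). -/
def slope (L : ℝ) (u : ℝ → ℝ) (t : ℝ) : ℝ := derivWithin u (Icc 0 L) t

/-- The point `(u(t), u'(t))` of the phase plane. -/
def phase (L : ℝ) (u : ℝ → ℝ) (t : ℝ) : ℝ × ℝ := (u t, slope L u t)

/-- `u` solves `-u'' = lam u + a(t) |u|^(p-1) u` on `[0, L]` in the Carathéodory sense: `u` is `C¹`,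
`u'` is absolutely continuous, and the equation holds almost everywhere. -/
structure SolvesEquation (lam p : ℝ) (a : ℝ → ℝ) (L : ℝ) (u : ℝ → ℝ) : Prop where
  contDiffOn : ContDiffOn ℝ 1 u (Icc 0 L)
  absolutelyContinuous : AbsolutelyContinuousOnInterval (slope L u) 0 L
  equation : ∀ᵐ t ∂(volume.restrict (Icc 0 L)),
    HasDerivAt (slope L u) (-(lam * u t + a t * (|u t| ^ (p - 1) * u t))) t

/-- `u` solves the generalized Sturm--Liouville problem: the equation together with
`(u(0), u'(0)) ∈ r₀` and `(u(L), u'(L)) ∈ r₁`. -/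
structure SolvesProblem (lam p : ℝ) (a : ℝ → ℝ) (L : ℝ) (r₀ r₁ : Set (ℝ × ℝ)) (u : ℝ → ℝ) :
    Prop where
  solvesEquation : SolvesEquation lam p a L u
  left_mem : phase L u 0 ∈ r₀
  right_mem : phase L u L ∈ r₁

/-- The nontrivial solutions of the boundary value problem, as functions on `[0, L]`. -/
def nontrivialSolutions (lam p : ℝ) (a : ℝ → ℝ) (L : ℝ) (r₀ r₁ : Set (ℝ × ℝ)) :
    Set (Icc (0 : ℝ) L → ℝ) :=
  {w | (∃ u : ℝ → ℝ, SolvesProblem lam p a L r₀ r₁ u ∧ (Icc 0 L).domRestrict u = w) ∧ w ≠ 0}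

/-- An unbounded arc linking the origin to infinity. -/
def IsUnboundedArc (r : Set (ℝ × ℝ)) : Prop :=
  ∃ ρ : ℝ → ℝ × ℝ, ContinuousOn ρ (Ici 0) ∧ InjOn ρ (Ici 0) ∧ ρ 0 = 0 ∧
    Tendsto (fun s => ‖ρ s‖) atTop atTop ∧ r = ρ '' Ici 0

/-! ### Quadrants -/

/-- The four quadrants of the phase plane, listed clockwise. -/
inductive Quadrant : Type
  | I
  | IV
  | III
  | II

namespace Quadrant

/-- The closed quadrant. -/
def closed : Quadrant → Set (ℝ × ℝ)
  | I => {z | 0 ≤ z.1 ∧ 0 ≤ z.2}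
  | IV => {z | 0 ≤ z.1 ∧ z.2 ≤ 0}
  | III => {z | z.1 ≤ 0 ∧ z.2 ≤ 0}
  | II => {z | z.1 ≤ 0 ∧ 0 ≤ z.2}

/-- The open quadrant. -/
def opened : Quadrant → Set (ℝ × ℝ)
  | I => {z | 0 < z.1 ∧ 0 < z.2}
  | IV => {z | 0 < z.1 ∧ z.2 < 0}
  | III => {z | z.1 < 0 ∧ z.2 < 0}
  | II => {z | z.1 < 0 ∧ 0 < z.2}

/-- Position in the clockwise order, the first quadrant being number `0`. -/
def index : Quadrant → ℕ
  | I => 0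
  | IV => 1
  | III => 2
  | II => 3

/-- Quadrants I and III: going clockwise, these are entered across the `y`-axis (where `u = 0`) and
left across the `x`-axis (where `u' = 0`). -/
def IsOdd : Quadrant → Prop
  | I => True
  | IV => False
  | III => True
  | II => False

end Quadrant

/-- The number of half-axes that a point crosses while it turns clockwise from the quadrant `q` to
the quadrant `r`, on its `(j + 1)`-st admissible passage through `r`. It is the `(j + 1)`-st element
of the set of integers `n ≥ 2` with `n ≡ r - q` modulo `4`: the visits of `r` before the
second half-axis has been crossed are not admissible. -/
def crossings (q r : Quadrant) (j : ℕ) : ℕ := 4 * j + 2 + (r.index + 6 - q.index) % 4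

/-- How many of these half-axes belong to the `y`-axis, i.e. are crossed at a zero of `u`. -/
def crossingsY (q r : Quadrant) (j : ℕ) : ℕ := (crossings q r j + q.index % 2) / 2

/-- How many of these half-axes belong to the `x`-axis, i.e. are crossed at a zero of `u'`. -/
def crossingsX (q r : Quadrant) (j : ℕ) : ℕ := (crossings q r j + (1 - q.index % 2)) / 2

/-! ### The annulus of closed orbits -/

/-- The potential `F(x) = lam x² / 2 + μ |x|^(p+1) / (p+1)` of the autonomous equation. -/
def potential (lam p μ x : ℝ) : ℝ := lam / 2 * x ^ 2 + μ / (p + 1) * |x| ^ (p + 1)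

/-- The Hamiltonian `H(x, y) = y² / 2 + F(x)`. -/
def energy (lam p μ : ℝ) (z : ℝ × ℝ) : ℝ := z.2 ^ 2 / 2 + potential lam p μ z.1

/-- The region between the level lines of `H` through `(x₁, 0)` and `(x₂, 0)`. The bound on `|x|`
discards the unbounded components of `{F(x₁) ≤ H ≤ F(x₂)}`, which exist if `p < 1`, `lam < 0`. -/
def annulus (lam p μ x₁ x₂ : ℝ) : Set (ℝ × ℝ) :=
  {z | |z.1| ≤ x₂ ∧ potential lam p μ x₁ ≤ energy lam p μ z ∧
    energy lam p μ z ≤ potential lam p μ x₂}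

/-- All the level lines of positive energy through the points `(x, 0)`, `x₁ ≤ x ≤ x₂`, are closed
orbits around the origin: `F < F(x)` on `(-x, x)` and `F'(x) > 0`. -/
structure IsAnnulus (lam p μ x₁ x₂ : ℝ) : Prop where
  pos : 0 < x₁
  lt : x₁ < x₂
  energy_pos : 0 < potential lam p μ x₁
  below : ∀ x ∈ Icc x₁ x₂, ∀ w : ℝ, |w| < x → potential lam p μ w < potential lam p μ x
  force_pos : ∀ x ∈ Icc x₁ x₂, 0 < lam * x + μ * x ^ p

/-! ### Itineraries and nodal behaviour -/

/-- An itinerary in the transition diagram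
`𝒜_{0,q₀} → ℬ_0 → 𝒜_1 → ℬ_1 → ⋯ → 𝒜_m → 𝒜_{m,q₁}`: the block `ℬ_i ∈ {II, IV}` reached at `s_i`
and the block `𝒜_{i+1} ∈ {I, III}` reached at `t_{i+1}` are free at every step `i < m`, and on each
hump there are `β` admissible passages, numbered by `lap`. -/
structure Itinerary (m β : ℕ) where
  /-- The number of the passage on the `i`-th hump (counted from `0`). -/
  lap : Fin (m + 1) → Fin β
  /-- The quadrant at `s_i` is II (`true`) or IV (`false`). -/
  mid : Fin m → Bool
  /-- The quadrant at `t_{i+1}` is I (`true`) or III (`false`). -/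
  next : Fin m → Bool

namespace Itinerary

variable {m β : ℕ}

/-- The quadrant at the end `s_i` of the `i`-th hump, `i < m`. -/
def midQuadrant (J : Itinerary m β) (i : Fin m) : Quadrant :=
  if J.mid i then Quadrant.II else Quadrant.IV

/-- The quadrant at the end `t_{i+1}` of the `i`-th gap. -/
def nextQuadrant (J : Itinerary m β) (i : Fin m) : Quadrant :=
  if J.next i then Quadrant.I else Quadrant.III

/-- The quadrant at the beginning `t_i` of the `i`-th hump, `0 ≤ i ≤ m`. -/
def source (J : Itinerary m β) (q₀ : Quadrant) : Fin (m + 1) → Quadrant :=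
  Fin.cons (α := fun _ => Quadrant) q₀ J.nextQuadrant

/-- The quadrant at the end `s_i` of the `i`-th hump, `0 ≤ i ≤ m`. -/
def target (J : Itinerary m β) (q₁ : Quadrant) : Fin (m + 1) → Quadrant :=
  Fin.snoc (α := fun _ => Quadrant) J.midQuadrant q₁

end Itinerary

/-- The zeros of `f` in `(c, d)`, together with `c` if `f c = 0` and `P` holds, and `d` if `f d = 0`
and `Q` holds. -/
def zerosIn (f : ℝ → ℝ) (c d : ℝ) (P Q : Prop) : Set ℝ :=
  {t | t ∈ Icc c d ∧ f t = 0 ∧ (t = c → P) ∧ (t = d → Q)}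

/-- The function `u` follows the itinerary `J` from the quadrant `q₀` to the quadrant `q₁` through
the region `A`, with the nodal behaviour that `J` prescribes on every hump and on every gap.

On a hump that leads from the quadrant `q` to the quadrant `r`, an axis that is met exactly at an end
point counts as crossed if it is the one by which (clockwise) `q` is left or `r` is entered. For
`q ∈ {I, III}` and `r ∈ {II, IV}` this means: zeros of `u` in the open hump, and zeros of `u'` in the
closed one. It matters only at `t = 0` and `t = L`, because all other end points lie in open
quadrants. -/
structure Follows {m β : ℕ} (τ ς : ℝ) (A : Set (ℝ × ℝ)) (q₀ q₁ : Quadrant) (J : Itinerary m β)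
    (u : ℝ → ℝ) : Prop where
  mem_start : ∀ i : Fin (m + 1),
    phase (len τ ς m) u (humpStart τ ς i) ∈ A ∩ (J.source q₀ i).closed
  mem_end : ∀ i : Fin (m + 1),
    phase (len τ ς m) u (humpEnd τ ς i) ∈ A ∩ (J.target q₁ i).closed
  mid_mem : ∀ i : Fin m,
    phase (len τ ς m) u (humpEnd τ ς i) ∈ (J.midQuadrant i).opened
  next_mem : ∀ i : Fin m,
    phase (len τ ς m) u (humpStart τ ς (i + 1)) ∈ (J.nextQuadrant i).opened
  hump_zeros : ∀ i : Fin (m + 1),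
    (zerosIn u (humpStart τ ς i) (humpEnd τ ς i)
      (¬ (J.source q₀ i).IsOdd) (J.target q₁ i).IsOdd).encard =
        crossingsY (J.source q₀ i) (J.target q₁ i) (J.lap i)
  hump_critical : ∀ i : Fin (m + 1),
    (zerosIn (slope (len τ ς m) u) (humpStart τ ς i) (humpEnd τ ς i)
      (J.source q₀ i).IsOdd (¬ (J.target q₁ i).IsOdd)).encard =
        crossingsX (J.source q₀ i) (J.target q₁ i) (J.lap i)
  gap_zeros : ∀ i : Fin m,
    {t ∈ Ioo (humpEnd τ ς i) (humpStart τ ς (i + 1)) | u t = 0}.encard =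
      if J.mid i = J.next i then 1 else 0
  gap_critical : ∀ i : Fin m,
    {t ∈ Ioo (humpEnd τ ς i) (humpStart τ ς (i + 1)) | slope (len τ ς m) u t = 0}.encard =
      if J.mid i = J.next i then 0 else 1

end MooreNehari

end

open Set Filter Topology MeasureTheory

noncomputable section

namespace MooreNehari

/-! ### Planar topology -/

/-! The proof stretches paths through a chain of humps and gaps. Write `lam = -ν²`. On a hump the
equation is autonomous, and in coordinates `(c, φ)`, with `c` the amplitude of the orbit and `φ` the
clockwise angle, it becomes `c' = 0`, `φ' = ω(κ, φ)`, where `κ = μ c^(p-1)` and `ω² = κ · shape p φ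
- ν²` (`potential_sub`, `isFlow_hump`). The solutions are therefore explicit up to inverting a
monotone function, and uniqueness for the initial value problem, doubtful at `u = 0` if `p < 1`, is
never needed.

Twist: one boundary orbit of the annulus lies so near a saddle connection that a quarter turn takes
longer than `τ` (`exists_slow`), while the other one makes many turns in the time `τ`
(`exists_fast`). Hence a path joining the two boundaries inside one quadrant is carried to a path
that winds around the annulus, and for each admissible number of crossed half-axes some piece of it
runs through exactly one quarter, from axis to axis (`exists_hump_crossing`).

Expansion: on a gap, `u'' = ν² u` is a linear saddle. For a long gap the image of a path through
quadrant II or IV passes through the hole of the annulus and leaves the annulus on both sides, in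
quadrants I and III. So it contains pieces crossing the annulus from boundary to boundary in each of
them (`exists_gap_crossing`), and the process can be repeated. The factor `4` per gap is the choice
of two quadrants at either end of it; the factor `β` per hump is the choice of the lap.

The starting path is a piece of the left arc. After the last hump, the stretched path joins two
opposite sides of a rectangle in the `(c, φ)` plane and a piece of the right arc joins the other
two, so they meet, by Poincaré--Miranda (`exists_common_point`). Induction over the humps is
`exists_orbit`. As `φ` increases strictly, zeros are counted by multiples of `π/2`
(`encard_zerosIn`); these counts and the visited quadrants recover the itinerary, so distinct
itineraries give distinct solutions.

For fixed `κ` the whole picture scales with the amplitude, which is why the bound on the gap length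
does not depend on `μ`. -/

/-- Unordered intervals `uIcc` are used so that a path may be run through in either direction; the
case `b ≤ a` is reduced to the other by `t ↦ -t`. -/
theorem exists_last {g : ℝ → ℝ} {a b m : ℝ} (hg : ContinuousOn g (uIcc a b)) (ha : g a ≤ m)
    (hb : m ≤ g b) : ∃ a' ∈ uIcc a b, g a' = m ∧ ∀ t ∈ uIcc a' b, m ≤ g t := by
  have key : ∀ (f : ℝ → ℝ) (x y : ℝ), x ≤ y → ContinuousOn f (Icc x y) → f x ≤ m → m ≤ f y →
      ∃ x' ∈ Icc x y, f x' = m ∧ ∀ t ∈ Icc x' y, m ≤ f t := by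
    intro f x y hxy hf hx hy
    have hS : IsCompact (Icc x y ∩ f ⁻¹' Iic m) :=
      isCompact_Icc.of_isClosed_subset (hf.preimage_isClosed_of_isClosed isClosed_Icc isClosed_Iic)
        inter_subset_left
    obtain ⟨x', ⟨hx'm, hx'f⟩, hmax⟩ := hS.exists_isGreatest ⟨x, left_mem_Icc.2 hxy, hx⟩
    have hsub : Icc x' y ⊆ Icc x y := Icc_subset_Icc_left hx'm.1
    obtain ⟨t, ht, htm⟩ := intermediate_value_Icc hx'm.2 (hf.mono hsub) ⟨hx'f, hy⟩
    have : t = x' := le_antisymm (hmax ⟨hsub ht, htm.le⟩) ht.1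
    subst this
    refine ⟨t, hx'm, htm, fun r hr => ?_⟩
    by_contra! h
    have := le_antisymm (hmax ⟨hsub hr, h.le⟩) hr.1
    rw [this] at h
    linarith
  rcases le_total a b with hab | hab
  · rw [uIcc_of_le hab] at hg ⊢
    obtain ⟨x, hx, h1, h2⟩ := key g a b hab hg ha hb
    exact ⟨x, hx, h1, by rwa [uIcc_of_le hx.2]⟩
  · rw [uIcc_of_ge hab] at hg ⊢
    obtain ⟨x, hx, h1, h2⟩ := key (fun t => g (-t)) (-a) (-b) (neg_le_neg hab)
      (hg.comp continuous_neg.continuousOn fun t ht => ⟨by linarith [ht.2], by linarith [ht.1]⟩)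
      (by simpa) (by simpa)
    refine ⟨-x, ⟨by linarith [hx.2], by linarith [hx.1]⟩, h1, fun t ht => ?_⟩
    rw [uIcc_of_ge (by linarith [hx.2])] at ht
    simpa using h2 (-t) ⟨by linarith [ht.2], by linarith [ht.1]⟩

theorem exists_first {g : ℝ → ℝ} {a b m : ℝ} (hg : ContinuousOn g (uIcc a b)) (ha : g a ≤ m)
    (hb : m ≤ g b) : ∃ b' ∈ uIcc a b, g b' = m ∧ ∀ t ∈ uIcc a b', g t ≤ m := by
  rw [uIcc_comm] at hg
  obtain ⟨x, hx, h1, h2⟩ := exists_last (g := fun t => -g t) (m := -m) hg.neg (by simpa) (by simpa)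
  exact ⟨x, by rwa [uIcc_comm], by simpa using h1,
    fun t ht => by simpa using h2 t (by rwa [uIcc_comm])⟩

/-- A path whose height runs from below `lo` to above `hi` has a piece which runs exactly from `lo`
to `hi`. -/
theorem exists_crossing {g : ℝ → ℝ} {a b lo hi : ℝ} (hg : ContinuousOn g (uIcc a b))
    (ha : g a ≤ lo) (hlh : lo ≤ hi) (hb : hi ≤ g b) :
    ∃ a' ∈ uIcc a b, ∃ b' ∈ uIcc a b, g a' = lo ∧ g b' = hi ∧
      ∀ t ∈ uIcc a' b', g t ∈ Icc lo hi := by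
  obtain ⟨b', hb', h1, h2⟩ := exists_first hg (ha.trans hlh) hb
  have hs : uIcc a b' ⊆ uIcc a b := uIcc_subset_uIcc left_mem_uIcc hb'
  obtain ⟨a', ha', h3, h4⟩ := exists_last (hg.mono hs) ha (hlh.trans h1.ge)
  exact ⟨a', hs ha', b', hb', h3, h1, fun t ht =>
    ⟨h4 t ht, h2 t (uIcc_subset_uIcc ha' right_mem_uIcc ht)⟩⟩

/-- A path from inside an annulus `{X ≤ x₂, E₁ ≤ e ≤ E₂}` to its exterior has a piece which crosses
the annulus. -/
theorem exists_annular_crossing {e X : ℝ → ℝ} {a b E₁ E₂ x₂ : ℝ} (he : ContinuousOn e (uIcc a b))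
    (hX : ContinuousOn X (uIcc a b)) (hE : E₁ ≤ E₂) (hea : e a ≤ E₁) (hXa : X a ≤ x₂)
    (hb : x₂ ≤ X b ∨ E₂ ≤ e b) (hedge : ∀ t ∈ uIcc a b, X t = x₂ → E₂ ≤ e t) :
    ∃ a' ∈ uIcc a b, ∃ b' ∈ uIcc a b, e a' = E₁ ∧ e b' = E₂ ∧
      ∀ t ∈ uIcc a' b', X t ≤ x₂ ∧ E₁ ≤ e t ∧ e t ≤ E₂ := by
  -- The first zero of this maximum is the first exit from the outer region; by `hedge`, an exit
  -- through `X = x₂` also has `e = E₂`.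
  obtain ⟨b', hb', h1, h2⟩ := exists_first (g := fun t => max (X t - x₂) (e t - E₂)) (m := 0)
    (ContinuousOn.sup (hX.sub continuousOn_const) (he.sub continuousOn_const))
    (by simp only [max_le_iff]; constructor <;> linarith)
    (by simp only [le_max_iff]; rcases hb with h | h; exacts [.inl (by linarith), .inr (by linarith)])
  simp only [max_le_iff] at h2
  have hs : uIcc a b' ⊆ uIcc a b := uIcc_subset_uIcc left_mem_uIcc hb'
  have heb : e b' = E₂ := by
    have hle := (h2 b' right_mem_uIcc)
    refine le_antisymm (by linarith) ?_
    rcases le_total (X b' - x₂) (e b' - E₂) with h | h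
    · rw [max_eq_right h] at h1; linarith
    · rw [max_eq_left h] at h1; exact hedge b' hb' (by linarith)
  obtain ⟨a', ha', h3, h4⟩ := exists_last (he.mono hs) hea (hE.trans heb.ge)
  refine ⟨a', hs ha', b', hb', h3, heb, fun t ht => ?_⟩
  have := h2 t (uIcc_subset_uIcc ha' right_mem_uIcc ht)
  exact ⟨by linarith, h4 t ht, by linarith⟩

/-- Where `cos ≥ 0` the sine increases with the angle, so a net decrease of the angle would force
`sin` to vanish at `ψ 1` and to stay `≤ 0` just above it, although `cos (ψ 1) > 0`. -/
theorem le_of_cos_nonneg_of_sin {ψ : ℝ → ℝ} (hψ : ContinuousOn ψ (Icc 0 1))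
    (hc : ∀ t ∈ Icc (0 : ℝ) 1, 0 ≤ Real.cos (ψ t)) (h0 : Real.sin (ψ 0) ≤ 0)
    (h1 : 0 ≤ Real.sin (ψ 1)) : ψ 0 ≤ ψ 1 := by
  by_contra! hlt
  have hcos : ∀ x ∈ Icc (ψ 1) (ψ 0), 0 ≤ Real.cos x := by
    intro x hx
    obtain ⟨t, ht, rfl⟩ := intermediate_value_Icc' zero_le_one hψ hx
    exact hc t ht
  have hmono : MonotoneOn Real.sin (Icc (ψ 1) (ψ 0)) := by
    refine monotoneOn_of_deriv_nonneg (convex_Icc _ _) Real.continuous_sin.continuousOn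
      Real.differentiable_sin.differentiableOn fun x hx => ?_
    rw [Real.deriv_sin]
    exact hcos x (interior_subset hx)
  set ε := min (ψ 0 - ψ 1) 1 with hε
  have hε0 : 0 < ε := lt_min (by linarith) one_pos
  have hm : ψ 1 + ε ∈ Icc (ψ 1) (ψ 0) := ⟨by linarith, by linarith [min_le_left (ψ 0 - ψ 1) 1]⟩
  have hl : ψ 1 ∈ Icc (ψ 1) (ψ 0) := ⟨le_rfl, hlt.le⟩
  have hr : ψ 0 ∈ Icc (ψ 1) (ψ 0) := ⟨hlt.le, le_rfl⟩
  have e1 : Real.sin (ψ 1) = 0 := le_antisymm ((hmono hl hr hlt.le).trans h0) h1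
  have e2 : Real.sin (ψ 1 + ε) ≤ 0 := (hmono hm hr hm.2).trans h0
  have e3 : 0 < Real.sin ε :=
    Real.sin_pos_of_pos_of_lt_pi hε0 (by linarith [min_le_right (ψ 0 - ψ 1) 1, Real.pi_gt_three])
  have e4 := Real.sin_sq_add_cos_sq (ψ 1)
  rw [Real.sin_add, e1] at e2
  have e5 := hcos _ hl
  have e6 : 0 < Real.cos (ψ 1) := by
    rcases e5.lt_or_eq with h | h
    · exact h
    · rw [e1, ← h] at e4; norm_num at e4
  nlinarith [mul_pos e6 e3]

/-- The Poincaré--Miranda theorem in the plane. -/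
theorem exists_zero_of_sign_change {f g : ℝ × ℝ → ℝ}
    (hf : ContinuousOn f (Icc 0 1 ×ˢ Icc 0 1)) (hg : ContinuousOn g (Icc 0 1 ×ˢ Icc 0 1))
    (hf0 : ∀ t ∈ Icc (0 : ℝ) 1, f (0, t) ≤ 0) (hf1 : ∀ t ∈ Icc (0 : ℝ) 1, 0 ≤ f (1, t))
    (hg0 : ∀ s ∈ Icc (0 : ℝ) 1, g (s, 0) ≤ 0) (hg1 : ∀ s ∈ Icc (0 : ℝ) 1, 0 ≤ g (s, 1)) :
    ∃ s ∈ Icc (0 : ℝ) 1, ∃ t ∈ Icc (0 : ℝ) 1, f (s, t) = 0 ∧ g (s, t) = 0 := by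
  by_contra! hne
  let π : ℝ × ℝ → ℝ × ℝ := fun z =>
    (projIcc (0 : ℝ) 1 zero_le_one z.1, projIcc (0 : ℝ) 1 zero_le_one z.2)
  have hπ : Continuous π :=
    (continuous_subtype_val.comp (continuous_projIcc.comp continuous_fst)).prodMk
      (continuous_subtype_val.comp (continuous_projIcc.comp continuous_snd))
  have hπm : ∀ z, π z ∈ Icc (0 : ℝ) 1 ×ˢ Icc (0 : ℝ) 1 := fun z => ⟨Subtype.coe_prop _,
    Subtype.coe_prop _⟩
  have hπe : ∀ s ∈ Icc (0 : ℝ) 1, ∀ t ∈ Icc (0 : ℝ) 1, π (s, t) = (s, t) := by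
    intro s hs t ht
    simp only [π, projIcc_of_mem _ hs, projIcc_of_mem _ ht]
  -- If there is no common zero, `f + i g`, extended to the plane by projection onto the square, has
  -- a continuous logarithm `l`, whose imaginary part is a continuous argument.
  let h : ℝ × ℝ → ℂ := fun z => ⟨f (π z), g (π z)⟩
  have hfc : Continuous fun z => f (π z) := hf.comp_continuous hπ hπm
  have hgc : Continuous fun z => g (π z) := hg.comp_continuous hπ hπm
  have hh : Continuous h := by
    have : h = fun z => ((f (π z) : ℝ) : ℂ) + ((g (π z) : ℝ) : ℂ) * Complex.I := by
      ext z; exact Complex.mk_eq_add_mul_I _ _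
    rw [this]
    exact (Complex.continuous_ofReal.comp hfc).add
      ((Complex.continuous_ofReal.comp hgc).mul continuous_const)
  have h0 : (0 : ℂ) ∉ h '' univ := by
    rintro ⟨z, -, hz⟩
    have h1 : f (π z) = 0 := congrArg Complex.re hz
    have h2 : g (π z) = 0 := congrArg Complex.im hz
    exact hne (π z).1 (hπm z).1 (π z).2 (hπm z).2 h1 h2
  have hsc : IsSimplyConnected (univ : Set (ℝ × ℝ)) := by
    have : ContractibleSpace (univ : Set (ℝ × ℝ)) := convex_univ.contractibleSpace univ_nonempty
    exact SimplyConnectedSpace.ofContractible _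
  obtain ⟨l, hl, hle⟩ := Complex.exists_continuousOn_eqOn_exp_comp hsc isOpen_univ
    hh.continuousOn h0
  have hlc : Continuous fun z => (l z).im :=
    Complex.continuous_im.comp (continuousOn_univ.1 hl)
  have hre : ∀ s ∈ Icc (0 : ℝ) 1, ∀ t ∈ Icc (0 : ℝ) 1,
      f (s, t) = Real.exp (l (s, t)).re * Real.cos (l (s, t)).im := by
    intro s hs t ht
    have := congrArg Complex.re (hle (mem_univ (s, t)))
    simp only [Function.comp, Complex.exp_re, h, hπe s hs t ht] at this
    exact this.symm
  have him : ∀ s ∈ Icc (0 : ℝ) 1, ∀ t ∈ Icc (0 : ℝ) 1,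
      g (s, t) = Real.exp (l (s, t)).re * Real.sin (l (s, t)).im := by
    intro s hs t ht
    have := congrArg Complex.im (hle (mem_univ (s, t)))
    simp only [Function.comp, Complex.exp_im, h, hπe s hs t ht] at this
    exact this.symm
  have m0 : (0 : ℝ) ∈ Icc (0 : ℝ) 1 := left_mem_Icc.2 zero_le_one
  have m1 : (1 : ℝ) ∈ Icc (0 : ℝ) 1 := right_mem_Icc.2 zero_le_one
  have c1 : ∀ t ∈ Icc (0 : ℝ) 1, 0 ≤ Real.cos (l (1, t)).im := fun t ht => by
    have := hf1 t ht
    rw [hre 1 m1 t ht] at this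
    exact nonneg_of_mul_nonneg_right this (Real.exp_pos _)
  have c0 : ∀ t ∈ Icc (0 : ℝ) 1, Real.cos (l (0, t)).im ≤ 0 := fun t ht => by
    have := hf0 t ht
    rw [hre 0 m0 t ht] at this
    exact nonpos_of_mul_nonpos_right this (Real.exp_pos _)
  have s1 : ∀ t ∈ Icc (0 : ℝ) 1, 0 ≤ Real.sin (l (t, 1)).im := fun t ht => by
    have := hg1 t ht
    rw [him t ht 1 m1] at this
    exact nonneg_of_mul_nonneg_right this (Real.exp_pos _)
  have s0 : ∀ t ∈ Icc (0 : ℝ) 1, Real.sin (l (t, 0)).im ≤ 0 := fun t ht => by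
    have := hg0 t ht
    rw [him t ht 0 m0] at this
    exact nonpos_of_mul_nonpos_right this (Real.exp_pos _)
  -- Along the four sides, taken counterclockwise and rotated back by quarter turns, the argument
  -- does not decrease. Since it returns to its initial value, it agrees at all corners.
  have a1 : (l (1, 0)).im ≤ (l (1, 1)).im :=
    le_of_cos_nonneg_of_sin (ψ := fun t => (l (1, t)).im)
      (hlc.comp (by fun_prop)).continuousOn c1 (s0 1 m1) (s1 1 m1)
  have a2 := le_of_cos_nonneg_of_sin (ψ := fun t => (l (1 - t, 1)).im - Real.pi / 2)
      ((hlc.comp (g := fun z => (l z).im) (f := fun t : ℝ => (1 - t, (1 : ℝ)))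
        (by fun_prop)).sub continuous_const).continuousOn
      (fun t ht => by
        rw [Real.cos_sub_pi_div_two]; exact s1 _ ⟨by linarith [ht.2], by linarith [ht.1]⟩)
      (by rw [Real.sin_sub_pi_div_two]; simpa using c1 1 m1)
      (by rw [Real.sin_sub_pi_div_two]; simpa using c0 1 m1)
  have a3 := le_of_cos_nonneg_of_sin (ψ := fun t => (l (0, 1 - t)).im - Real.pi)
      ((hlc.comp (g := fun z => (l z).im) (f := fun t : ℝ => ((0 : ℝ), 1 - t))
        (by fun_prop)).sub continuous_const).continuousOn
      (fun t ht => by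
        rw [Real.cos_sub_pi]; simpa using c0 (1 - t) ⟨by linarith [ht.2], by linarith [ht.1]⟩)
      (by rw [Real.sin_sub_pi]; simpa using s1 0 m0)
      (by rw [Real.sin_sub_pi]; simpa using s0 0 m0)
  have a4 := le_of_cos_nonneg_of_sin (ψ := fun t => (l (t, 0)).im + Real.pi / 2)
      ((hlc.comp (g := fun z => (l z).im) (f := fun t : ℝ => (t, (0 : ℝ)))
        (by fun_prop)).add continuous_const).continuousOn
      (fun t ht => by rw [Real.cos_add_pi_div_two]; simpa using s0 t ht)
      (by rw [Real.sin_add_pi_div_two]; simpa using c0 0 m0)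
      (by rw [Real.sin_add_pi_div_two]; simpa using c1 0 m0)
  simp only [sub_zero, sub_self] at a2 a3
  have b1 : (l (1, 0)).im = (l (1, 1)).im := by linarith
  have b2 : (l (0, 0)).im = (l (1, 1)).im := by linarith
  have b3 : (l (0, 1)).im = (l (1, 1)).im := by linarith
  -- The opposite corners `(1, 1)` and `(0, 0)` put this common argument in opposite closed
  -- quadrants, so its sine and cosine both vanish.
  have d1 := c1 1 m1
  have d2 := c0 0 m0
  have d3 := s1 1 m1
  have d4 := s0 0 m0
  rw [b2] at d2 d4
  have := Real.sin_sq_add_cos_sq (l (1, 1)).im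
  rw [le_antisymm d2 d1, le_antisymm d4 d3] at this
  norm_num at this

/-- Two paths in a rectangle, one joining the bottom to the top and the other one joining the left
side to the right side, meet. -/
theorem exists_common_point {c φ c' φ' : ℝ → ℝ} {a b a' b' x₁ x₂ lo hi : ℝ}
    (hc : ContinuousOn c (uIcc a b)) (hφ : ContinuousOn φ (uIcc a b))
    (hc' : ContinuousOn c' (uIcc a' b')) (hφ' : ContinuousOn φ' (uIcc a' b'))
    (hcm : ∀ s ∈ uIcc a b, c s ∈ Icc x₁ x₂) (hφm : ∀ t ∈ uIcc a' b', φ' t ∈ Icc lo hi)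
    (ha : φ a = lo) (hb : φ b = hi) (ha' : c' a' = x₁) (hb' : c' b' = x₂) :
    ∃ s ∈ uIcc a b, ∃ t ∈ uIcc a' b', c s = c' t ∧ φ s = φ' t := by
  let α : ℝ → ℝ := fun s => a + s * (b - a)
  let α' : ℝ → ℝ := fun s => a' + s * (b' - a')
  have hmem : ∀ x y : ℝ, ∀ s ∈ Icc (0 : ℝ) 1, x + s * (y - x) ∈ uIcc x y := by
    intro x y s hs
    rw [← segment_eq_uIcc, segment_eq_image']
    exact ⟨s, hs, rfl⟩
  have hα : Continuous fun z : ℝ × ℝ => α z.1 := by fun_prop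
  have hα' : Continuous fun z : ℝ × ℝ => α' z.2 := by fun_prop
  have hm : MapsTo (fun z : ℝ × ℝ => α z.1) (Icc 0 1 ×ˢ Icc 0 1) (uIcc a b) :=
    fun z hz => hmem a b _ hz.1
  have hm' : MapsTo (fun z : ℝ × ℝ => α' z.2) (Icc 0 1 ×ˢ Icc 0 1) (uIcc a' b') :=
    fun z hz => hmem a' b' _ hz.2
  have m0 : (0 : ℝ) ∈ Icc (0 : ℝ) 1 := left_mem_Icc.2 zero_le_one
  have m1 : (1 : ℝ) ∈ Icc (0 : ℝ) 1 := right_mem_Icc.2 zero_le_one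
  obtain ⟨s, hs, t, ht, h1, h2⟩ := exists_zero_of_sign_change
    (f := fun z => φ (α z.1) - φ' (α' z.2)) (g := fun z => c' (α' z.2) - c (α z.1))
    ((hφ.comp hα.continuousOn hm).sub (hφ'.comp hα'.continuousOn hm'))
    ((hc'.comp hα'.continuousOn hm').sub (hc.comp hα.continuousOn hm))
    (fun t ht => by
      have := (hφm _ (hmem a' b' t ht)).1
      simp only [α, α', zero_mul, add_zero, ha]; linarith)
    (fun t ht => by
      have := (hφm _ (hmem a' b' t ht)).2
      simp only [α, α', one_mul, add_sub_cancel, hb]; linarith)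
    (fun t ht => by
      have := (hcm _ (hmem a b t ht)).1
      simp only [α, α', zero_mul, add_zero, ha']; linarith)
    (fun t ht => by
      have := (hcm _ (hmem a b t ht)).2
      simp only [α, α', one_mul, add_sub_cancel, hb']; linarith)
  exact ⟨_, hmem a b s hs, _, hmem a' b' t ht, by simp only [α, α'] at *; linarith,
    by simp only [α, α'] at *; linarith⟩

/-! ### Scalar equations `φ' = ω κ φ` with a positive right-hand side depending on a parameter -/

/-- A continuous family of angular speeds, bounded below by a positive constant. -/
structure IsSpeed (ω : ℝ → ℝ → ℝ) : Prop where
  cont : Continuous fun z : ℝ × ℝ => ω z.1 z.2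
  lower : ∃ m > 0, ∀ κ φ, m ≤ ω κ φ
  upper : ∀ κ, ∃ B, ∀ φ, ω κ φ ≤ B

/-- The time needed to turn from the angle `0` to the angle `φ`. -/
def clock (ω : ℝ → ℝ → ℝ) (κ φ : ℝ) : ℝ := ∫ ψ in (0 : ℝ)..φ, (ω κ ψ)⁻¹

/-- The angle reached from `φ` after the time `t`. -/
def turn (ω : ℝ → ℝ → ℝ) (κ φ t : ℝ) : ℝ := Function.invFun (clock ω κ) (clock ω κ φ + t)

namespace IsSpeed

variable {ω : ℝ → ℝ → ℝ} (h : IsSpeed ω)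

include h

theorem pos (κ φ : ℝ) : 0 < ω κ φ := by
  obtain ⟨m, hm, hl⟩ := h.lower
  exact hm.trans_le (hl κ φ)

theorem continuous_inv : Continuous fun z : ℝ × ℝ => (ω z.1 z.2)⁻¹ :=
  h.cont.inv₀ fun _ => (h.pos _ _).ne'

theorem continuous_inv_right (κ : ℝ) : Continuous fun ψ => (ω κ ψ)⁻¹ :=
  h.continuous_inv.comp (Continuous.prodMk_right κ)

theorem continuous_clock : Continuous fun z : ℝ × ℝ => clock ω z.1 z.2 :=
  intervalIntegral.continuous_parametric_intervalIntegral_of_continuous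
    (f := fun (z : ℝ × ℝ) ψ => (ω z.1 ψ)⁻¹)
    (h.continuous_inv.comp (f := fun z : (ℝ × ℝ) × ℝ => (z.1.1, z.2)) (by fun_prop)) continuous_snd

theorem hasDerivAt_clock (κ φ : ℝ) : HasDerivAt (clock ω κ) (ω κ φ)⁻¹ φ :=
  (h.continuous_inv_right κ).integral_hasStrictDerivAt 0 φ |>.hasDerivAt

theorem strictMono_clock (κ : ℝ) : StrictMono (clock ω κ) :=
  strictMono_of_deriv_pos fun φ => by
    rw [(h.hasDerivAt_clock κ φ).deriv]
    exact inv_pos.2 (h.pos κ φ)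

theorem clock_sub (κ x y : ℝ) : clock ω κ y - clock ω κ x = ∫ ψ in x..y, (ω κ ψ)⁻¹ :=
  intervalIntegral.integral_interval_sub_left ((h.continuous_inv_right κ).intervalIntegrable _ _)
    ((h.continuous_inv_right κ).intervalIntegrable _ _)

theorem clock_sub_le {κ m x y : ℝ} (hm : 0 < m) (hl : ∀ φ, m ≤ ω κ φ) (hxy : x ≤ y) :
    clock ω κ y - clock ω κ x ≤ (y - x) / m := by
  rw [h.clock_sub]
  calc ∫ ψ in x..y, (ω κ ψ)⁻¹ ≤ ∫ ψ in x..y, m⁻¹ :=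
        intervalIntegral.integral_mono_on hxy ((h.continuous_inv_right κ).intervalIntegrable _ _)
          (by simp) fun ψ _ => inv_anti₀ hm (hl ψ)
    _ = (y - x) / m := by simp [div_eq_mul_inv]

theorem le_clock_sub {κ B x y : ℝ} (hl : ∀ φ, ω κ φ ≤ B) (hxy : x ≤ y) :
    (y - x) / B ≤ clock ω κ y - clock ω κ x := by
  rw [h.clock_sub]
  calc (y - x) / B = ∫ ψ in x..y, B⁻¹ := by simp [div_eq_mul_inv]
    _ ≤ ∫ ψ in x..y, (ω κ ψ)⁻¹ :=
        intervalIntegral.integral_mono_on hxy (by simp)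
          ((h.continuous_inv_right κ).intervalIntegrable _ _)
          fun ψ _ => inv_anti₀ (h.pos κ ψ) (hl ψ)

theorem clock_surjective (κ : ℝ) : Function.Surjective (clock ω κ) := by
  obtain ⟨B, hB⟩ := h.upper κ
  have hB0 : 0 < B := (h.pos κ 0).trans_le (hB 0)
  have hc : Continuous (clock ω κ) := h.continuous_clock.comp (Continuous.prodMk_right κ)
  have h0 : clock ω κ 0 = 0 := by simp [clock]
  refine hc.surjective ?_ ?_
  · refine tendsto_atTop_mono' _ ?_ (tendsto_id.atTop_div_const hB0)
    filter_upwards [eventually_ge_atTop 0] with x hx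
    simpa [h0] using h.le_clock_sub hB hx
  · refine tendsto_atBot_mono' _ ?_ (tendsto_id.atBot_div_const hB0)
    filter_upwards [eventually_le_atBot 0] with x hx
    have := h.le_clock_sub hB hx
    rw [h0, zero_sub, neg_div] at this
    simp only [id]; linarith

theorem clock_turn (κ φ t : ℝ) : clock ω κ (turn ω κ φ t) = clock ω κ φ + t :=
  Function.rightInverse_invFun (h.clock_surjective κ) _

theorem turn_zero (κ φ : ℝ) : turn ω κ φ 0 = φ :=
  (h.strictMono_clock κ).injective (by rw [h.clock_turn, add_zero])

theorem strictMono_turn (κ φ : ℝ) : StrictMono (turn ω κ φ) := fun s t hst => by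
  rw [← (h.strictMono_clock κ).lt_iff_lt, h.clock_turn, h.clock_turn]
  linarith

/-- Since `clock` increases strictly in the angle, `turn < x` is equivalent to a strict inequality
between jointly continuous clock values, hence is an open condition. -/
theorem continuous_turn : Continuous fun z : (ℝ × ℝ) × ℝ => turn ω z.1.1 z.1.2 z.2 := by
  rw [continuous_iff_continuousAt]
  rintro ⟨⟨κ, φ⟩, t⟩
  have hc1 : Continuous fun z : (ℝ × ℝ) × ℝ => clock ω z.1.1 z.1.2 + z.2 :=
    (h.continuous_clock.comp continuous_fst).add continuous_snd
  have hc2 : ∀ x, Continuous fun z : (ℝ × ℝ) × ℝ => clock ω z.1.1 x := fun x =>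
    h.continuous_clock.comp (f := fun z : (ℝ × ℝ) × ℝ => (z.1.1, x)) (by fun_prop)
  rw [ContinuousAt, tendsto_order]
  constructor
  · intro x hx
    rw [← (h.strictMono_clock κ).lt_iff_lt, h.clock_turn] at hx
    filter_upwards [((hc2 x).continuousAt (x := ((κ, φ), t))).eventually_lt hc1.continuousAt hx]
      with z hz
    rwa [← (h.strictMono_clock z.1.1).lt_iff_lt, h.clock_turn]
  · intro x hx
    rw [gt_iff_lt, ← (h.strictMono_clock κ).lt_iff_lt, h.clock_turn] at hx
    filter_upwards [(hc1.continuousAt (x := ((κ, φ), t))).eventually_lt (hc2 x).continuousAt hx]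
      with z hz
    rwa [← (h.strictMono_clock z.1.1).lt_iff_lt, h.clock_turn]

theorem hasDerivAt_turn (κ φ t : ℝ) : HasDerivAt (turn ω κ φ) (ω κ (turn ω κ φ t)) t := by
  have hc : Continuous (turn ω κ φ) := h.continuous_turn.comp (Continuous.prodMk_right (κ, φ))
  have := HasDerivAt.of_local_left_inverse (f := fun x => clock ω κ x - clock ω κ φ)
    hc.continuousAt ((h.hasDerivAt_clock κ (turn ω κ φ t)).sub_const _)
    (inv_ne_zero (h.pos _ _).ne') (.of_forall fun s => by rw [h.clock_turn]; ring)
  simpa using this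

theorem add_mul_le_turn {κ m : ℝ} (hm : 0 < m) (hl : ∀ φ, m ≤ ω κ φ) (φ : ℝ) {t : ℝ}
    (ht : 0 ≤ t) : φ + m * t ≤ turn ω κ φ t := by
  have h1 : φ ≤ turn ω κ φ t := by
    conv_lhs => rw [← h.turn_zero κ φ]
    exact (h.strictMono_turn κ φ).monotone ht
  have h2 := h.clock_sub_le hm hl h1
  rw [h.clock_turn, le_div_iff₀ hm] at h2
  linarith

/-- If the speed is even and `π`-periodic, then every quarter turn takes the same time. -/
theorem clock_quarter {κ : ℝ} (he : ∀ φ, ω κ (-φ) = ω κ φ)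
    (hp : ∀ φ, ω κ (φ + Real.pi) = ω κ φ) (k : ℕ) :
    clock ω κ (k * (Real.pi / 2)) = k * clock ω κ (Real.pi / 2) := by
  have half : ∀ k : ℕ, clock ω κ ((k + 1 : ℕ) * (Real.pi / 2)) - clock ω κ (k * (Real.pi / 2)) =
      clock ω κ (Real.pi / 2) := by
    intro k
    -- The period `π` shifts by two quarters. The second quarter is moved to `[-π/2, 0]` by the
    -- period and then to the first one by evenness.
    induction k using Nat.twoStepInduction with
    | zero => simp [clock]
    | one =>
      rw [h.clock_sub]
      have h1 : ∫ ψ in (-(Real.pi / 2))..0, (ω κ ψ)⁻¹ = clock ω κ (Real.pi / 2) := by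
        have := intervalIntegral.integral_comp_neg (a := 0) (b := Real.pi / 2)
          (fun ψ => (ω κ ψ)⁻¹)
        rw [neg_zero] at this
        rw [← this]
        simp only [he, clock]
      have h2 := intervalIntegral.integral_comp_add_right (a := -(Real.pi / 2)) (b := 0)
        (fun ψ => (ω κ ψ)⁻¹) Real.pi
      simp only [hp] at h2
      rw [← h1, h2]
      congr 1 <;> push_cast <;> ring
    | more k ih _ =>
      rw [← ih, h.clock_sub, h.clock_sub]
      have h2 := intervalIntegral.integral_comp_add_right (a := k * (Real.pi / 2))
        (b := (k + 1 : ℕ) * (Real.pi / 2)) (fun ψ => (ω κ ψ)⁻¹) Real.pi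
      simp only [hp] at h2
      rw [h2]
      congr 1 <;> push_cast <;> ring
  induction k with
  | zero => simp [clock]
  | succ k ih =>
    have := half k
    rw [ih] at this
    push_cast at this ⊢
    linarith

/-- Slow orbits cannot complete the quarter after the one they start in. This is why only passages
with at least two crossed half-axes are admissible. -/
theorem turn_lt_of_slow {κ τ : ℝ} (he : ∀ φ, ω κ (-φ) = ω κ φ)
    (hp : ∀ φ, ω κ (φ + Real.pi) = ω κ φ) (hτ : τ < clock ω κ (Real.pi / 2)) {k : ℕ} {φ : ℝ}
    (hφ : φ ≤ (k + 1) * (Real.pi / 2)) : turn ω κ φ τ < (k + 2) * (Real.pi / 2) := by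
  rw [← (h.strictMono_clock κ).lt_iff_lt, h.clock_turn]
  have h1 := (h.strictMono_clock κ).monotone hφ
  have h2 := h.clock_quarter he hp (k + 1)
  have h3 := h.clock_quarter he hp (k + 2)
  push_cast at h2 h3
  rw [h2] at h1
  rw [h3]
  linarith

end IsSpeed

/-! ### The angular speed of the autonomous equation -/

/-- The mean of `σ ^ p` over `[s, 1]`. -/
def meanPow (p s : ℝ) : ℝ := ∫ r in (0 : ℝ)..1, (s + (1 - s) * r) ^ p

theorem continuous_meanPow {p : ℝ} (hp : 0 < p) : Continuous (meanPow p) :=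
  intervalIntegral.continuous_parametric_intervalIntegral_of_continuous'
    (f := fun s r => (s + (1 - s) * r) ^ p)
    (Continuous.rpow_const (by fun_prop) fun _ => .inr hp.le) 0 1

/-- This is how the mean removes the singularity of `(1 - s^(p+1)) / (1 - s)` at `s = 1`, which
corresponds to the points of an orbit on the `x`-axis. -/
theorem one_sub_mul_meanPow {p : ℝ} (hp : 0 < p) (s : ℝ) :
    (1 - s) * meanPow p s = (1 - s ^ (p + 1)) / (p + 1) := by
  have h := intervalIntegral.mul_integral_comp_add_mul (a := 0) (b := 1)
    (f := fun x : ℝ => x ^ p) (1 - s) s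
  rw [meanPow, h, integral_rpow (.inl (by linarith))]
  simp

theorem meanPow_one (p : ℝ) : meanPow p 1 = 1 := by simp [meanPow]

theorem intervalIntegrable_meanPow {p : ℝ} (hp : 0 < p) (s : ℝ) :
    IntervalIntegrable (fun r : ℝ => (s + (1 - s) * r) ^ p) volume 0 1 :=
  (Continuous.rpow_const (by fun_prop) fun _ => .inr hp.le).intervalIntegrable _ _

theorem integral_segment (s : ℝ) : ∫ r in (0 : ℝ)..1, (s + (1 - s) * r) = (1 + s) / 2 := by
  rw [intervalIntegral.integral_add (by simp) (Continuous.intervalIntegrable (by fun_prop) _ _),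
    intervalIntegral.integral_const, intervalIntegral.integral_const_mul, integral_id]
  simp; ring

theorem segment_mem {s r : ℝ} (hs : s ∈ Icc (0 : ℝ) 1) (hr : r ∈ Icc (0 : ℝ) 1) :
    s + (1 - s) * r ∈ Icc (0 : ℝ) 1 :=
  ⟨by nlinarith [hs.1, hs.2, hr.1], by nlinarith [hs.1, hs.2, hr.2]⟩

theorem meanPow_le_one {p s : ℝ} (hp : 0 < p) (hs : s ∈ Icc (0 : ℝ) 1) : meanPow p s ≤ 1 := by
  calc meanPow p s ≤ ∫ r in (0 : ℝ)..1, (1 : ℝ) :=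
        intervalIntegral.integral_mono_on zero_le_one (intervalIntegrable_meanPow hp s) (by simp)
          fun r hr => Real.rpow_le_one (segment_mem hs hr).1 (segment_mem hs hr).2 hp.le
    _ = 1 := by simp

theorem le_meanPow_of_le_one {p s : ℝ} (hp : 0 < p) (hp1 : p ≤ 1) (hs : s ∈ Icc (0 : ℝ) 1) :
    (1 + s) / 2 ≤ meanPow p s := by
  rw [← integral_segment]
  refine intervalIntegral.integral_mono_on zero_le_one
    (Continuous.intervalIntegrable (by fun_prop) _ _) (intervalIntegrable_meanPow hp s)
    fun r hr => ?_
  have := segment_mem hs hr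
  exact Real.self_le_rpow_of_le_one this.1 this.2 hp1

/-- The factor through which the angular speed depends on the angle. -/
def shape (p φ : ℝ) : ℝ := 2 * meanPow p |Real.sin φ| / (1 + |Real.sin φ|)

theorem abs_sin_mem (φ : ℝ) : |Real.sin φ| ∈ Icc (0 : ℝ) 1 := ⟨abs_nonneg _, Real.abs_sin_le_one φ⟩

theorem continuous_shape {p : ℝ} (hp : 0 < p) : Continuous (shape p) :=
  (((continuous_meanPow hp).comp Real.continuous_sin.abs).const_mul 2).div
    (continuous_const.add Real.continuous_sin.abs) fun φ => by
      have := (abs_sin_mem φ).1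
      simp only [ne_eq]; positivity

theorem shape_neg (p φ : ℝ) : shape p (-φ) = shape p φ := by simp [shape]

theorem shape_add_pi (p φ : ℝ) : shape p (φ + Real.pi) = shape p φ := by
  simp [shape, Real.sin_add_pi]

theorem shape_congr (p : ℝ) {φ ψ : ℝ} (h : Real.sin φ = Real.sin ψ) : shape p φ = shape p ψ := by
  simp [shape, h]

theorem cos_sq_mul_shape {p : ℝ} (hp : 0 < p) (φ : ℝ) :
    Real.cos φ ^ 2 * shape p φ = 2 * ((1 - |Real.sin φ| ^ (p + 1)) / (p + 1)) := by
  have h0 := (abs_sin_mem φ).1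
  have h1 : Real.cos φ ^ 2 = (1 - |Real.sin φ|) * (1 + |Real.sin φ|) := by
    rw [Real.cos_sq', ← sq_abs]; ring
  rw [← one_sub_mul_meanPow hp, shape, h1]
  have : 1 + |Real.sin φ| ≠ 0 := by positivity
  field_simp

theorem shape_le_two {p : ℝ} (hp : 0 < p) (φ : ℝ) : shape p φ ≤ 2 := by
  have h0 := abs_sin_mem φ
  have := meanPow_le_one hp h0
  rw [shape, div_le_iff₀ (by linarith [h0.1])]
  linarith [h0.1]

theorem one_le_shape {p : ℝ} (hp : 0 < p) (hp1 : p ≤ 1) (φ : ℝ) : 1 ≤ shape p φ := by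
  have h0 := abs_sin_mem φ
  have := le_meanPow_of_le_one hp hp1 h0
  rw [shape, le_div_iff₀ (by linarith [h0.1])]
  linarith

/-- For `p ≤ 1` the minimum of `shape` is `1`, attained at `π/2`; this bound says that it is left at
most quadratically, which makes orbits slow there. -/
theorem shape_le_one_add {p : ℝ} (hp : 0 < p) (φ : ℝ) : shape p φ ≤ 1 + Real.cos φ ^ 2 := by
  have h0 := abs_sin_mem φ
  have := meanPow_le_one hp h0
  rw [shape, div_le_iff₀ (by linarith [h0.1]), Real.cos_sq', ← sq_abs]
  nlinarith [h0.1, h0.2, mul_nonneg h0.1 (sub_nonneg.2 h0.2)]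

theorem shape_pi_div_two (p : ℝ) : shape p (Real.pi / 2) = 1 := by
  simp [shape, meanPow_one]; norm_num

theorem shape_of_cos_eq_zero (p : ℝ) {φ : ℝ} (h : Real.cos φ = 0) : shape p φ = 1 := by
  have : |Real.sin φ| = 1 := by
    have := Real.sin_sq_add_cos_sq φ
    rw [h] at this
    rw [← sq_eq_sq₀ (abs_nonneg _) zero_le_one, sq_abs]; linarith
  rw [shape, this, meanPow_one]; norm_num

/-- For `|sin φ| ≤ 1` and `p ≥ 1` one has `|sin φ|^(p+1) ≤ sin² φ`; divide the resulting bound by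
`cos² φ`. -/
theorem two_div_le_shape {p : ℝ} (hp1 : 1 ≤ p) (φ : ℝ) : 2 / (p + 1) ≤ shape p φ := by
  have h0 := abs_sin_mem φ
  rcases eq_or_ne (Real.cos φ) 0 with hc | hc
  · rw [shape_of_cos_eq_zero p hc, div_le_one (by linarith)]; linarith
  · have hc2 : 0 < Real.cos φ ^ 2 := by positivity
    rw [← mul_le_mul_iff_right₀ hc2, cos_sq_mul_shape (by linarith)]
    have h1 : |Real.sin φ| ^ (p + 1) ≤ |Real.sin φ| ^ (2 : ℝ) :=
      Real.rpow_le_rpow_of_exponent_ge' h0.1 h0.2 (by norm_num) (by linarith)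
    rw [Real.rpow_two, sq_abs] at h1
    have h2 := Real.sin_sq_add_cos_sq φ
    rw [mul_div_assoc', mul_div_assoc']
    gcongr ?_ / _
    linarith

/-- The counterpart of `shape_le_one_add` for `p ≥ 1`, where the minimum `2 / (p + 1)` is attained
at `φ = 0`. -/
theorem shape_le_of_one_le {p : ℝ} (hp1 : 1 ≤ p) (φ : ℝ) :
    shape p φ ≤ 2 / (p + 1) + 4 * Real.sin φ ^ 2 := by
  have hp : 0 < p := by linarith
  have h0 := abs_sin_mem φ
  have h2 := Real.sin_sq_add_cos_sq φ
  have hq : 0 < 2 / (p + 1) := by positivity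
  rcases le_total (1 / 2) (Real.sin φ ^ 2) with hs | hs
  · linarith [shape_le_two hp φ]
  · have hc2 : 0 < Real.cos φ ^ 2 := by linarith
    have hq1 : 2 / (p + 1) ≤ 1 := by rw [div_le_one (by linarith)]; linarith
    rw [← mul_le_mul_iff_right₀ hc2, cos_sq_mul_shape hp]
    have h1 : 0 ≤ |Real.sin φ| ^ (p + 1) := Real.rpow_nonneg h0.1 _
    calc 2 * ((1 - |Real.sin φ| ^ (p + 1)) / (p + 1))
        = 2 / (p + 1) * (1 - |Real.sin φ| ^ (p + 1)) := by ring
      _ ≤ 2 / (p + 1) * 1 := by gcongr; linarith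
      _ ≤ Real.cos φ ^ 2 * (2 / (p + 1) + 4 * Real.sin φ ^ 2) := by
        have : Real.cos φ ^ 2 = 1 - Real.sin φ ^ 2 := by linarith
        rw [this]
        nlinarith [sq_nonneg (Real.sin φ)]

/-- The angular speed in the coordinates `(c, φ)`, where `c` is the amplitude of an orbit and
`κ = μ c ^ (p - 1)`. The parameter is truncated at `κ₀`. -/
def speed (lam p κ₀ κ φ : ℝ) : ℝ := √(max κ κ₀ * shape p φ + lam)

theorem speed_neg (lam p κ₀ κ φ : ℝ) : speed lam p κ₀ κ (-φ) = speed lam p κ₀ κ φ := by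
  rw [speed, speed, shape_neg]

theorem speed_add_pi (lam p κ₀ κ φ : ℝ) : speed lam p κ₀ κ (φ + Real.pi) = speed lam p κ₀ κ φ := by
  rw [speed, speed, shape_add_pi]

theorem continuousOn_param (p μ : ℝ) : ContinuousOn (fun c : ℝ => μ * c ^ (p - 1)) (Ioi 0) :=
  continuousOn_const.mul (continuousOn_id.rpow_const fun _ hx => .inl (ne_of_gt hx))

/-- The point with the amplitude `c` and the angle `φ`, measured clockwise from the positive
`y`-axis. -/
def point (lam p μ κ₀ c φ : ℝ) : ℝ × ℝ :=
  (c * Real.sin φ, c * Real.cos φ * speed lam p κ₀ (μ * c ^ (p - 1)) φ)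

/-- The conditions under which the amplitudes `c ∈ [x₁, x₂]` belong to closed orbits. -/
structure IsRing (lam p μ x₁ x₂ κ₀ : ℝ) : Prop where
  lam_neg : lam < 0
  p_pos : 0 < p
  μ_pos : 0 < μ
  pos : 0 < x₁
  lt : x₁ < x₂
  le_param : ∀ c ∈ Icc x₁ x₂, κ₀ ≤ μ * c ^ (p - 1)
  param_pos : 0 < κ₀
  sq_pos : ∃ m > 0, ∀ φ, m ≤ κ₀ * shape p φ + lam

/-- This identity dictates the coordinates: on the level line through `(c, 0)` it factors `u'^2 / 2`
as `(c cos φ)² / 2` times the square of the angular speed. -/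
theorem potential_sub {lam p μ c : ℝ} (hp : 0 < p) (hc : 0 < c) (φ : ℝ) :
    potential lam p μ c - potential lam p μ (c * Real.sin φ) =
      (c * Real.cos φ) ^ 2 / 2 * (μ * c ^ (p - 1) * shape p φ + lam) := by
  have h1 := cos_sq_mul_shape hp φ
  have h2 : c ^ (p + 1) = c ^ 2 * c ^ (p - 1) := by
    rw [← Real.rpow_natCast, ← Real.rpow_add hc]; congr 1; push_cast; ring
  have h3 : (c * Real.cos φ) ^ 2 / 2 * (μ * c ^ (p - 1) * shape p φ + lam) =
      c ^ 2 * (μ * c ^ (p - 1)) / 2 * (Real.cos φ ^ 2 * shape p φ) +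
        c ^ 2 * Real.cos φ ^ 2 / 2 * lam := by ring
  rw [h3, h1, potential, potential, abs_mul, abs_of_pos hc, Real.mul_rpow hc.le (abs_nonneg _), h2,
    Real.cos_sq']
  ring

namespace IsRing

variable {lam p μ x₁ x₂ κ₀ : ℝ} (h : IsRing lam p μ x₁ x₂ κ₀)

include h

theorem shape_pos (φ : ℝ) : 0 < shape p φ := by
  obtain ⟨m, hm, hl⟩ := h.sq_pos
  have h1 := h.lam_neg
  exact pos_of_mul_pos_right (by linarith [hl φ]) h.param_pos.le

theorem sq_lower (κ φ : ℝ) : κ₀ * shape p φ + lam ≤ max κ κ₀ * shape p φ + lam := by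
  have := (h.shape_pos φ).le
  gcongr
  exact le_max_right _ _

/-- Because of the truncation at `κ₀` the lower bound holds for every real `κ`, so joint continuity
of the flow needs no restriction on the parameter. -/
theorem isSpeed : IsSpeed (speed lam p κ₀) where
  cont := by
    have := (continuous_shape h.p_pos).comp (continuous_snd (X := ℝ) (Y := ℝ))
    exact (((continuous_fst.max continuous_const).mul this).add continuous_const).sqrt
  lower := by
    obtain ⟨m, hm, hl⟩ := h.sq_pos
    exact ⟨√m, Real.sqrt_pos.2 hm, fun κ φ =>
      Real.sqrt_le_sqrt ((hl φ).trans (h.sq_lower κ φ))⟩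
  upper κ := by
    refine ⟨√(max κ κ₀ * 2 + lam), fun φ => Real.sqrt_le_sqrt ?_⟩
    have := h.param_pos.le.trans (le_max_right κ κ₀)
    have := shape_le_two h.p_pos φ
    gcongr

theorem speed_sq {c : ℝ} (hc : c ∈ Icc x₁ x₂) (φ : ℝ) :
    speed lam p κ₀ (μ * c ^ (p - 1)) φ ^ 2 = μ * c ^ (p - 1) * shape p φ + lam := by
  obtain ⟨m, hm, hl⟩ := h.sq_pos
  rw [speed, Real.sq_sqrt (by linarith [h.sq_lower (μ * c ^ (p - 1)) φ, hl φ]),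
    max_eq_left (h.le_param c hc)]

theorem amp_pos {c : ℝ} (hc : c ∈ Icc x₁ x₂) : 0 < c := h.pos.trans_le hc.1

theorem factor_pos {c : ℝ} (hc : c ∈ Icc x₁ x₂) (φ : ℝ) :
    0 < μ * c ^ (p - 1) * shape p φ + lam := by
  rw [← h.speed_sq hc]
  exact pow_pos (h.isSpeed.pos _ _) 2

theorem energy_point {c : ℝ} (hc : c ∈ Icc x₁ x₂) (φ : ℝ) :
    energy lam p μ (point lam p μ κ₀ c φ) = potential lam p μ c := by
  have := potential_sub (lam := lam) (μ := μ) h.p_pos (h.amp_pos hc) φ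
  rw [← h.speed_sq hc] at this
  simp only [energy, point]
  linarith [this]

/-- For `|w| < c` put `w = c sin φ` in `potential_sub`, whose right-hand side is then positive; the
force at `c` is `c` times the squared speed at `φ = π/2`. -/
theorem isAnnulus : IsAnnulus lam p μ x₁ x₂ := by
  have below : ∀ x ∈ Icc x₁ x₂, ∀ w : ℝ, |w| < x → potential lam p μ w < potential lam p μ x := by
    intro c hc w hw
    have hc0 := h.amp_pos hc
    rw [abs_lt] at hw
    have h1 : -1 < w / c := by rw [lt_div_iff₀ hc0]; linarith
    have h2 : w / c < 1 := by rw [div_lt_one hc0]; linarith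
    have h3 := potential_sub (lam := lam) (μ := μ) h.p_pos hc0 (Real.arcsin (w / c))
    rw [Real.sin_arcsin h1.le h2.le, mul_div_cancel₀ _ hc0.ne'] at h3
    have h4 : 0 < Real.cos (Real.arcsin (w / c)) := by
      rw [Real.cos_arcsin]; exact Real.sqrt_pos.2 (by nlinarith)
    have h5 := h.factor_pos hc (Real.arcsin (w / c))
    have : 0 < (c * Real.cos (Real.arcsin (w / c))) ^ 2 / 2 *
      (μ * c ^ (p - 1) * shape p (Real.arcsin (w / c)) + lam) := by positivity
    linarith
  refine ⟨h.pos, h.lt, ?_, below, fun c hc => ?_⟩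
  · have := below x₁ ⟨le_rfl, h.lt.le⟩ 0 (by simpa using h.pos)
    have hp1 : p + 1 ≠ 0 := by linarith [h.p_pos]
    simpa [potential, Real.zero_rpow hp1] using this
  · have h1 := h.factor_pos hc (Real.pi / 2)
    have hc0 := h.amp_pos hc
    rw [shape_pi_div_two, mul_one] at h1
    have : c ^ p = c * c ^ (p - 1) := by
      rw [mul_comm, ← Real.rpow_add_one hc0.ne']; congr 1; ring
    rw [this]
    nlinarith [mul_pos hc0 h1]

theorem strictMonoOn_potential : StrictMonoOn (potential lam p μ) (Icc x₁ x₂) :=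
  fun c hc d hd hcd => h.isAnnulus.below d hd c (by rwa [abs_of_pos (h.amp_pos hc)])

theorem point_mem_annulus {c : ℝ} (hc : c ∈ Icc x₁ x₂) (φ : ℝ) :
    point lam p μ κ₀ c φ ∈ annulus lam p μ x₁ x₂ := by
  have hm := h.strictMonoOn_potential.monotoneOn
  refine ⟨?_, ?_, ?_⟩
  · rw [point, abs_mul, abs_of_pos (h.amp_pos hc)]
    nlinarith [hc.2, (abs_sin_mem φ).2, h.amp_pos hc]
  · rw [h.energy_point hc]; exact hm (left_mem_Icc.2 h.lt.le) hc hc.1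
  · rw [h.energy_point hc]; exact hm hc (right_mem_Icc.2 h.lt.le) hc.2

end IsRing

/-! ### Quadrants as quarter turns -/

/-- The angles that belong to the `k`-th quarter turn. -/
def quarter (k : ℕ) : Set ℝ := Icc (k * (Real.pi / 2)) ((k + 1) * (Real.pi / 2))

theorem sin_cos_quarter (k : ℕ) (θ : ℝ) :
    (Real.sin (k * (Real.pi / 2) + θ), Real.cos (k * (Real.pi / 2) + θ)) =
      match k % 4 with
      | 0 => (Real.sin θ, Real.cos θ)
      | 1 => (Real.cos θ, -Real.sin θ)
      | 2 => (-Real.sin θ, -Real.cos θ)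
      | _ => (-Real.cos θ, Real.sin θ) := by
  have hk := Nat.div_add_mod k 4
  have hlt : k % 4 < 4 := Nat.mod_lt _ (by norm_num)
  set n := k / 4
  set j := k % 4
  have hk' : (k : ℝ) = 4 * n + j := by rw [← hk]; push_cast; ring
  have h1 : (k : ℝ) * (Real.pi / 2) + θ = j * (Real.pi / 2) + θ + n * (2 * Real.pi) := by
    rw [hk']; ring
  rw [h1, Real.sin_add_nat_mul_two_pi, Real.cos_add_nat_mul_two_pi]
  interval_cases j
  · simp
  · simp only [Nat.cast_one, one_mul, add_comm (Real.pi / 2) θ, Real.sin_add_pi_div_two,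
      Real.cos_add_pi_div_two]
  · have : ((2 : ℕ) : ℝ) * (Real.pi / 2) + θ = θ + Real.pi := by push_cast; ring
    simp only [this, Real.sin_add_pi, Real.cos_add_pi]
  · have : ((3 : ℕ) : ℝ) * (Real.pi / 2) + θ = θ + Real.pi + Real.pi / 2 := by push_cast; ring
    simp only [this, Real.sin_add_pi_div_two, Real.cos_add_pi_div_two, Real.sin_add_pi,
      Real.cos_add_pi, neg_neg]

theorem sin_cos_mem_closed {q : Quadrant} {k : ℕ} (hk : k % 4 = q.index) {φ : ℝ}
    (hφ : φ ∈ quarter k) : (Real.sin φ, Real.cos φ) ∈ q.closed := by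
  obtain ⟨θ, rfl⟩ : ∃ θ, φ = k * (Real.pi / 2) + θ := ⟨φ - k * (Real.pi / 2), by ring⟩
  have h0 : 0 ≤ θ := by linarith [hφ.1]
  have h1 : θ ≤ Real.pi / 2 := by linarith [hφ.2]
  have hs : 0 ≤ Real.sin θ := Real.sin_nonneg_of_nonneg_of_le_pi h0 (by linarith)
  have hc : 0 ≤ Real.cos θ := Real.cos_nonneg_of_mem_Icc ⟨by linarith, h1⟩
  rw [sin_cos_quarter, hk]
  cases q <;> simp [Quadrant.index, Quadrant.closed, hs, hc]

theorem exists_angle {q : Quadrant} {k : ℕ} (hk : k % 4 = q.index) {a b : ℝ}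
    (hab : a ^ 2 + b ^ 2 = 1) (hq : (a, b) ∈ q.closed) :
    ∃ φ ∈ quarter k, Real.sin φ = a ∧ Real.cos φ = b := by
  have key : ∀ x y : ℝ, 0 ≤ x → 0 ≤ y → x ^ 2 + y ^ 2 = 1 →
      ∃ θ ∈ Icc 0 (Real.pi / 2), Real.sin θ = x ∧ Real.cos θ = y := by
    intro x y hx hy hxy
    refine ⟨Real.arcsin x, ⟨Real.arcsin_nonneg.2 hx, Real.arcsin_le_pi_div_two x⟩,
      Real.sin_arcsin (by linarith) (by nlinarith), ?_⟩
    rw [Real.cos_arcsin, ← hxy, add_sub_cancel_left, Real.sqrt_sq hy]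
  suffices ∃ θ ∈ Icc 0 (Real.pi / 2),
      (Real.sin (k * (Real.pi / 2) + θ), Real.cos (k * (Real.pi / 2) + θ)) = (a, b) by
    obtain ⟨θ, hθ, h⟩ := this
    exact ⟨_, ⟨by linarith [hθ.1], by linarith [hθ.2]⟩, congrArg Prod.fst h, congrArg Prod.snd h⟩
  simp only [sin_cos_quarter, hk]
  cases q <;> simp only [Quadrant.closed, mem_ofPred_eq] at hq <;> simp only [Quadrant.index]
  · obtain ⟨θ, hθ, h1, h2⟩ := key a b hq.1 hq.2 hab
    exact ⟨θ, hθ, by rw [h1, h2]⟩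
  · obtain ⟨θ, hθ, h1, h2⟩ := key (-b) a (by linarith) hq.1 (by linarith [neg_sq b])
    exact ⟨θ, hθ, by rw [h1, h2, neg_neg]⟩
  · obtain ⟨θ, hθ, h1, h2⟩ := key (-a) (-b) (by linarith) (by linarith) (by rw [neg_sq, neg_sq, hab])
    exact ⟨θ, hθ, by rw [h1, h2, neg_neg, neg_neg]⟩
  · obtain ⟨θ, hθ, h1, h2⟩ := key b (-a) hq.2 (by linarith) (by linarith [neg_sq a])
    exact ⟨θ, hθ, by rw [h1, h2, neg_neg]⟩

theorem Quadrant.smul_mem_closed {q : Quadrant} {a b c d : ℝ} (hc : 0 < c) (hd : 0 < d) :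
    (c * a, d * b) ∈ q.closed ↔ (a, b) ∈ q.closed := by
  cases q <;> simp [Quadrant.closed, mul_nonneg_iff_of_pos_left, hc, hd, mul_nonpos_iff_pos_imp_nonpos,
    hc.le, hd.le]

namespace IsRing

variable {lam p μ x₁ x₂ κ₀ : ℝ} (h : IsRing lam p μ x₁ x₂ κ₀)

include h

theorem point_mem_closed {c : ℝ} (hc : c ∈ Icc x₁ x₂) {q : Quadrant} {k : ℕ}
    (hk : k % 4 = q.index) {φ : ℝ} (hφ : φ ∈ quarter k) : point lam p μ κ₀ c φ ∈ q.closed := by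
  have h1 : point lam p μ κ₀ c φ = (c * Real.sin φ,
    (c * speed lam p κ₀ (μ * c ^ (p - 1)) φ) * Real.cos φ) := by
    rw [point]; congr 1; ring
  rw [h1, Quadrant.smul_mem_closed (h.amp_pos hc) (mul_pos (h.amp_pos hc) (h.isSpeed.pos _ _))]
  exact sin_cos_mem_closed hk hφ

/-- The energy gives `c`, the ratio `z.1 / c` gives `sin φ`, and the sign of `z.2` selects the
cosine. -/
theorem exists_point {z : ℝ × ℝ} (hz : z ∈ annulus lam p μ x₁ x₂) {q : Quadrant} (hq : z ∈ q.closed)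
    {k : ℕ} (hk : k % 4 = q.index) :
    ∃ c ∈ Icc x₁ x₂, ∃ φ ∈ quarter k, point lam p μ κ₀ c φ = z := by
  obtain ⟨hz1, hz2, hz3⟩ := hz
  have hcont : ContinuousOn (potential lam p μ) (Icc x₁ x₂) := by
    have : Continuous (potential lam p μ) := by
      unfold potential
      have hp := h.p_pos
      exact (by fun_prop : Continuous fun x : ℝ => lam / 2 * x ^ 2).add
        ((Continuous.rpow_const (by fun_prop) fun _ => .inr (by linarith)).const_mul _)
    exact this.continuousOn
  obtain ⟨c, hc, hce⟩ := intermediate_value_Icc h.lt.le hcont ⟨hz2, hz3⟩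
  have hc0 := h.amp_pos hc
  -- Here the bound `|z.1| ≤ x₂` in `annulus` enters: beyond `c`, but within `x₂`, the potential
  -- exceeds the energy of `z`.
  have hzc : |z.1| ≤ c := by
    by_contra! hlt
    have h1 := h.isAnnulus.below |z.1| ⟨hc.1.trans hlt.le, hz1⟩ c (by rwa [abs_of_pos hc0])
    rw [hce] at h1
    simp only [potential, energy, abs_abs, sq_abs] at h1
    nlinarith [sq_nonneg z.2]
  have hzc2 : (z.1 / c) ^ 2 ≤ 1 := by
    rw [div_pow, div_le_one (by positivity), ← sq_abs z.1]
    exact pow_le_pow_left₀ (abs_nonneg _) hzc 2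
  have hsq := Real.sq_sqrt (sub_nonneg.2 hzc2)
  obtain ⟨b, hb2, hbs, hbn⟩ : ∃ b : ℝ, b ^ 2 = 1 - (z.1 / c) ^ 2 ∧ (0 ≤ z.2 → 0 ≤ b) ∧
      (z.2 ≤ 0 → b ≤ 0) := by
    rcases lt_trichotomy z.2 0 with h2 | h2 | h2
    · exact ⟨-√(1 - (z.1 / c) ^ 2), by rw [neg_sq, hsq], fun h' => absurd h' (not_le.2 h2),
        fun _ => neg_nonpos.2 (Real.sqrt_nonneg _)⟩
    · refine ⟨0, ?_, fun _ => le_rfl, fun _ => le_rfl⟩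
      have : z.1 = c ∨ z.1 = -c := by
        have h3 : potential lam p μ |z.1| = potential lam p μ c := by
          rw [hce]; simp [energy, h2, potential]
        have h4 : |z.1| = c := by
          by_contra hne
          have := h.isAnnulus.below c hc |z.1| (by rw [abs_abs]; exact lt_of_le_of_ne hzc hne)
          linarith
        exact (abs_eq hc0.le).1 h4
      rcases this with h | h <;> rw [h] <;> field_simp <;> ring
    · exact ⟨√(1 - (z.1 / c) ^ 2), hsq, fun _ => Real.sqrt_nonneg _,
        fun h' => absurd h' (not_le.2 h2)⟩
  have hqb : (z.1 / c, b) ∈ q.closed := by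
    cases q <;> simp only [Quadrant.closed, mem_ofPred_eq] at hq ⊢
    · exact ⟨div_nonneg hq.1 hc0.le, hbs hq.2⟩
    · exact ⟨div_nonneg hq.1 hc0.le, hbn hq.2⟩
    · exact ⟨div_nonpos_of_nonpos_of_nonneg hq.1 hc0.le, hbn hq.2⟩
    · exact ⟨div_nonpos_of_nonpos_of_nonneg hq.1 hc0.le, hbs hq.2⟩
  obtain ⟨φ, hφ, hsin, hcos⟩ := exists_angle hk (by rw [hb2]; ring) hqb
  refine ⟨c, hc, φ, hφ, ?_⟩
  have e1 : (point lam p μ κ₀ c φ).1 = z.1 := by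
    simp only [point, hsin]; field_simp
  have e2 : (point lam p μ κ₀ c φ).2 ^ 2 = z.2 ^ 2 := by
    have := h.energy_point hc φ
    rw [hce] at this
    simp only [energy, e1] at this
    linarith
  have e3 : (point lam p μ κ₀ c φ).2 = c * speed lam p κ₀ (μ * c ^ (p - 1)) φ * b := by
    simp only [point, hcos]; ring
  have e4 : 0 < c * speed lam p κ₀ (μ * c ^ (p - 1)) φ := mul_pos hc0 (h.isSpeed.pos _ _)
  refine Prod.ext e1 ?_
  rcases sq_eq_sq_iff_eq_or_eq_neg.1 e2 with h5 | h5
  · exact h5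
  · rcases le_total 0 z.2 with h6 | h6
    · have := mul_nonneg e4.le (hbs h6); linarith
    · have := mul_nonpos_of_nonneg_of_nonpos e4.le (hbn h6); linarith

theorem point_injOn (k : ℕ) :
    InjOn (fun w : ℝ × ℝ => point lam p μ κ₀ w.1 w.2) (Icc x₁ x₂ ×ˢ quarter k) := by
  rintro ⟨c, φ⟩ ⟨hc, hφ⟩ ⟨d, ψ⟩ ⟨hd, hψ⟩ he
  simp only at hc hd hφ hψ he
  have hcd : c = d := by
    refine h.strictMonoOn_potential.injOn hc hd ?_
    rw [← h.energy_point hc φ, he, h.energy_point hd ψ]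
  subst hcd
  have hc0 := h.amp_pos hc
  have hs : Real.sin φ = Real.sin ψ := mul_left_cancel₀ hc0.ne' (congrArg Prod.fst he)
  have hcs : Real.cos φ = Real.cos ψ := by
    have := congrArg Prod.snd he
    simp only [point, speed, shape_congr p hs] at this
    exact mul_left_cancel₀ hc0.ne' (mul_right_cancel₀ (h.isSpeed.pos _ ψ).ne' this)
  have h1 : Real.cos (φ - ψ) = 1 := by
    rw [Real.cos_sub, hs, hcs, ← sq, ← sq, Real.cos_sq_add_sin_sq]
  have hpi := Real.pi_pos
  have h2 := (Real.cos_eq_one_iff_of_lt_of_lt (x := φ - ψ)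
    (by linarith [hφ.1, hψ.2]) (by linarith [hφ.2, hψ.1])).1 h1
  rw [Prod.mk.injEq]
  exact ⟨rfl, by linarith⟩

theorem continuousOn_point :
    ContinuousOn (fun w : ℝ × ℝ => point lam p μ κ₀ w.1 w.2) (Icc x₁ x₂ ×ˢ univ) := by
  have h1 : ContinuousOn (fun w : ℝ × ℝ => (μ * w.1 ^ (p - 1), w.2)) (Icc x₁ x₂ ×ˢ univ) :=
    ((continuousOn_param p μ).comp continuousOn_fst fun w hw => h.amp_pos hw.1).prodMk
      continuousOn_snd
  have h2 := h.isSpeed.cont.comp_continuousOn h1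
  unfold point
  refine ContinuousOn.prodMk (by fun_prop) (ContinuousOn.mul (by fun_prop) h2)

/-- A path in a closed quadrant of the annulus, in the coordinates `(c, φ)`. -/
theorem exists_lift {Z : ℝ → ℝ × ℝ} {a b : ℝ} (hZ : ContinuousOn Z (uIcc a b)) {q : Quadrant}
    (hZm : ∀ t ∈ uIcc a b, Z t ∈ annulus lam p μ x₁ x₂ ∩ q.closed) {k : ℕ}
    (hk : k % 4 = q.index) :
    ∃ c φ : ℝ → ℝ, ContinuousOn c (uIcc a b) ∧ ContinuousOn φ (uIcc a b) ∧
      ∀ t ∈ uIcc a b, c t ∈ Icc x₁ x₂ ∧ φ t ∈ quarter k ∧ point lam p μ κ₀ (c t) (φ t) = Z t := by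
  let K : Set (ℝ × ℝ) := Icc x₁ x₂ ×ˢ quarter k
  let f : K → ℝ × ℝ := fun w => point lam p μ κ₀ w.1.1 w.1.2
  have hf : Continuous f :=
    (h.continuousOn_point.mono (prod_mono_right (subset_univ _))).domRestrict
  have hfi : Function.Injective f := fun w w' hw => Subtype.ext (h.point_injOn k w.2 w'.2 hw)
  have : CompactSpace K := isCompact_iff_compactSpace.1 (isCompact_Icc.prod isCompact_Icc)
  -- A continuous injection of a compact rectangle is a homeomorphism onto its image, so the
  -- coordinates depend continuously on the point of the path.
  have hemb := hf.isClosedEmbedding hfi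
  have hex : ∀ t : uIcc a b, ∃ w : K, f w = Z t := fun t => by
    obtain ⟨c, hc, φ, hφ, he⟩ := h.exists_point (hZm t t.2).1 (hZm t t.2).2 hk
    exact ⟨⟨(c, φ), hc, hφ⟩, he⟩
  choose g hg using hex
  have hgc : Continuous g := by
    rw [hemb.isInducing.continuous_iff]
    have : f ∘ g = (uIcc a b).domRestrict Z := funext hg
    rw [this]
    exact hZ.domRestrict
  let π : ℝ → uIcc a b := projIcc (a ⊓ b) (a ⊔ b) inf_le_sup
  have hπ : Continuous fun t => (g (π t)).1 :=
    continuous_subtype_val.comp (hgc.comp continuous_projIcc)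
  refine ⟨fun t => (g (π t)).1.1, fun t => (g (π t)).1.2, hπ.fst.continuousOn,
    hπ.snd.continuousOn, fun t ht => ⟨(g (π t)).2.1, (g (π t)).2.2, ?_⟩⟩
  have : π t = ⟨t, ht⟩ := projIcc_of_mem _ ht
  exact (hg (π t)).trans (by rw [this])

end IsRing

/-! ### Trajectories in the phase plane and their concatenation -/

/-- `z = (u, u')` solves `-u'' = lam u + α |u|^(p-1) u` with the constant weight `α`. -/
structure IsFlow (lam p α : ℝ) (z : ℝ → ℝ × ℝ) : Prop where
  fst : ∀ t, HasDerivAt (fun t => (z t).1) (z t).2 t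
  snd : ∀ t, HasDerivAt (fun t => (z t).2) (-(lam * (z t).1 + α * (|(z t).1| ^ (p - 1) * (z t).1))) t

/-- `z = (u, u')` solves the equation with the weight `a` on `[A, B]`. -/
structure IsTrajectory (lam p : ℝ) (a : ℝ → ℝ) (A B : ℝ) (z : ℝ → ℝ × ℝ) : Prop where
  fst : ∀ t ∈ Icc A B, HasDerivWithinAt (fun t => (z t).1) (z t).2 (Icc A B) t
  -- Stronger than absolute continuity, and easily glued: at a junction the larger constant serves.
  snd : ∃ K, LipschitzOnWith K (fun t => (z t).2) (Icc A B)
  equation : ∀ᵐ t ∂(volume.restrict (Icc A B)),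
    HasDerivAt (fun t => (z t).2) (-(lam * (z t).1 + a t * (|(z t).1| ^ (p - 1) * (z t).1))) t

/-- For `p < 1` the factor `|x|^(p-1)` is unbounded near `0`; the product is rewritten with powers
of exponent `p` of the positive and negative parts. -/
theorem continuous_abs_rpow_mul {p : ℝ} (hp : 0 < p) :
    Continuous fun x : ℝ => |x| ^ (p - 1) * x := by
  have : (fun x : ℝ => |x| ^ (p - 1) * x) = fun x => max x 0 ^ p - max (-x) 0 ^ p := by
    funext x
    have key : ∀ y : ℝ, 0 < y → y ^ (p - 1) * y = y ^ p := fun y hy => by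
      rw [← Real.rpow_add_one hy.ne']; congr 1; ring
    rcases lt_trichotomy x 0 with hx | rfl | hx
    · rw [abs_of_neg hx, max_eq_right hx.le, max_eq_left (by linarith), Real.zero_rpow hp.ne',
        ← key (-x) (by linarith)]
      ring
    · simp
    · rw [abs_of_pos hx, max_eq_left hx.le, max_eq_right (by linarith), Real.zero_rpow hp.ne',
        ← key x hx]
      ring
  rw [this]
  exact (Continuous.rpow_const (by fun_prop) fun _ => .inr hp.le).sub
    (Continuous.rpow_const (by fun_prop) fun _ => .inr hp.le)

theorem IsFlow.comp_sub {lam p α : ℝ} {z : ℝ → ℝ × ℝ} (h : IsFlow lam p α z) (s : ℝ) :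
    IsFlow lam p α fun t => z (t - s) where
  fst t := by simpa using (h.fst (t - s)).comp_sub_const t s
  snd t := by simpa using (h.snd (t - s)).comp_sub_const t s

/-- Only interior values of the weight matter: at the ends of a gap the weight equals `μ`, since
humps are closed. -/
theorem IsFlow.isTrajectory {lam p α : ℝ} (hp : 0 < p) {z : ℝ → ℝ × ℝ} (h : IsFlow lam p α z)
    {a : ℝ → ℝ} {A B : ℝ} (ha : ∀ t ∈ Ioo A B, a t = α) : IsTrajectory lam p a A B z where
  fst t _ := (h.fst t).hasDerivWithinAt
  snd := by
    have hc : Continuous fun t => (z t).1 :=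
      continuous_iff_continuousAt.2 fun t => (h.fst t).continuousAt
    have hd : Continuous fun t => -(lam * (z t).1 + α * (|(z t).1| ^ (p - 1) * (z t).1)) :=
      ((hc.const_mul lam).add (((continuous_abs_rpow_mul hp).comp hc).const_mul α)).neg
    obtain ⟨C, hC⟩ := isCompact_Icc.exists_bound_of_continuousOn (s := Icc A B) hd.continuousOn
    exact ⟨C.toNNReal, (convex_Icc A B).lipschitzOnWith_of_nnnorm_hasDerivWithin_le
      (fun t _ => (h.snd t).hasDerivWithinAt) fun t ht => by
        rw [← NNReal.coe_le_coe, coe_nnnorm]; exact (hC t ht).trans (Real.le_coe_toNNReal C)⟩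
  equation := by
    rw [← restrict_Ioo_eq_restrict_Icc, ae_restrict_iff' measurableSet_Ioo]
    exact .of_forall fun t ht => by rw [ha t ht]; exact h.snd t

theorem IsTrajectory.glue {lam p : ℝ} {a : ℝ → ℝ} {A B C : ℝ} {z w : ℝ → ℝ × ℝ}
    (hz : IsTrajectory lam p a A B z) (hw : IsTrajectory lam p a B C w) (hAB : A ≤ B) (hBC : B ≤ C)
    (h : z B = w B) : IsTrajectory lam p a A C fun t => if t ≤ B then z t else w t := by
  set y : ℝ → ℝ × ℝ := fun t => if t ≤ B then z t else w t with hy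
  have yz : ∀ t ≤ B, y t = z t := fun t ht => if_pos ht
  have yw : ∀ t, B ≤ t → y t = w t := fun t ht => by
    rcases ht.eq_or_lt with rfl | ht
    · rw [yz _ le_rfl, h]
    · exact if_neg (not_le.2 ht)
  refine ⟨fun t _ => ?_, ?_, ?_⟩
  · rw [← Icc_union_Icc_eq_Icc hAB hBC]
    refine HasDerivWithinAt.union ?_ ?_
    · by_cases ht' : t ∈ Icc A B
      · rw [yz t ht'.2]
        exact (hz.fst t ht').congr (fun s hs => by rw [yz s hs.2]) (by rw [yz t ht'.2])
      · exact HasFDerivWithinAt.of_notMem_closure (by rwa [isClosed_Icc.closure_eq])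
    · by_cases ht' : t ∈ Icc B C
      · rw [yw t ht'.1]
        exact (hw.fst t ht').congr (fun s hs => by rw [yw s hs.1]) (by rw [yw t ht'.1])
      · exact HasFDerivWithinAt.of_notMem_closure (by rwa [isClosed_Icc.closure_eq])
  · obtain ⟨K, hK⟩ := hz.snd
    obtain ⟨K', hK'⟩ := hw.snd
    have hK0 : (K : ℝ) ≤ (max K K' : NNReal) := NNReal.coe_le_coe.2 (le_max_left _ _)
    have hK0' : (K' : ℝ) ≤ (max K K' : NNReal) := NNReal.coe_le_coe.2 (le_max_right _ _)
    have main : ∀ s ∈ Icc A C, ∀ t ∈ Icc A C, s ≤ t →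
        dist (y s).2 (y t).2 ≤ (max K K' : NNReal) * dist s t := by
      intro s hs t ht hst
      rcases le_total t B with htB | htB
      · rw [yz s (hst.trans htB), yz t htB]
        exact (hK.dist_le_mul s ⟨hs.1, hst.trans htB⟩ t ⟨ht.1, htB⟩).trans
          (mul_le_mul_of_nonneg_right hK0 dist_nonneg)
      · rcases le_total s B with hsB | hsB
        · have h1 := (hK.dist_le_mul s ⟨hs.1, hsB⟩ B ⟨hAB, le_rfl⟩).trans
            (mul_le_mul_of_nonneg_right hK0 dist_nonneg)
          have h2 := (hK'.dist_le_mul B ⟨le_rfl, hBC⟩ t ⟨htB, ht.2⟩).trans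
            (mul_le_mul_of_nonneg_right hK0' dist_nonneg)
          rw [yz s hsB, yw t htB]
          have h3 : dist s t = dist s B + dist B t := by
            rw [Real.dist_eq, Real.dist_eq, Real.dist_eq, abs_of_nonpos (by linarith),
              abs_of_nonpos (by linarith), abs_of_nonpos (by linarith)]
            ring
          rw [h3, mul_add]
          simp only [h] at h1
          exact (dist_triangle _ (w B).2 _).trans (add_le_add h1 h2)
        · rw [yw s hsB, yw t htB]
          exact (hK'.dist_le_mul s ⟨hsB, hs.2⟩ t ⟨htB, ht.2⟩).trans
            (mul_le_mul_of_nonneg_right hK0' dist_nonneg)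
    refine ⟨max K K', LipschitzOnWith.of_dist_le_mul fun s hs t ht => ?_⟩
    rcases le_total s t with hst | hst
    · exact main s hs t ht hst
    · rw [dist_comm, dist_comm s]; exact main t ht s hs hst
  · have hne : ∀ S : Set ℝ, ∀ᵐ t ∂(volume.restrict S), t ≠ B := fun S =>
      ae_restrict_of_ae (by simp [ae_iff, measure_singleton])
    rw [← Icc_union_Icc_eq_Icc hAB hBC, ae_restrict_union_iff]
    constructor
    · filter_upwards [hz.equation, hne _, ae_restrict_mem measurableSet_Icc] with t ht htB htm
      have hlt : t < B := lt_of_le_of_ne htm.2 htB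
      rw [yz t hlt.le]
      refine ht.congr_of_eventuallyEq ?_
      filter_upwards [Iio_mem_nhds hlt] with s hs
      rw [yz s (le_of_lt hs)]
    · filter_upwards [hw.equation, hne _, ae_restrict_mem measurableSet_Icc] with t ht htB htm
      have hlt : B < t := lt_of_le_of_ne htm.1 (Ne.symm htB)
      rw [yw t hlt.le]
      refine ht.congr_of_eventuallyEq ?_
      filter_upwards [Ioi_mem_nhds hlt] with s hs
      rw [yw s (le_of_lt hs)]

theorem IsTrajectory.slope_eq {lam p : ℝ} {a : ℝ → ℝ} {L : ℝ} {z : ℝ → ℝ × ℝ} (hL : 0 < L)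
    (h : IsTrajectory lam p a 0 L z) {t : ℝ} (ht : t ∈ Icc 0 L) :
    slope L (fun t => (z t).1) t = (z t).2 :=
  (h.fst t ht).derivWithin (uniqueDiffOn_Icc hL t ht)

theorem IsTrajectory.solvesEquation {lam p : ℝ} {a : ℝ → ℝ} {L : ℝ} {z : ℝ → ℝ × ℝ} (hL : 0 < L)
    (h : IsTrajectory lam p a 0 L z) : SolvesEquation lam p a L fun t => (z t).1 where
  contDiffOn := by
    obtain ⟨K, hK⟩ := h.snd
    rw [contDiffOn_one_iff_derivWithin (uniqueDiffOn_Icc hL)]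
    exact ⟨fun t ht => (h.fst t ht).differentiableWithinAt,
      hK.continuousOn.congr fun t ht => h.slope_eq hL ht⟩
  absolutelyContinuous := by
    obtain ⟨K, hK⟩ := h.snd
    refine LipschitzOnWith.absolutelyContinuousOnInterval (K := K) ?_
    rw [uIcc_of_le hL.le]
    intro s hs t ht
    rw [h.slope_eq hL hs, h.slope_eq hL ht]
    exact hK hs ht
  equation := by
    have := h.equation
    rw [← restrict_Ioo_eq_restrict_Icc] at this ⊢
    filter_upwards [this, ae_restrict_mem measurableSet_Ioo] with t ht htm
    refine ht.congr_of_eventuallyEq ?_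
    filter_upwards [Ioo_mem_nhds htm.1 htm.2] with s hs
    exact h.slope_eq hL (Ioo_subset_Icc_self hs)

theorem IsTrajectory.phase_eq {lam p : ℝ} {a : ℝ → ℝ} {L : ℝ} {z : ℝ → ℝ × ℝ} (hL : 0 < L)
    (h : IsTrajectory lam p a 0 L z) {t : ℝ} (ht : t ∈ Icc 0 L) :
    phase L (fun t => (z t).1) t = z t :=
  Prod.ext rfl (h.slope_eq hL ht)

/-! ### The weight -/

section Weight

variable {τ ς : ℝ}

theorem humpStart_zero : humpStart τ ς 0 = 0 := by simp [humpStart]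

theorem humpStart_succ (i : ℕ) : humpStart τ ς (i + 1) = humpEnd τ ς i + ς := by
  simp only [humpStart, humpEnd]; push_cast; ring

theorem humpStart_mono (hτ : 0 < τ) (hς : 0 < ς) : Monotone (humpStart τ ς) := fun i j hij => by
  have : (i : ℝ) ≤ j := by exact_mod_cast hij
  have h2 : 0 < τ + ς := by linarith
  simp only [humpStart]
  gcongr

theorem humpStart_nonneg (hτ : 0 < τ) (hς : 0 < ς) (i : ℕ) : 0 ≤ humpStart τ ς i := by
  rw [← humpStart_zero (τ := τ) (ς := ς)]; exact humpStart_mono hτ hς (Nat.zero_le i)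

theorem humpEnd_mono (hτ : 0 < τ) (hς : 0 < ς) : Monotone (humpEnd τ ς) := fun i j hij => by
  have := humpStart_mono hτ hς hij
  simp only [humpEnd]; linarith

theorem weight_of_mem_hump {μ : ℝ} {m i : ℕ} (hi : i ≤ m) {t : ℝ}
    (ht : t ∈ Icc (humpStart τ ς i) (humpEnd τ ς i)) : weight μ τ ς m t = μ :=
  indicator_of_mem (mem_iUnion.2 ⟨⟨i, Nat.lt_succ_of_le hi⟩, ht⟩) _

theorem weight_of_mem_gap (hτ : 0 < τ) (hς : 0 < ς) {μ : ℝ} {m i : ℕ} {t : ℝ}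
    (ht : t ∈ Ioo (humpEnd τ ς i) (humpStart τ ς (i + 1))) : weight μ τ ς m t = 0 := by
  refine indicator_of_notMem ?_ _
  rw [mem_iUnion]
  rintro ⟨j, hj⟩
  rcases le_or_gt (j : ℕ) i with hji | hji
  · linarith [humpEnd_mono hτ hς hji, hj.2, ht.1]
  · linarith [humpStart_mono hτ hς (Nat.succ_le_of_lt hji), hj.1, ht.2]

/-- Solutions on the humps and on the gaps which fit together form a trajectory. -/
theorem exists_trajectory {lam p μ : ℝ} (hp : 0 < p) (hτ : 0 < τ) (hς : 0 < ς) {m : ℕ}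
    {H G : ℕ → ℝ → ℝ × ℝ} (hH : ∀ i ≤ m, IsFlow lam p μ (H i)) (hG : ∀ i < m, IsFlow lam p 0 (G i))
    (hHG : ∀ i < m, H i (humpEnd τ ς i) = G i (humpEnd τ ς i))
    (hGH : ∀ i < m, G i (humpStart τ ς (i + 1)) = H (i + 1) (humpStart τ ς (i + 1))) :
    ∀ n ≤ m, ∃ z, IsTrajectory lam p (weight μ τ ς m) 0 (humpEnd τ ς n) z ∧
      (∀ i ≤ n, EqOn z (H i) (Icc (humpStart τ ς i) (humpEnd τ ς i))) ∧
      ∀ i < n, EqOn z (G i) (Icc (humpEnd τ ς i) (humpStart τ ς (i + 1))) := by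
  intro n
  induction n with
  | zero =>
    refine fun _ => ⟨H 0, ?_, fun i hi => ?_, fun i hi => absurd hi (Nat.not_lt_zero i)⟩
    · refine (hH 0 (Nat.zero_le m)).isTrajectory hp fun t ht =>
        weight_of_mem_hump (Nat.zero_le m) ?_
      rw [humpStart_zero]
      exact Ioo_subset_Icc_self ht
    · rw [Nat.le_zero.1 hi]; exact fun _ _ => rfl
  | succ n ih =>
    intro hn
    obtain ⟨z, hz, hzH, hzG⟩ := ih (by omega)
    have e0 : 0 ≤ humpEnd τ ς n := by
      have := humpStart_nonneg hτ hς n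
      simp only [humpEnd]; linarith
    have e1 : humpEnd τ ς n < humpStart τ ς (n + 1) := by rw [humpStart_succ]; linarith
    have e2 : humpStart τ ς (n + 1) < humpEnd τ ς (n + 1) := by simp only [humpEnd]; linarith
    have hT1 : IsTrajectory lam p (weight μ τ ς m) (humpEnd τ ς n) (humpStart τ ς (n + 1)) (G n) :=
      (hG n (by omega)).isTrajectory hp fun t ht => weight_of_mem_gap hτ hς ht
    have hT2 : IsTrajectory lam p (weight μ τ ς m) (humpStart τ ς (n + 1)) (humpEnd τ ς (n + 1))
        (H (n + 1)) := (hH (n + 1) hn).isTrajectory hp fun t ht =>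
          weight_of_mem_hump hn (Ioo_subset_Icc_self ht)
    have hm : humpEnd τ ς n ∈ Icc (humpStart τ ς n) (humpEnd τ ς n) :=
      ⟨by simp only [humpEnd]; linarith, le_rfl⟩
    have h3 := hz.glue hT1 e0 e1.le (by rw [hzH n le_rfl hm, hHG n (by omega)])
    have h4 := h3.glue hT2 (e0.trans e1.le) e2.le
      (by simp only [if_neg (not_le.2 e1)]; exact hGH n (by omega))
    have old : ∀ t ≤ humpEnd τ ς n,
        (if t ≤ humpStart τ ς (n + 1) then (if t ≤ humpEnd τ ς n then z t else G n t)
          else H (n + 1) t) = z t := fun t ht => by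
      rw [if_pos (ht.trans e1.le), if_pos ht]
    refine ⟨_, h4, fun i hi t ht => ?_, fun i hi t ht => ?_⟩
    · rcases Nat.lt_or_ge i (n + 1) with hi' | hi'
      · have hin : i ≤ n := by omega
        simp only [old t (ht.2.trans (humpEnd_mono hτ hς hin))]
        exact hzH i hin ht
      · obtain rfl : i = n + 1 := by omega
        rcases ht.1.eq_or_lt with h5 | h5
        · subst h5
          simp only [if_pos le_rfl, if_neg (not_le.2 e1)]
          exact hGH n (by omega)
        · simp only [if_neg (not_le.2 h5)]
    · rcases Nat.lt_or_ge i n with hi' | hi'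
      · have h5 : humpStart τ ς (i + 1) ≤ humpEnd τ ς n := by
          have := humpStart_mono hτ hς (Nat.succ_le_of_lt hi')
          simp only [Nat.succ_eq_add_one] at this
          simp only [humpEnd] at *; linarith
        simp only [old t (ht.2.trans h5)]
        exact hzG i hi' ht
      · obtain rfl : i = n := by omega
        simp only [if_pos ht.2]
        rcases ht.1.eq_or_lt with h5 | h5
        · subst h5
          simp only [if_pos le_rfl]
          rw [hzH i le_rfl hm, hHG i (by omega)]
        · simp only [if_neg (not_le.2 h5)]

end Weight

/-! ### Solutions on a hump -/

/-- Near `t` the sign of `V` is constant, so `V = ±√(V²)`. -/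
theorem hasDerivAt_of_sq {V : ℝ → ℝ} {D t : ℝ} (hV : ContinuousAt V t)
    (hD : HasDerivAt (fun s => V s ^ 2) D t) (ht : V t ≠ 0) : HasDerivAt V (D / (2 * V t)) t := by
  have h1 := hD.sqrt (pow_ne_zero 2 ht)
  rw [Real.sqrt_sq_eq_abs] at h1
  rcases ht.lt_or_gt with h | h
  · rw [abs_of_neg h] at h1
    have h2 := h1.neg
    refine (h2.congr_of_eventuallyEq ?_).congr_deriv (by rw [mul_neg, div_neg, neg_neg])
    filter_upwards [hV.eventually_lt continuousAt_const h] with s hs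
    simp [Real.sqrt_sq_eq_abs, abs_of_neg hs]
  · rw [abs_of_pos h] at h1
    refine h1.congr_of_eventuallyEq ?_
    filter_upwards [continuousAt_const.eventually_lt hV h] with s hs
    rw [Real.sqrt_sq hs.le]

theorem hasDerivAt_potential {lam p μ : ℝ} (hp : 0 < p) (x : ℝ) :
    HasDerivAt (potential lam p μ) (lam * x + μ * (|x| ^ (p - 1) * x)) x := by
  have h1 := (hasDerivAt_abs_rpow x (p := p + 1) (by linarith)).const_mul (μ / (p + 1))
  have h2 := ((hasDerivAt_id x).pow 2).const_mul (lam / 2)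
  refine (h2.add h1).congr_deriv ?_
  have e : p + 1 - 2 = p - 1 := by ring
  have : p + 1 ≠ 0 := by linarith
  rw [e]
  simp only [id]
  field_simp
  push_cast; ring

namespace IsRing

variable {lam p μ x₁ x₂ κ₀ : ℝ} (h : IsRing lam p μ x₁ x₂ κ₀)

/-- The angle after the time `t` on the orbit of amplitude `c`. -/
def _root_.MooreNehari.angle (lam p μ κ₀ c φ t : ℝ) : ℝ :=
  turn (speed lam p κ₀) (μ * c ^ (p - 1)) φ t

/-- The motion along the orbit of amplitude `c`. -/
def _root_.MooreNehari.hump (lam p μ κ₀ c φ t : ℝ) : ℝ × ℝ :=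
  point lam p μ κ₀ c (angle lam p μ κ₀ c φ t)

include h

theorem hasDerivAt_angle (c φ t : ℝ) : HasDerivAt (angle lam p μ κ₀ c φ)
    (speed lam p κ₀ (μ * c ^ (p - 1)) (angle lam p μ κ₀ c φ t)) t :=
  h.isSpeed.hasDerivAt_turn _ _ _

/-- Where `u' ≠ 0`, differentiating `u'^2 = 2 (F(c) - F(u))` gives the equation. The remaining times
are countable, as the angle is injective in time, so `u'` is still the integral of the continuous
right-hand side `g` and the equation holds everywhere, without differentiating the speed. -/
theorem isFlow_hump {c : ℝ} (hc : c ∈ Icc x₁ x₂) (φ : ℝ) :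
    IsFlow lam p μ (hump lam p μ κ₀ c φ) := by
  set θ := angle lam p μ κ₀ c φ with hθ
  have hθd := h.hasDerivAt_angle c φ
  have hθc : Continuous θ := continuous_iff_continuousAt.2 fun t => (hθd t).continuousAt
  have h1 : ∀ t, HasDerivAt (fun t => (hump lam p μ κ₀ c φ t).1) (hump lam p μ κ₀ c φ t).2 t := by
    intro t
    refine ((hθd t).sin.const_mul c).congr_deriv ?_
    simp only [hump, point]; ring
  have hV : Continuous fun t => (hump lam p μ κ₀ c φ t).2 :=
    ((Real.continuous_cos.comp hθc).const_mul c).mul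
      (h.isSpeed.cont.comp (continuous_const.prodMk hθc))
  have hU : Continuous fun t => (hump lam p μ κ₀ c φ t).1 :=
    continuous_iff_continuousAt.2 fun t => (h1 t).continuousAt
  set g : ℝ → ℝ := fun t => -(lam * (hump lam p μ κ₀ c φ t).1 +
    μ * (|(hump lam p μ κ₀ c φ t).1| ^ (p - 1) * (hump lam p μ κ₀ c φ t).1)) with hg
  have hgc : Continuous g := ((hU.const_mul lam).add
    (((continuous_abs_rpow_mul h.p_pos).comp hU).const_mul μ)).neg
  refine ⟨h1, ?_⟩
  have hne : ∀ t, Real.cos (θ t) ≠ 0 → HasDerivAt (fun t => (hump lam p μ κ₀ c φ t).2) (g t) t := by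
    intro t ht
    have hVt : (hump lam p μ κ₀ c φ t).2 ≠ 0 := by
      simp only [hump, point]
      exact mul_ne_zero (mul_ne_zero (h.amp_pos hc).ne' ht) (h.isSpeed.pos _ _).ne'
    have hsq : (fun t => (hump lam p μ κ₀ c φ t).2 ^ 2) = fun t =>
        2 * (potential lam p μ c - potential lam p μ (hump lam p μ κ₀ c φ t).1) := by
      funext s
      have := h.energy_point hc (θ s)
      simp only [energy] at this
      simp only [hump]
      linarith
    have hD : HasDerivAt (fun t => (hump lam p μ κ₀ c φ t).2 ^ 2)
        (2 * (g t * (hump lam p μ κ₀ c φ t).2)) t := by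
      rw [hsq]
      refine ((((hasDerivAt_potential h.p_pos _).comp t (h1 t)).const_sub
        (potential lam p μ c)).const_mul 2).congr_deriv ?_
      simp only [hg]; ring
    refine (hasDerivAt_of_sq hV.continuousAt hD hVt).congr_deriv ?_
    field_simp
  have hcount : {t | Real.cos (θ t) = 0}.Countable := by
    have h2 : {x : ℝ | Real.cos x = 0}.Countable := by
      refine (countable_range fun k : ℤ => (2 * k + 1) * Real.pi / 2).mono fun x hx => ?_
      obtain ⟨k, hk⟩ := Real.cos_eq_zero_iff.1 hx
      exact ⟨k, hk.symm⟩
    exact h2.preimage (h.isSpeed.strictMono_turn _ _).injective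
  have hint : ∀ t, (hump lam p μ κ₀ c φ t).2 = (hump lam p μ κ₀ c φ 0).2 + ∫ s in (0 : ℝ)..t, g s := by
    intro t
    rw [integral_eq_of_hasDerivAt_off_countable _ g hcount hV.continuousOn
      (fun x hx => hne x hx.2) (hgc.intervalIntegrable _ _)]
    ring
  intro t
  have h3 := (hgc.integral_hasStrictDerivAt 0 t).hasDerivAt.const_add (hump lam p μ κ₀ c φ 0).2
  exact h3.congr_of_eventuallyEq (.of_forall hint)

end IsRing

/-! ### Solutions on a gap -/

/-- The solution of `u'' = ν² u` through the point `z` at the time `0`. -/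
def gap (ν : ℝ) (z : ℝ × ℝ) (t : ℝ) : ℝ × ℝ :=
  (z.1 * Real.cosh (ν * t) + z.2 / ν * Real.sinh (ν * t),
    ν * z.1 * Real.sinh (ν * t) + z.2 * Real.cosh (ν * t))

theorem gap_zero (ν : ℝ) (z : ℝ × ℝ) : gap ν z 0 = z := by simp [gap]

theorem gap_neg (ν : ℝ) (z : ℝ × ℝ) (t : ℝ) : gap ν (-z) t = -gap ν z t := by
  simp only [gap, Prod.fst_neg, Prod.snd_neg, Prod.neg_mk]
  congr 1 <;> ring

theorem isFlow_gap {ν : ℝ} (hν : ν ≠ 0) (p : ℝ) (z : ℝ × ℝ) :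
    IsFlow (-ν ^ 2) p 0 (gap ν z) := by
  have hl : ∀ t : ℝ, HasDerivAt (fun t => ν * t) ν t := fun t => by
    simpa using (hasDerivAt_id t).const_mul ν
  refine ⟨fun t => ?_, fun t => ?_⟩
  · refine (((hl t).cosh.const_mul z.1).add ((hl t).sinh.const_mul (z.2 / ν))).congr_deriv ?_
    simp only [gap]; field_simp
  · refine (((hl t).sinh.const_mul (ν * z.1)).add ((hl t).cosh.const_mul z.2)).congr_deriv ?_
    simp only [gap]; field_simp; ring

/-! ### Counting half-axes on a hump -/

/-- The multiples `j π/2` with `k < j ≤ k + D` are certainly attained. Those with `j = k` and `j = k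
+ D + 1` can be attained only at `c` and at `d`, respectively; `P` and `Q` exclude exactly these two
cases when they have parity `e`. -/
theorem encard_zerosIn {θ f : ℝ → ℝ} {c d : ℝ} (hcd : c ≤ d) (hθ : Continuous θ)
    (hm : StrictMono θ) {k D e : ℕ} (hD : 1 ≤ D) (he : e < 2) (hc : θ c ∈ quarter k)
    (hd : θ d ∈ quarter (k + D))
    (hf : ∀ t ∈ Icc c d, f t = 0 ↔ ∃ n : ℤ, θ t = (2 * n + e : ℤ) * (Real.pi / 2)) {P Q : Prop}
    (hP : P ↔ k % 2 ≠ e) (hQ : Q ↔ (k + D) % 2 = e) :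
    (zerosIn f c d P Q).encard = ((Finset.Ioc k (k + D)).filter fun j => j % 2 = e).card := by
  have hpi : 0 < Real.pi / 2 := by linarith [Real.pi_pos]
  set S := (Finset.Ioc k (k + D)).filter fun j => j % 2 = e with hS
  have hinj : Function.Injective fun j : ℕ => (j : ℝ) * (Real.pi / 2) := fun i j hij =>
    Nat.cast_injective (mul_right_cancel₀ hpi.ne' hij)
  have key : θ '' zerosIn f c d P Q = (fun j : ℕ => (j : ℝ) * (Real.pi / 2)) '' (S : Set ℕ) := by
    ext x
    constructor
    · rintro ⟨t, ⟨ht, hft, htc, htd⟩, rfl⟩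
      obtain ⟨n, hn⟩ := (hf t ht).1 hft
      have h1 : (k : ℝ) * (Real.pi / 2) ≤ θ t := hc.1.trans (hm.monotone ht.1)
      have h2 : θ t ≤ ((k + D : ℕ) + 1 : ℝ) * (Real.pi / 2) := (hm.monotone ht.2).trans hd.2
      rw [hn] at h1 h2
      have h1' : (k : ℤ) ≤ 2 * n + e := by
        exact_mod_cast le_of_mul_le_mul_right h1 hpi
      have h2' : 2 * n + e ≤ (k + D : ℕ) + 1 := by
        exact_mod_cast le_of_mul_le_mul_right h2 hpi
      have h3 : 2 * n + e ≠ (k : ℤ) := by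
        intro h
        have htc' : t = c := hm.injective (le_antisymm (by rw [hn, h]; exact_mod_cast hc.1)
          (hm.monotone ht.1))
        have := hP.1 (htc htc')
        omega
      have h4 : 2 * n + e ≠ ((k + D : ℕ) : ℤ) + 1 := by
        intro h
        have htd' : t = d := hm.injective (le_antisymm (hm.monotone ht.2)
          (by rw [hn, h]; exact_mod_cast hd.2))
        have := hQ.1 (htd htd')
        omega
      refine ⟨(2 * n + e).toNat, ?_, ?_⟩
      · simp only [hS, Finset.coe_filter, Finset.mem_Ioc, mem_ofPred_eq]
        omega
      · have : ((2 * n + e).toNat : ℤ) = 2 * n + e := Int.toNat_of_nonneg (by omega)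
        simp only
        rw [hn, ← this]
        norm_cast
    · rintro ⟨j, hj, rfl⟩
      simp only [hS, Finset.coe_filter, Finset.mem_Ioc, mem_ofPred_eq] at hj
      have hj1 : (k : ℝ) + 1 ≤ j := by exact_mod_cast hj.1.1
      have hj2 : (j : ℝ) ≤ (k + D : ℕ) := by exact_mod_cast hj.1.2
      have h1 : θ c ≤ j * (Real.pi / 2) := hc.2.trans (by gcongr)
      have h2 : j * (Real.pi / 2) ≤ θ d := le_trans (by gcongr) hd.1
      obtain ⟨t, ht, hjt⟩ := intermediate_value_Icc hcd hθ.continuousOn ⟨h1, h2⟩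
      refine ⟨t, ⟨ht, (hf t ht).2 ⟨(j / 2 : ℕ), ?_⟩, fun htc => hP.2 ?_, fun htd => hQ.2 ?_⟩, hjt⟩
      · rw [hjt]
        congr 1
        have : j = 2 * (j / 2) + e := by omega
        exact_mod_cast this
      · subst htc
        have := hc.2
        rw [hjt] at this
        have : j ≤ k + 1 := by exact_mod_cast le_of_mul_le_mul_right this hpi
        omega
      · subst htd
        have := hd.1
        rw [hjt] at this
        have : k + D ≤ j := by exact_mod_cast le_of_mul_le_mul_right this hpi
        omega
  rw [← hm.injective.encard_image, key, hinj.encard_image, encard_coe_eq_coe_finsetCard]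

theorem card_filter_mod_two (k D e : ℕ) (he : e < 2) :
    ((Finset.Ioc k (k + D)).filter fun j => j % 2 = e).card = (D + (k + e) % 2) / 2 := by
  induction D with
  | zero => simp
  | succ D ih =>
    have : Finset.Ioc k (k + (D + 1)) = insert (k + D + 1) (Finset.Ioc k (k + D)) := by
      ext j; simp only [Finset.mem_Ioc, Finset.mem_insert]; omega
    rw [this, Finset.filter_insert]
    split_ifs with h
    · rw [Finset.card_insert_of_notMem (by simp), ih]; omega
    · rw [ih]; omega

theorem Quadrant.isOdd_iff (q : Quadrant) : q.IsOdd ↔ q.index % 2 = 0 := by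
  cases q <;> simp [Quadrant.IsOdd, Quadrant.index]

theorem add_crossings_mod {q r : Quadrant} {k : ℕ} (hk : k % 4 = q.index) (j : ℕ) :
    (k + crossings q r j) % 4 = r.index := by
  unfold crossings
  cases q <;> cases r <;> simp only [Quadrant.index] at * <;> omega

theorem two_le_crossings (q r : Quadrant) (j : ℕ) : 2 ≤ crossings q r j := by
  unfold crossings; omega

theorem crossings_le (q r : Quadrant) {j β : ℕ} (hj : j < β) : crossings q r j + 1 ≤ 4 * β + 2 := by
  unfold crossings; omega

/-- Each further lap adds four half-axes, two of them on the `y`-axis, so the number of zeros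
determines the lap. -/
theorem crossingsY_injective (q r : Quadrant) : Function.Injective (crossingsY q r) := fun i j h => by
  simp only [crossingsY, crossings] at h
  omega

namespace IsRing

variable {lam p μ x₁ x₂ κ₀ : ℝ} (h : IsRing lam p μ x₁ x₂ κ₀)

include h

theorem continuous_angle (c φ : ℝ) : Continuous (angle lam p μ κ₀ c φ) :=
  continuous_iff_continuousAt.2 fun t => (h.hasDerivAt_angle c φ t).continuousAt

theorem hump_zeros {c φ τ s : ℝ} (hc : c ∈ Icc x₁ x₂) (hτ : 0 < τ) {q r : Quadrant} {k j : ℕ}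
    (hk : k % 4 = q.index) (hφ : φ ∈ quarter k)
    (hψ : angle lam p μ κ₀ c φ τ ∈ quarter (k + crossings q r j)) {f : ℝ → ℝ}
    (hf : ∀ t ∈ Icc s (s + τ), f t = (hump lam p μ κ₀ c φ (t - s)).1) :
    (zerosIn f s (s + τ) (¬ q.IsOdd) r.IsOdd).encard = crossingsY q r j := by
  have hr := add_crossings_mod (r := r) hk j
  have hq2 := Nat.mod_mod_of_dvd k (show 2 ∣ 4 by norm_num)
  have hr2 := Nat.mod_mod_of_dvd (k + crossings q r j) (show 2 ∣ 4 by norm_num)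
  rw [hk] at hq2
  rw [hr] at hr2
  rw [encard_zerosIn (θ := fun t => angle lam p μ κ₀ c φ (t - s)) (k := k) (D := crossings q r j)
    (e := 0) (by linarith), card_filter_mod_two _ _ _ (by norm_num), crossingsY, hq2, add_zero]
  · exact (h.continuous_angle c φ).comp (continuous_sub_right s)
  · exact fun x y hxy => h.isSpeed.strictMono_turn _ _ (by linarith)
  · have := two_le_crossings q r j; omega
  · norm_num
  · simp only [sub_self]; rw [angle, h.isSpeed.turn_zero]; exact hφ
  · simpa using hψ
  · intro t ht
    rw [hf t ht, hump, point, mul_eq_zero, or_iff_right (h.amp_pos hc).ne', Real.sin_eq_zero_iff]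
    refine exists_congr fun n => ?_
    rw [eq_comm]
    have : ((2 * n + (0 : ℕ) : ℤ) : ℝ) * (Real.pi / 2) = n * Real.pi := by push_cast; ring
    rw [this]
  · rw [Quadrant.isOdd_iff, hq2]
  · rw [Quadrant.isOdd_iff, hr2]

theorem hump_critical {c φ τ s : ℝ} (hc : c ∈ Icc x₁ x₂) (hτ : 0 < τ) {q r : Quadrant} {k j : ℕ}
    (hk : k % 4 = q.index) (hφ : φ ∈ quarter k)
    (hψ : angle lam p μ κ₀ c φ τ ∈ quarter (k + crossings q r j)) {f : ℝ → ℝ}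
    (hf : ∀ t ∈ Icc s (s + τ), f t = (hump lam p μ κ₀ c φ (t - s)).2) :
    (zerosIn f s (s + τ) q.IsOdd (¬ r.IsOdd)).encard = crossingsX q r j := by
  have hr := add_crossings_mod (r := r) hk j
  have hq2 := Nat.mod_mod_of_dvd k (show 2 ∣ 4 by norm_num)
  have hr2 := Nat.mod_mod_of_dvd (k + crossings q r j) (show 2 ∣ 4 by norm_num)
  rw [hk] at hq2
  rw [hr] at hr2
  rw [encard_zerosIn (θ := fun t => angle lam p μ κ₀ c φ (t - s)) (k := k) (D := crossings q r j)
    (e := 1) (by linarith), card_filter_mod_two _ _ _ (by norm_num), crossingsX, hq2]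
  · congr 3; omega
  · exact (h.continuous_angle c φ).comp (continuous_sub_right s)
  · exact fun x y hxy => h.isSpeed.strictMono_turn _ _ (by linarith)
  · have := two_le_crossings q r j; omega
  · norm_num
  · simp only [sub_self]; rw [angle, h.isSpeed.turn_zero]; exact hφ
  · simpa using hψ
  · intro t ht
    rw [hf t ht, hump, point, mul_eq_zero, or_iff_left (h.isSpeed.pos _ _).ne', mul_eq_zero,
      or_iff_right (h.amp_pos hc).ne', Real.cos_eq_zero_iff]
    refine exists_congr fun n => ?_
    have : ((2 * n + (1 : ℕ) : ℤ) : ℝ) * (Real.pi / 2) = (2 * n + 1) * Real.pi / 2 := by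
      push_cast; ring
    rw [this]
  · rw [Quadrant.isOdd_iff, hq2]; omega
  · rw [Quadrant.isOdd_iff, hr2]; omega

/-- The orbits of amplitude `c` need more than the time `τ` for a quarter turn. -/
def _root_.MooreNehari.IsSlow (lam p μ κ₀ τ c : ℝ) : Prop :=
  τ < clock (speed lam p κ₀) (μ * c ^ (p - 1)) (Real.pi / 2)

/-- The orbits of amplitude `c` make `n` quarter turns in the time `τ`. -/
def _root_.MooreNehari.IsFast (lam p μ κ₀ τ : ℝ) (n : ℕ) (c : ℝ) : Prop :=
  ∀ φ, n * (Real.pi / 2) / τ ≤ speed lam p κ₀ (μ * c ^ (p - 1)) φ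

theorem angle_lt_of_slow {τ c : ℝ} (hs : IsSlow lam p μ κ₀ τ c) {k : ℕ} {φ : ℝ}
    (hφ : φ ∈ quarter k) : angle lam p μ κ₀ c φ τ < (k + 2) * (Real.pi / 2) :=
  h.isSpeed.turn_lt_of_slow (speed_neg _ _ _ _) (speed_add_pi _ _ _ _) hs hφ.2

theorem le_angle_of_fast {τ c : ℝ} (hτ : 0 < τ) {n : ℕ} (hn : 0 < n)
    (hs : IsFast lam p μ κ₀ τ n c) {k : ℕ} {φ : ℝ} (hφ : φ ∈ quarter k) :
    (k + n) * (Real.pi / 2) ≤ angle lam p μ κ₀ c φ τ := by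
  have hn' : (0 : ℝ) < n := by exact_mod_cast hn
  have hpi := Real.pi_pos
  have h1 := h.isSpeed.add_mul_le_turn (by positivity) hs φ hτ.le
  rw [div_mul_cancel₀ _ hτ.ne'] at h1
  have h2 := hφ.1
  rw [angle]
  linarith

theorem continuousOn_angle {c φ : ℝ → ℝ} {s : Set ℝ} (hc : ContinuousOn c s)
    (hcm : ∀ t ∈ s, c t ∈ Icc x₁ x₂) (hφ : ContinuousOn φ s) (τ : ℝ) :
    ContinuousOn (fun t => angle lam p μ κ₀ (c t) (φ t) τ) s :=
  h.isSpeed.continuous_turn.comp_continuousOn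
    ((((continuousOn_param p μ).comp hc fun t ht => h.amp_pos (hcm t ht)).prodMk hφ).prodMk
      continuousOn_const)

/-- On a hump a path across the annulus is stretched to a path which runs through any prescribed
quarter turn. -/
theorem exists_hump_crossing {τ : ℝ} (hτ : 0 < τ) {β : ℕ}
    (htwist : IsSlow lam p μ κ₀ τ x₁ ∧ IsFast lam p μ κ₀ τ (4 * β + 3) x₂ ∨
      IsFast lam p μ κ₀ τ (4 * β + 3) x₁ ∧ IsSlow lam p μ κ₀ τ x₂)
    {c φ : ℝ → ℝ} {a b : ℝ} (hc : ContinuousOn c (uIcc a b)) (hφ : ContinuousOn φ (uIcc a b)) {k : ℕ}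
    (hm : ∀ t ∈ uIcc a b, c t ∈ Icc x₁ x₂ ∧ φ t ∈ quarter k) (ha : c a = x₁) (hb : c b = x₂)
    {D : ℕ} (hD2 : 2 ≤ D) (hDβ : D + 1 ≤ 4 * β + 2) :
    ∃ a' ∈ uIcc a b, ∃ b' ∈ uIcc a b,
      angle lam p μ κ₀ (c a') (φ a') τ = (k + D : ℕ) * (Real.pi / 2) ∧
      angle lam p μ κ₀ (c b') (φ b') τ = ((k + D : ℕ) + 1) * (Real.pi / 2) ∧
      ∀ t ∈ uIcc a' b', angle lam p μ κ₀ (c t) (φ t) τ ∈ quarter (k + D) := by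
  have hpi : 0 < Real.pi / 2 := by linarith [Real.pi_pos]
  have hθ := h.continuousOn_angle hc (fun t ht => (hm t ht).1) hφ τ
  have hD2' : (2 : ℝ) ≤ D := by exact_mod_cast hD2
  have hDβ' : (D : ℝ) + 1 ≤ 4 * β + 2 := by exact_mod_cast hDβ
  -- A slow end has not reached quarter `k + 2 ≤ k + D`, whereas a fast end has passed quarter `k +
  -- D`, as `D + 1 ≤ 4 β + 2`; in between the angle crosses the whole quarter.
  have slow : ∀ t ∈ uIcc a b, IsSlow lam p μ κ₀ τ (c t) →
      angle lam p μ κ₀ (c t) (φ t) τ ≤ (k + D : ℕ) * (Real.pi / 2) := fun t ht hs => by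
    refine (h.angle_lt_of_slow hs (hm t ht).2).le.trans ?_
    push_cast
    gcongr
  have fast : ∀ t ∈ uIcc a b, IsFast lam p μ κ₀ τ (4 * β + 3) (c t) →
      ((k + D : ℕ) + 1) * (Real.pi / 2) ≤ angle lam p μ κ₀ (c t) (φ t) τ := fun t ht hs => by
    refine le_trans ?_ (h.le_angle_of_fast hτ (by omega) hs (hm t ht).2)
    push_cast
    gcongr ?_ * _
    linarith
  have hle : ((k + D : ℕ) : ℝ) * (Real.pi / 2) ≤ ((k + D : ℕ) + 1) * (Real.pi / 2) := by
    gcongr; linarith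
  rcases htwist with ⟨h1, h2⟩ | ⟨h1, h2⟩
  · exact exists_crossing hθ (slow a left_mem_uIcc (by rwa [ha])) hle
      (fast b right_mem_uIcc (by rwa [hb]))
  · rw [uIcc_comm] at hθ ⊢
    exact exists_crossing hθ (slow b right_mem_uIcc (by rwa [hb])) hle
      (fast a left_mem_uIcc (by rwa [ha]))

end IsRing

/-! ### Gaps -/

/-- `u' + ν u` and `u' - ν u` are the expanding and the contracting coordinate of the saddle; they
keep their signs over a gap. -/
theorem gap_snd_add (ν : ℝ) (hν : ν ≠ 0) (z : ℝ × ℝ) (t : ℝ) :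
    (gap ν z t).2 + ν * (gap ν z t).1 = (z.2 + ν * z.1) * Real.exp (ν * t) := by
  rw [← Real.cosh_add_sinh]; simp only [gap]; field_simp; ring

theorem gap_snd_sub (ν : ℝ) (hν : ν ≠ 0) (z : ℝ × ℝ) (t : ℝ) :
    (gap ν z t).2 - ν * (gap ν z t).1 = (z.2 - ν * z.1) * Real.exp (-(ν * t)) := by
  rw [← Real.cosh_sub_sinh]; simp only [gap]; field_simp; ring

theorem encard_zeros_of_strictMono {f : ℝ → ℝ} (hf : Continuous f) (hm : StrictMono f) {a b : ℝ}
    (hab : a ≤ b) (ha : f a < 0) (hb : 0 < f b) : {t ∈ Ioo a b | f t = 0}.encard = 1 := by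
  obtain ⟨t, ht, hft⟩ := intermediate_value_Ioo hab hf.continuousOn ⟨ha, hb⟩
  rw [encard_eq_one]
  exact ⟨t, Set.ext fun s => ⟨fun hs => hm.injective (hs.2.trans hft.symm), fun hs => by
    rw [mem_singleton_iff.1 hs]; exact ⟨ht, hft⟩⟩⟩

/-- The start in II fixes the sign of `u' - ν u` and the end in I that of `u' + ν u`. Both are
positive, so `u' > 0` throughout and `u` has a single sign change. -/
theorem gap_nodal_of_mem_I {ν : ℝ} (hν : 0 < ν) {z : ℝ × ℝ} {s T : ℝ} (hT : 0 < T)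
    (hz : z ∈ Quadrant.II.opened) (hw : gap ν z T ∈ Quadrant.I.opened) :
    {t ∈ Ioo s (s + T) | (gap ν z (t - s)).1 = 0}.encard = 1 ∧
      {t ∈ Ioo s (s + T) | (gap ν z (t - s)).2 = 0}.encard = 0 := by
  have hpos : ∀ t, 0 < (gap ν z t).2 := by
    intro t
    have h1 := gap_snd_add ν hν.ne' z T
    have h2 : 0 < z.2 + ν * z.1 :=
      pos_of_mul_pos_left (h1 ▸ add_pos hw.2 (mul_pos hν hw.1)) (Real.exp_pos _).le
    have h3 : 0 < z.2 - ν * z.1 := by nlinarith [hz.1, hz.2]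
    have h4 := gap_snd_add ν hν.ne' z t
    have h5 := gap_snd_sub ν hν.ne' z t
    linarith [mul_pos h2 (Real.exp_pos (ν * t)), mul_pos h3 (Real.exp_pos (-(ν * t)))]
  -- The exponent `1` is arbitrary, because the nonlinear term has the weight `0` here.
  have hd : ∀ t, HasDerivAt (fun t => (gap ν z (t - s)).1) (gap ν z (t - s)).2 t :=
    ((isFlow_gap hν.ne' 1 z).comp_sub s).fst
  constructor
  · refine encard_zeros_of_strictMono (continuous_iff_continuousAt.2 fun t => (hd t).continuousAt)
      (strictMono_of_deriv_pos fun t => (hd t).deriv ▸ hpos _) (by linarith) ?_ ?_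
    · simpa [gap_zero] using hz.1
    · simpa using hw.1
  · rw [encard_eq_zero, eq_empty_iff_forall_notMem]
    exact fun t ht => (hpos _).ne' ht.2

/-- Now `u' + ν u < 0 < u' - ν u`, hence `u < 0`, so `u'' = ν² u < 0` and `u'` decreases strictly
through zero. -/
theorem gap_nodal_of_mem_III {ν : ℝ} (hν : 0 < ν) {z : ℝ × ℝ} {s T : ℝ} (hT : 0 < T)
    (hz : z ∈ Quadrant.II.opened) (hw : gap ν z T ∈ Quadrant.III.opened) :
    {t ∈ Ioo s (s + T) | (gap ν z (t - s)).1 = 0}.encard = 0 ∧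
      {t ∈ Ioo s (s + T) | (gap ν z (t - s)).2 = 0}.encard = 1 := by
  have hneg : ∀ t, (gap ν z t).1 < 0 := by
    intro t
    have h1 := gap_snd_add ν hν.ne' z T
    have h2 : z.2 + ν * z.1 < 0 := by
      by_contra! h0
      have := mul_nonneg h0 (Real.exp_pos (ν * T)).le
      have h6 := mul_pos_of_neg_of_neg (neg_lt_zero.2 hν) hw.1
      linarith [hw.2]
    have h3 : 0 < z.2 - ν * z.1 := by nlinarith [hz.1, hz.2]
    have h4 := gap_snd_add ν hν.ne' z t
    have h5 := gap_snd_sub ν hν.ne' z t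
    have h6 := mul_neg_of_neg_of_pos h2 (Real.exp_pos (ν * t))
    have h7 := mul_pos h3 (Real.exp_pos (-(ν * t)))
    have h8 : ν * (gap ν z t).1 < 0 := by linarith
    exact (pos_iff_neg_of_mul_neg h8).1 hν
  have hd : ∀ t, HasDerivAt (fun t => -(gap ν z (t - s)).2) (-(ν ^ 2 * (gap ν z (t - s)).1)) t :=
    fun t => (((isFlow_gap hν.ne' 1 z).comp_sub s).snd t).neg.congr_deriv (by ring)
  constructor
  · rw [encard_eq_zero, eq_empty_iff_forall_notMem]
    exact fun t ht => (hneg _).ne ht.2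
  · have := encard_zeros_of_strictMono (continuous_iff_continuousAt.2 fun t => (hd t).continuousAt)
      (strictMono_of_deriv_pos fun t => by
        rw [(hd t).deriv]; nlinarith [mul_pos (pow_pos hν 2) (neg_pos.2 (hneg (t - s)))])
      (a := s) (b := s + T) (by linarith) (by simpa [gap_zero] using hz.2) (by simpa using hw.2)
    simpa using this

/-- The quadrant at the end of a hump. -/
def midOf (b : Bool) : Quadrant := if b then .II else .IV

/-- The quadrant at the end of a gap. -/
def nextOf (b : Bool) : Quadrant := if b then .I else .III

theorem gap_nodal {ν : ℝ} (hν : 0 < ν) {z : ℝ × ℝ} {s T : ℝ} (hT : 0 < T) {b n : Bool}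
    (hz : z ∈ (midOf b).opened) (hw : gap ν z T ∈ (nextOf n).opened) :
    ({t ∈ Ioo s (s + T) | (gap ν z (t - s)).1 = 0}.encard = if b = n then 1 else 0) ∧
      {t ∈ Ioo s (s + T) | (gap ν z (t - s)).2 = 0}.encard = if b = n then 0 else 1 := by
  have hneg : ∀ t, (gap ν (-z) t) = -gap ν z t := gap_neg ν z
  cases b <;> cases n <;> simp only [midOf, nextOf, Bool.false_eq_true, if_false, if_true,
    reduceCtorEq] at *
  · have := gap_nodal_of_mem_I hν (z := -z) (s := s) hT ⟨neg_lt_zero.2 hz.1, neg_pos.2 hz.2⟩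
      (by rw [hneg]; exact ⟨neg_pos.2 hw.1, neg_pos.2 hw.2⟩)
    simpa [hneg] using this
  · have := gap_nodal_of_mem_III hν (z := -z) (s := s) hT ⟨neg_lt_zero.2 hz.1, neg_pos.2 hz.2⟩
      (by rw [hneg]; exact ⟨neg_lt_zero.2 hw.1, neg_lt_zero.2 hw.2⟩)
    simpa [hneg] using this
  · exact gap_nodal_of_mem_III hν hT hz hw
  · exact gap_nodal_of_mem_I hν hT hz hw

/-! ### Expansion of the annulus over a long gap. -/

theorem potential_abs (lam p μ x : ℝ) : potential lam p μ |x| = potential lam p μ x := by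
  simp [potential]

theorem potential_zero {lam p μ : ℝ} (hp : 0 < p) : potential lam p μ 0 = 0 := by
  have : p + 1 ≠ 0 := by linarith
  simp [potential, Real.zero_rpow this]

theorem neg_mem_annulus {lam p μ x₁ x₂ : ℝ} {z : ℝ × ℝ} :
    -z ∈ annulus lam p μ x₁ x₂ ↔ z ∈ annulus lam p μ x₁ x₂ := by
  simp [annulus, energy, potential]

theorem energy_neg (lam p μ : ℝ) (z : ℝ × ℝ) : energy lam p μ (-z) = energy lam p μ z := by
  simp [energy, potential]

theorem continuous_energy {lam p μ : ℝ} (hp : 0 < p) : Continuous (energy lam p μ) := by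
  have : Continuous (potential lam p μ) :=
    continuous_iff_continuousAt.2 fun x => (hasDerivAt_potential hp x).continuousAt
  unfold energy
  fun_prop

theorem continuous_gap (ν t : ℝ) : Continuous fun z : ℝ × ℝ => gap ν z t := by
  unfold gap
  fun_prop

/-- The length `T` of the gaps is so large that the saddle point expands sufficiently. -/
structure IsLongGap (ν p μ x₁ x₂ T : ℝ) : Prop where
  pos : 0 < ν
  sinh_pos : 0 < Real.sinh (ν * T)
  amplitude : x₂ < x₁ * Real.cosh (ν * T)
  outer : (ν * x₂) ^ 2 < 2 * potential (-ν ^ 2) p μ x₁ * Real.sinh (ν * T) ^ 2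
  inner : 2 * potential (-ν ^ 2) p μ x₂ + (ν * x₂) ^ 2 <
    2 * potential (-ν ^ 2) p μ x₁ * Real.cosh (ν * T) ^ 2

section GapCrossing

variable {ν p μ x₁ x₂ T : ℝ} (hp : 0 < p) (hμ : 0 < μ) (hA : IsAnnulus (-ν ^ 2) p μ x₁ x₂)
  (hT : IsLongGap ν p μ x₁ x₂ T)

include hp hA

omit hp hA in
theorem le_energy_of_abs_eq {z : ℝ × ℝ} (hz : |z.1| = x₂) :
    potential (-ν ^ 2) p μ x₂ ≤ energy (-ν ^ 2) p μ z := by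
  rw [energy, ← potential_abs _ _ _ z.1, hz]
  linarith [sq_nonneg z.2]

omit hp in
theorem le_abs_of_snd_eq_zero {z : ℝ × ℝ} (hz : z ∈ annulus (-ν ^ 2) p μ x₁ x₂) (h : z.2 = 0) :
    x₁ ≤ |z.1| := by
  by_contra! hlt
  have h1 := hA.below x₁ ⟨le_rfl, hA.lt.le⟩ z.1 hlt
  have h2 := hz.2.1
  simp only [energy, h] at h2
  linarith

omit hA in
theorem sq_of_fst_eq_zero {z : ℝ × ℝ} (hz : z ∈ annulus (-ν ^ 2) p μ x₁ x₂) (h : z.1 = 0) :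
    2 * potential (-ν ^ 2) p μ x₁ ≤ z.2 ^ 2 := by
  have h2 := hz.2.1
  simp only [energy, h, potential_zero hp] at h2
  linarith

include hμ in
omit hA in
theorem sq_snd_le {z : ℝ × ℝ} (hz : z ∈ annulus (-ν ^ 2) p μ x₁ x₂) :
    z.2 ^ 2 ≤ 2 * potential (-ν ^ 2) p μ x₂ + (ν * x₂) ^ 2 := by
  have h2 := hz.2.2
  have h3 : z.1 ^ 2 ≤ x₂ ^ 2 := by
    rw [← sq_abs]; exact pow_le_pow_left₀ (abs_nonneg _) hz.1 2
  have h4 : 0 ≤ μ / (p + 1) * |z.1| ^ (p + 1) := by positivity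
  have h5 : ν ^ 2 * z.1 ^ 2 ≤ ν ^ 2 * x₂ ^ 2 := by gcongr
  simp only [energy] at h2
  rw [potential] at h2
  nlinarith

omit hp hA in
-- This solves the flow for the initial data: if the image lies on the `y`-axis, its height is that
-- of `z` divided by `cosh (ν T)`. The next identity does the same for the `x`-axis.
theorem cosh_mul_gap_snd (hν : ν ≠ 0) (z : ℝ × ℝ) : Real.cosh (ν * T) * (gap ν z T).2 =
    z.2 + ν * Real.sinh (ν * T) * (gap ν z T).1 := by
  have := Real.cosh_sq (ν * T)
  simp only [gap]
  field_simp
  linear_combination z.2 * this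

omit hp hA in
theorem cosh_mul_gap_fst (hν : ν ≠ 0) (z : ℝ × ℝ) : Real.cosh (ν * T) * (gap ν z T).1 =
    z.1 + Real.sinh (ν * T) / ν * (gap ν z T).2 := by
  have := Real.cosh_sq (ν * T)
  simp only [gap]
  field_simp
  linear_combination ν * z.1 * this

include hμ hT in
omit hA in
-- Images on the `y`-axis fall into the hole of the annulus: their height is at most the largest
-- height in the annulus divided by `cosh (ν T)`.
theorem energy_gap_lt_of_fst_eq_zero {z : ℝ × ℝ} (hz : z ∈ annulus (-ν ^ 2) p μ x₁ x₂)
    (h : (gap ν z T).1 = 0) : energy (-ν ^ 2) p μ (gap ν z T) < potential (-ν ^ 2) p μ x₁ := by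
  have h1 := cosh_mul_gap_snd (T := T) hT.pos.ne' z
  rw [h, mul_zero, add_zero] at h1
  have h2 := sq_snd_le hp hμ hz
  rw [← h1, mul_pow] at h2
  have h3 : 0 < Real.cosh (ν * T) ^ 2 := pow_pos (Real.cosh_pos _) 2
  have h4 := h2.trans_lt hT.inner
  have h5 : (gap ν z T).2 ^ 2 < 2 * potential (-ν ^ 2) p μ x₁ := by
    by_contra! h6
    nlinarith [mul_le_mul_of_nonneg_left h6 h3.le]
  rw [energy, h, potential_zero hp]
  linarith

include hT in
omit hp in
theorem energy_gap_lt_of_snd_eq_zero {z : ℝ × ℝ} (hz : z ∈ annulus (-ν ^ 2) p μ x₁ x₂)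
    (h : (gap ν z T).2 = 0) : energy (-ν ^ 2) p μ (gap ν z T) < potential (-ν ^ 2) p μ x₁ := by
  have h1 := cosh_mul_gap_fst (T := T) hT.pos.ne' z
  rw [h, mul_zero, add_zero] at h1
  have h3 := Real.cosh_pos (ν * T)
  have h4 : |(gap ν z T).1| < x₁ := by
    have h5 := hz.1
    rw [← h1, abs_mul, abs_of_pos h3] at h5
    by_contra! h6
    nlinarith [mul_le_mul_of_nonneg_left h6 h3.le, hT.amplitude]
  have := hA.below x₁ ⟨le_rfl, hA.lt.le⟩ _ h4
  rw [energy, h]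
  linarith

include hT in
omit hp in
-- The end of the path on the `x`-axis is thrown beyond the annulus to the left; by
-- `lt_gap_of_fst_eq_zero` the end on the `y`-axis is thrown beyond it to the right.
theorem lt_abs_gap_of_snd_eq_zero {z : ℝ × ℝ} (hz : z ∈ annulus (-ν ^ 2) p μ x₁ x₂)
    (hq : z ∈ Quadrant.II.closed) (h : z.2 = 0) : (gap ν z T).1 < 0 ∧ x₂ < |(gap ν z T).1| := by
  have h1 := le_abs_of_snd_eq_zero hA hz h
  rw [abs_of_nonpos hq.1] at h1
  have h2 : (gap ν z T).1 = z.1 * Real.cosh (ν * T) := by simp [gap, h]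
  have h3 := Real.cosh_pos (ν * T)
  have h4 : x₁ * Real.cosh (ν * T) ≤ -z.1 * Real.cosh (ν * T) := by gcongr
  have h5 : (gap ν z T).1 < 0 := by
    rw [h2]; nlinarith [mul_pos hA.pos h3]
  refine ⟨h5, ?_⟩
  rw [abs_of_neg h5, h2]
  linarith [hT.amplitude]

include hT in
theorem lt_gap_of_fst_eq_zero {z : ℝ × ℝ} (hz : z ∈ annulus (-ν ^ 2) p μ x₁ x₂)
    (hq : z ∈ Quadrant.II.closed) (h : z.1 = 0) : x₂ < (gap ν z T).1 ∧ 0 < (gap ν z T).2 := by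
  have h1 := sq_of_fst_eq_zero hp hz h
  have h2 : (gap ν z T).1 = z.2 / ν * Real.sinh (ν * T) := by simp [gap, h]
  have h2' : (gap ν z T).2 = z.2 * Real.cosh (ν * T) := by simp [gap, h]
  have h0 := hA.energy_pos
  have h3 : 0 < z.2 := lt_of_le_of_ne hq.2 fun h' => by rw [← h'] at h1; norm_num at h1; linarith
  have h4 := hT.pos
  have h5 := hT.sinh_pos
  refine ⟨?_, by rw [h2']; exact mul_pos h3 (Real.cosh_pos _)⟩
  have h6 : ν * x₂ < z.2 * Real.sinh (ν * T) := by
    refine lt_of_pow_lt_pow_left₀ 2 (by positivity) (hT.outer.trans_le ?_)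
    rw [mul_pow]
    gcongr
  rw [h2, div_mul_eq_mul_div, lt_div_iff₀ h4]
  linarith

variable {z : ℝ → ℝ × ℝ} {a b : ℝ}

include hμ hT in
-- After the last parameter at which the image meets the `y`-axis, necessarily in the hole, the
-- image stays in `u ≥ 0` and must cross the annulus to get beyond `x₂`. There `u' > 0` by
-- `cosh_mul_gap_snd`, and all inequalities are strict because axis points of the path or of the
-- image never land in the annulus.
theorem exists_gap_crossing_I (hz : ContinuousOn z (uIcc a b))
    (hzm : ∀ t ∈ uIcc a b, z t ∈ annulus (-ν ^ 2) p μ x₁ x₂ ∩ Quadrant.II.closed)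
    (ha : (z a).2 = 0) (hb : (z b).1 = 0) :
    ∃ a' ∈ uIcc a b, ∃ b' ∈ uIcc a b,
      energy (-ν ^ 2) p μ (gap ν (z a') T) = potential (-ν ^ 2) p μ x₁ ∧
      energy (-ν ^ 2) p μ (gap ν (z b') T) = potential (-ν ^ 2) p μ x₂ ∧
      ∀ t ∈ uIcc a' b', z t ∈ Quadrant.II.opened ∧
        gap ν (z t) T ∈ annulus (-ν ^ 2) p μ x₁ x₂ ∩ Quadrant.I.opened := by
  have hW : ContinuousOn (fun t => gap ν (z t) T) (uIcc a b) :=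
    (continuous_gap ν T).comp_continuousOn hz
  have ma := hzm a left_mem_uIcc
  have mb := hzm b right_mem_uIcc
  obtain ⟨a₁, ha₁, hX₁, hX⟩ := exists_last hW.fst (m := 0)
    (lt_abs_gap_of_snd_eq_zero hA hT ma.1 ma.2 ha).1.le
    ((hA.pos.trans hA.lt).trans (lt_gap_of_fst_eq_zero hp hA hT mb.1 mb.2 hb).1).le
  have hs : uIcc a₁ b ⊆ uIcc a b := uIcc_subset_uIcc ha₁ right_mem_uIcc
  obtain ⟨a', ha', b', hb', e1, e2, hm⟩ := exists_annular_crossing (a := a₁) (b := b)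
    (e := fun t => energy (-ν ^ 2) p μ (gap ν (z t) T)) (X := fun t => |(gap ν (z t) T).1|)
    ((continuous_energy hp).comp_continuousOn (hW.mono hs)) (hW.fst.mono hs).abs
    (hA.below x₂ ⟨hA.lt.le, le_rfl⟩ x₁ (by rw [abs_of_pos hA.pos]; exact hA.lt)).le
    (energy_gap_lt_of_fst_eq_zero hp hμ hT (hzm _ ha₁).1 hX₁).le
    (by simp only [hX₁, abs_zero]; exact (hA.pos.trans hA.lt).le)
    (.inl ((lt_gap_of_fst_eq_zero hp hA hT mb.1 mb.2 hb).1.le.trans (le_abs_self _)))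
    (fun t _ h => le_energy_of_abs_eq h)
  refine ⟨a', hs ha', b', hs hb', e1, e2, fun t ht => ?_⟩
  obtain ⟨h1, h2, h3⟩ := hm t ht
  have ht₁ : t ∈ uIcc a₁ b := uIcc_subset_uIcc ha' hb' ht
  obtain ⟨hzA, hzq⟩ := hzm t (hs ht₁)
  have hX0 : 0 ≤ (gap ν (z t) T).1 := hX t ht₁
  have hy : 0 < (z t).2 := lt_of_le_of_ne hzq.2 fun h =>
    absurd (lt_abs_gap_of_snd_eq_zero hA hT hzA hzq h.symm).1 (not_lt.2 hX0)
  have hx : (z t).1 < 0 := lt_of_le_of_ne hzq.1 fun h =>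
    absurd (lt_gap_of_fst_eq_zero hp hA hT hzA hzq h).1
      (not_lt.2 ((le_abs_self _).trans h1))
  have hX1 : 0 < (gap ν (z t) T).1 := lt_of_le_of_ne hX0 fun h =>
    absurd (energy_gap_lt_of_fst_eq_zero hp hμ hT hzA h.symm) (not_lt.2 h2)
  have hY : 0 < (gap ν (z t) T).2 := by
    have h4 := cosh_mul_gap_snd (T := T) hT.pos.ne' (z t)
    have h5 := hT.pos
    have h6 := hT.sinh_pos
    have h7 : 0 < Real.cosh (ν * T) * (gap ν (z t) T).2 := by rw [h4]; positivity
    exact pos_of_mul_pos_right h7 (Real.cosh_pos _).le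
  exact ⟨⟨hx, hy⟩, ⟨h1, h2, h3⟩, hX1, hY⟩

include hT in
theorem exists_gap_crossing_III (hz : ContinuousOn z (uIcc a b))
    (hzm : ∀ t ∈ uIcc a b, z t ∈ annulus (-ν ^ 2) p μ x₁ x₂ ∩ Quadrant.II.closed)
    (ha : (z a).2 = 0) (hb : (z b).1 = 0) :
    ∃ a' ∈ uIcc a b, ∃ b' ∈ uIcc a b,
      energy (-ν ^ 2) p μ (gap ν (z a') T) = potential (-ν ^ 2) p μ x₁ ∧
      energy (-ν ^ 2) p μ (gap ν (z b') T) = potential (-ν ^ 2) p μ x₂ ∧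
      ∀ t ∈ uIcc a' b', z t ∈ Quadrant.II.opened ∧
        gap ν (z t) T ∈ annulus (-ν ^ 2) p μ x₁ x₂ ∩ Quadrant.III.opened := by
  -- The path is read backwards, from the `y`-axis to the `x`-axis, and cut where its image last
  -- meets the `x`-axis.
  rw [uIcc_comm] at hz hzm ⊢
  have hW : ContinuousOn (fun t => gap ν (z t) T) (uIcc b a) :=
    (continuous_gap ν T).comp_continuousOn hz
  have ma := hzm a right_mem_uIcc
  have mb := hzm b left_mem_uIcc
  have hν := hT.pos
  have hsh := hT.sinh_pos
  have hch := Real.cosh_pos (ν * T)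
  have hYa : 0 ≤ -(gap ν (z a) T).2 := by
    have := mul_nonneg (mul_nonneg hν.le (neg_nonneg.2 ma.2.1)) hsh.le
    simp only [gap, ha, zero_mul, add_zero]
    linarith
  obtain ⟨b₁, hb₁, hY₁, hY⟩ := exists_last (g := fun t => -(gap ν (z t) T).2) hW.snd.neg (m := 0)
    (neg_nonpos.2 (lt_gap_of_fst_eq_zero hp hA hT mb.1 mb.2 hb).2.le) hYa
  rw [neg_eq_zero] at hY₁
  have hs : uIcc b₁ a ⊆ uIcc b a := uIcc_subset_uIcc hb₁ right_mem_uIcc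
  have hin := energy_gap_lt_of_snd_eq_zero (p := p) hA hT (hzm _ hb₁).1 hY₁
  have hxb : |(gap ν (z b₁) T).1| ≤ x₂ := by
    have h1 := cosh_mul_gap_fst (T := T) hν.ne' (z b₁)
    rw [hY₁, mul_zero, add_zero] at h1
    refine le_trans ?_ (hzm _ hb₁).1.1
    rw [← h1, abs_mul, abs_of_pos hch]
    exact le_mul_of_one_le_left (abs_nonneg _) (Real.one_le_cosh _)
  obtain ⟨a', ha', b', hb', e1, e2, hm⟩ := exists_annular_crossing (a := b₁) (b := a)
    (e := fun t => energy (-ν ^ 2) p μ (gap ν (z t) T)) (X := fun t => |(gap ν (z t) T).1|)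
    ((continuous_energy hp).comp_continuousOn (hW.mono hs)) (hW.fst.mono hs).abs
    (hA.below x₂ ⟨hA.lt.le, le_rfl⟩ x₁ (by rw [abs_of_pos hA.pos]; exact hA.lt)).le
    hin.le hxb
    (.inl (lt_abs_gap_of_snd_eq_zero hA hT ma.1 ma.2 ha).2.le)
    (fun t _ h => le_energy_of_abs_eq h)
  refine ⟨a', hs ha', b', hs hb', e1, e2, fun t ht => ?_⟩
  obtain ⟨h1, h2, h3⟩ := hm t ht
  have ht₁ : t ∈ uIcc b₁ a := uIcc_subset_uIcc ha' hb' ht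
  obtain ⟨hzA, hzq⟩ := hzm t (hs ht₁)
  have hY0 : (gap ν (z t) T).2 ≤ 0 := by linarith [hY t ht₁]
  have hY1 : (gap ν (z t) T).2 < 0 := lt_of_le_of_ne hY0 fun h =>
    absurd (energy_gap_lt_of_snd_eq_zero hA hT hzA h) (not_lt.2 h2)
  have hy : 0 < (z t).2 := lt_of_le_of_ne hzq.2 fun h =>
    absurd (lt_abs_gap_of_snd_eq_zero hA hT hzA hzq h.symm).2 (not_lt.2 h1)
  have hx : (z t).1 < 0 := lt_of_le_of_ne hzq.1 fun h =>
    absurd (lt_gap_of_fst_eq_zero hp hA hT hzA hzq h).2 (not_lt.2 hY0)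
  have hX : (gap ν (z t) T).1 < 0 := by
    have h4 := cosh_mul_gap_fst (T := T) hν.ne' (z t)
    have h5 : Real.sinh (ν * T) / ν * (gap ν (z t) T).2 < 0 :=
      mul_neg_of_pos_of_neg (by positivity) hY1
    by_contra! h6
    linarith [mul_nonneg hch.le h6]
  exact ⟨⟨hx, hy⟩, ⟨h1, h2, h3⟩, hX, hY1⟩

include hμ hT in
/-- Over a gap, a path through a quarter of the annulus is stretched across the annulus, in
either of the quadrants `I` and `III`. -/
theorem exists_gap_crossing (hz : ContinuousOn z (uIcc a b)) (m n : Bool)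
    (hzm : ∀ t ∈ uIcc a b, z t ∈ annulus (-ν ^ 2) p μ x₁ x₂ ∩ (midOf m).closed)
    (ha : (z a).2 = 0) (hb : (z b).1 = 0) :
    ∃ a' ∈ uIcc a b, ∃ b' ∈ uIcc a b,
      energy (-ν ^ 2) p μ (gap ν (z a') T) = potential (-ν ^ 2) p μ x₁ ∧
      energy (-ν ^ 2) p μ (gap ν (z b') T) = potential (-ν ^ 2) p μ x₂ ∧
      ∀ t ∈ uIcc a' b', z t ∈ (midOf m).opened ∧
        gap ν (z t) T ∈ annulus (-ν ^ 2) p μ x₁ x₂ ∩ (nextOf n).opened := by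
  have hneg : m = false → ∀ t ∈ uIcc a b,
      -z t ∈ annulus (-ν ^ 2) p μ x₁ x₂ ∩ Quadrant.II.closed := by
    rintro rfl t ht
    have := (hzm t ht).2
    exact ⟨neg_mem_annulus.2 (hzm t ht).1, neg_nonpos.2 this.1, neg_nonneg.2 this.2⟩
  cases m
  · cases n
    · obtain ⟨a', ha', b', hb', e1, e2, hm⟩ := exists_gap_crossing_I hp hμ hA hT hz.neg (hneg rfl)
        (by simpa using ha) (by simpa using hb)
      simp only [Pi.neg_apply, gap_neg, energy_neg] at e1 e2 hm
      refine ⟨a', ha', b', hb', e1, e2, fun t ht => ?_⟩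
      obtain ⟨h1, h2, h3⟩ := hm t ht
      exact ⟨⟨neg_neg_iff_pos.1 h1.1, neg_pos.1 h1.2⟩, neg_mem_annulus.1 h2, neg_pos.1 h3.1,
        neg_pos.1 h3.2⟩
    · obtain ⟨a', ha', b', hb', e1, e2, hm⟩ := exists_gap_crossing_III hp hA hT hz.neg (hneg rfl)
        (by simpa using ha) (by simpa using hb)
      simp only [Pi.neg_apply, gap_neg, energy_neg] at e1 e2 hm
      refine ⟨a', ha', b', hb', e1, e2, fun t ht => ?_⟩
      obtain ⟨h1, h2, h3⟩ := hm t ht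
      exact ⟨⟨neg_neg_iff_pos.1 h1.1, neg_pos.1 h1.2⟩, neg_mem_annulus.1 h2, neg_neg_iff_pos.1 h3.1,
        neg_neg_iff_pos.1 h3.2⟩
  · cases n
    · exact exists_gap_crossing_III hp hA hT hz hzm ha hb
    · exact exists_gap_crossing_I hp hμ hA hT hz hzm ha hb

end GapCrossing

/-! ### Following an itinerary -/

theorem Quadrant.opened_subset_closed (q : Quadrant) : q.opened ⊆ q.closed := by
  rintro z hz
  cases q <;> exact ⟨hz.1.le, hz.2.le⟩

theorem Quadrant.index_mod (q : Quadrant) : q.index % 4 = q.index := by cases q <;> rfl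

/-- An unbounded arc in a quadrant has a piece which crosses the annulus. -/
theorem IsUnboundedArc.exists_crossing {ν p μ x₁ x₂ : ℝ} (hp : 0 < p) (hμ : 0 < μ)
    (hA : IsAnnulus (-ν ^ 2) p μ x₁ x₂) {r : Set (ℝ × ℝ)} (hr : IsUnboundedArc r) {q : Quadrant}
    (hq : r ⊆ q.closed) :
    ∃ (Z : ℝ → ℝ × ℝ) (a b : ℝ), ContinuousOn Z (uIcc a b) ∧
      energy (-ν ^ 2) p μ (Z a) = potential (-ν ^ 2) p μ x₁ ∧
      energy (-ν ^ 2) p μ (Z b) = potential (-ν ^ 2) p μ x₂ ∧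
      ∀ t ∈ uIcc a b, Z t ∈ annulus (-ν ^ 2) p μ x₁ x₂ ∩ q.closed ∧ Z t ∈ r := by
  obtain ⟨Z, hZc, -, hZ0, hZt, rfl⟩ := hr
  have hx₂ : 0 < x₂ := hA.pos.trans hA.lt
  have hE : potential (-ν ^ 2) p μ x₁ ≤ potential (-ν ^ 2) p μ x₂ :=
    (hA.below x₂ ⟨hA.lt.le, le_rfl⟩ x₁ (by rw [abs_of_pos hA.pos]; exact hA.lt)).le
  -- With `|u| < x₂` and norm above `R` (a maximum norm) one gets `u'^2 > R`, so the energy exceeds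
  -- `F(x₂)`, since `F(u) ≥ -(ν x₂)² / 2`.
  set R := 1 + x₂ + (2 * potential (-ν ^ 2) p μ x₂ + (ν * x₂) ^ 2) with hR
  have hE2 : 0 < potential (-ν ^ 2) p μ x₂ := hA.energy_pos.trans_le hE
  obtain ⟨s, hsR, hs0⟩ := ((hZt.eventually_gt_atTop R).and (eventually_ge_atTop 0)).exists
  have hsub : uIcc 0 s ⊆ Ici 0 := by
    rw [uIcc_of_le hs0]; exact Icc_subset_Ici_self
  have hZs := hZc.mono hsub
  have hfar : x₂ ≤ |(Z s).1| ∨ potential (-ν ^ 2) p μ x₂ ≤ energy (-ν ^ 2) p μ (Z s) := by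
    by_contra! hlt
    have h1 : R < |(Z s).2| := by
      have h2 : R < max ‖(Z s).1‖ ‖(Z s).2‖ := hsR
      rcases lt_max_iff.1 h2 with h3 | h3
      · rw [Real.norm_eq_abs] at h3
        nlinarith [sq_nonneg (ν * x₂)]
      · exact h3
    have hR1 : 1 ≤ R := by nlinarith [sq_nonneg (ν * x₂)]
    have h3 : R < (Z s).2 ^ 2 := by
      rw [← sq_abs]; nlinarith
    have h4 : (Z s).1 ^ 2 ≤ x₂ ^ 2 := by
      rw [← sq_abs]; exact pow_le_pow_left₀ (abs_nonneg _) hlt.1.le 2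
    have h5 : ν ^ 2 * (Z s).1 ^ 2 ≤ ν ^ 2 * x₂ ^ 2 := by gcongr
    have h6 : 0 ≤ μ / (p + 1) * |(Z s).1| ^ (p + 1) := by positivity
    have h7 := hlt.2
    rw [energy, potential] at h7
    nlinarith
  have hZ00 : energy (-ν ^ 2) p μ (Z 0) ≤ potential (-ν ^ 2) p μ x₁ := by
    rw [hZ0, energy, Prod.fst_zero, Prod.snd_zero, potential_zero hp]
    linarith [hA.energy_pos]
  obtain ⟨a', ha', b', hb', e1, e2, hm⟩ := exists_annular_crossing (a := 0) (b := s)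
    (e := fun t => energy (-ν ^ 2) p μ (Z t)) (X := fun t => |(Z t).1|)
    ((continuous_energy hp).comp_continuousOn hZs) hZs.fst.abs hE hZ00
    (by simpa [hZ0] using hx₂.le) hfar (fun t _ h => le_energy_of_abs_eq h)
  have hs' : uIcc a' b' ⊆ uIcc 0 s := uIcc_subset_uIcc ha' hb'
  exact ⟨Z, a', b', hZs.mono hs', e1, e2, fun t ht =>
    ⟨⟨hm t ht, hq ⟨t, hsub (hs' ht), rfl⟩⟩, ⟨t, hsub (hs' ht), rfl⟩⟩⟩

section Itineraries

variable {ν p μ x₁ x₂ κ₀ τ ς : ℝ} {β : ℕ}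

/-- The states `d i = (c, φ)` at the beginnings of the humps make up an orbit which visits the
quadrants `q i` and `r i` at the ends of the `i`-th hump, after the prescribed number of passages. -/
structure IsOrbit (ν p μ x₁ x₂ κ₀ τ ς : ℝ) (n : ℕ) (q r : ℕ → Quadrant) (lap : ℕ → ℕ)
    (d : ℕ → ℝ × ℝ) : Prop where
  amplitude : ∀ i ≤ n, (d i).1 ∈ Icc x₁ x₂
  start : ∀ i ≤ n, (d i).2 ∈ quarter (q i).index
  finish : ∀ i ≤ n, angle (-ν ^ 2) p μ κ₀ (d i).1 (d i).2 τ ∈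
    quarter ((q i).index + crossings (q i) (r i) (lap i))
  finish_mem : ∀ i < n, hump (-ν ^ 2) p μ κ₀ (d i).1 (d i).2 τ ∈ (r i).opened
  gap_eq : ∀ i < n, gap ν (hump (-ν ^ 2) p μ κ₀ (d i).1 (d i).2 τ) ς =
    point (-ν ^ 2) p μ κ₀ (d (i + 1)).1 (d (i + 1)).2
  next_mem : ∀ i < n, point (-ν ^ 2) p μ κ₀ (d (i + 1)).1 (d (i + 1)).2 ∈ (q (i + 1)).opened

theorem IsRing.amp_eq {lam : ℝ} (h : IsRing lam p μ x₁ x₂ κ₀) {c x φ : ℝ} (hc : c ∈ Icc x₁ x₂)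
    (hx : x ∈ Icc x₁ x₂)
    (he : energy lam p μ (point lam p μ κ₀ c φ) = potential lam p μ x) : c = x :=
  h.strictMonoOn_potential.injOn hc hx (by rw [← he, h.energy_point hc])

/-- The induction is over the humps still to come and quantifies over all paths across the annulus
in the quadrant `q 0`; the states already passed are recovered from the parameter `s`, because each
stretching only restricts the parameter interval. -/
theorem exists_orbit (h : IsRing (-ν ^ 2) p μ x₁ x₂ κ₀) (hT : IsLongGap ν p μ x₁ x₂ ς) (hτ : 0 < τ)
    (htwist : IsSlow (-ν ^ 2) p μ κ₀ τ x₁ ∧ IsFast (-ν ^ 2) p μ κ₀ τ (4 * β + 3) x₂ ∨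
      IsFast (-ν ^ 2) p μ κ₀ τ (4 * β + 3) x₁ ∧ IsSlow (-ν ^ 2) p μ κ₀ τ x₂)
    {Z : ℝ → ℝ × ℝ} {a₁ b₁ : ℝ} (hZ : ContinuousOn Z (uIcc a₁ b₁))
    (hZa : energy (-ν ^ 2) p μ (Z a₁) = potential (-ν ^ 2) p μ x₁)
    (hZb : energy (-ν ^ 2) p μ (Z b₁) = potential (-ν ^ 2) p μ x₂) (n : ℕ) :
    ∀ (q r : ℕ → Quadrant) (lap : ℕ → ℕ) (mid next : ℕ → Bool),
      (∀ t ∈ uIcc a₁ b₁, Z t ∈ annulus (-ν ^ 2) p μ x₁ x₂ ∩ (r n).closed) →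
      (∀ i < n, r i = midOf (mid i) ∧ q (i + 1) = nextOf (next i)) → (∀ i ≤ n, lap i < β) →
      ∀ (c φ : ℝ → ℝ) (a b : ℝ), ContinuousOn c (uIcc a b) → ContinuousOn φ (uIcc a b) →
        (∀ t ∈ uIcc a b, c t ∈ Icc x₁ x₂ ∧ φ t ∈ quarter (q 0).index) → c a = x₁ → c b = x₂ →
        ∃ s ∈ uIcc a b, ∃ d, IsOrbit ν p μ x₁ x₂ κ₀ τ ς n q r lap d ∧ d 0 = (c s, φ s) ∧
          ∃ t ∈ uIcc a₁ b₁, hump (-ν ^ 2) p μ κ₀ (d n).1 (d n).2 τ = Z t := by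
  have m1 : x₁ ∈ Icc x₁ x₂ := ⟨le_rfl, h.lt.le⟩
  have m2 : x₂ ∈ Icc x₁ x₂ := ⟨h.lt.le, le_rfl⟩
  induction n with
  | zero =>
    intro q r lap mid next hZm _ hlap c φ a b hc hφ hm ha hb
    obtain ⟨a', ha', b', hb', e1, e2, hθm⟩ := h.exists_hump_crossing hτ htwist hc hφ hm ha hb
      (two_le_crossings (q 0) (r 0) (lap 0)) (crossings_le _ _ (hlap 0 le_rfl))
    have hs := uIcc_subset_uIcc ha' hb'
    obtain ⟨c', φ', hc', hφ', hm'⟩ := h.exists_lift hZ hZm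
      (add_crossings_mod (q := q 0) (Quadrant.index_mod _) (lap 0))
    have hθ := h.continuousOn_angle (hc.mono hs) (fun t ht => (hm t (hs ht)).1) (hφ.mono hs) τ
    have ma := hm' a₁ left_mem_uIcc
    have mb := hm' b₁ right_mem_uIcc
    -- In the rectangle amplitude times quarter, the stretched path runs from bottom to top and the
    -- lifted right arc from side to side.
    obtain ⟨s, hs', t, ht, h1, h2⟩ := exists_common_point (hc.mono hs) hθ hc' hφ'
      (fun t ht => (hm t (hs ht)).1) (fun t ht => (hm' t ht).2.1) e1 e2
      (h.amp_eq ma.1 m1 (by rw [ma.2.2, hZa])) (h.amp_eq mb.1 m2 (by rw [mb.2.2, hZb]))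
    refine ⟨s, hs hs', fun _ => (c s, φ s), ⟨fun i _ => (hm s (hs hs')).1, fun i hi => ?_,
      fun i hi => ?_, fun i hi => absurd hi (Nat.not_lt_zero i),
      fun i hi => absurd hi (Nat.not_lt_zero i), fun i hi => absurd hi (Nat.not_lt_zero i)⟩,
      rfl, t, ht, ?_⟩
    · obtain rfl := Nat.le_zero.1 hi; exact (hm s (hs hs')).2
    · obtain rfl := Nat.le_zero.1 hi; exact hθm s hs'
    · rw [← (hm' t ht).2.2, ← h1, ← h2, hump]
  | succ n ih =>
    intro q r lap mid next hZm hqr hlap c φ a b hc hφ hm ha hb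
    obtain ⟨a', ha', b', hb', e1, e2, hθm⟩ := h.exists_hump_crossing hτ htwist hc hφ hm ha hb
      (two_le_crossings (q 0) (r 0) (lap 0)) (crossings_le _ _ (hlap 0 (Nat.zero_le _)))
    have hs := uIcc_subset_uIcc ha' hb'
    have hθ := h.continuousOn_angle (hc.mono hs) (fun t ht => (hm t (hs ht)).1) (hφ.mono hs) τ
    have hk := add_crossings_mod (q := q 0) (r := r 0) (Quadrant.index_mod _) (lap 0)
    have hr0 := (hqr 0 (Nat.succ_pos n)).1
    have hodd : (midOf (mid 0)).index = 1 ∨ (midOf (mid 0)).index = 3 := by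
      cases mid 0 <;> simp [midOf, Quadrant.index]
    have hz : ContinuousOn (fun t => hump (-ν ^ 2) p μ κ₀ (c t) (φ t) τ) (uIcc a' b') :=
      h.continuousOn_point.comp ((hc.mono hs).prodMk hθ) fun t ht =>
        ⟨(hm t (hs ht)).1, mem_univ _⟩
    -- Quadrants II and IV have odd index, so the quarter begins on the `x`-axis and ends on the
    -- `y`-axis, as `exists_gap_crossing` requires.
    have hza : (hump (-ν ^ 2) p μ κ₀ (c a') (φ a') τ).2 = 0 := by
      have h1 := sin_cos_quarter ((q 0).index + crossings (q 0) (r 0) (lap 0)) 0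
      rw [hk, hr0, add_zero, ← hr0, ← e1] at h1
      have h2 := congrArg Prod.snd h1
      have h3 : Real.cos (angle (-ν ^ 2) p μ κ₀ (c a') (φ a') τ) = 0 := by
        rw [hr0] at h2
        rcases hodd with h4 | h4 <;> rw [h4] at h2 <;> simpa using h2
      simp [hump, point, h3]
    have hzb : (hump (-ν ^ 2) p μ κ₀ (c b') (φ b') τ).1 = 0 := by
      have h1 := sin_cos_quarter ((q 0).index + crossings (q 0) (r 0) (lap 0)) (Real.pi / 2)
      have h5 : (((q 0).index + crossings (q 0) (r 0) (lap 0) : ℕ) : ℝ) * (Real.pi / 2) + Real.pi / 2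
        = angle (-ν ^ 2) p μ κ₀ (c b') (φ b') τ := by rw [e2]; ring
      rw [hk, h5] at h1
      have h2 := congrArg Prod.fst h1
      have h3 : Real.sin (angle (-ν ^ 2) p μ κ₀ (c b') (φ b') τ) = 0 := by
        rw [hr0] at h2
        rcases hodd with h4 | h4 <;> rw [h4] at h2 <;> simpa using h2
      simp [hump, point, h3]
    obtain ⟨a'', ha'', b'', hb'', f1, f2, hgm⟩ := exists_gap_crossing h.p_pos h.μ_pos h.isAnnulus hT
      hz (mid 0) (next 0) (fun t ht => ⟨h.point_mem_annulus (hm t (hs ht)).1 _, by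
        rw [← hr0]; exact h.point_mem_closed (hm t (hs ht)).1 hk (hθm t ht)⟩) hza hzb
    have hs' := uIcc_subset_uIcc ha'' hb''
    have hq1 := (hqr 0 (Nat.succ_pos n)).2
    obtain ⟨c', φ', hc', hφ', hm'⟩ := h.exists_lift (q := q 1) (k := (q 1).index)
      ((continuous_gap ν ς).comp_continuousOn (hz.mono hs'))
      (fun t ht => ⟨(hgm t ht).2.1, by
        rw [zero_add] at hq1; rw [hq1]; exact Quadrant.opened_subset_closed _ (hgm t ht).2.2⟩)
      (Quadrant.index_mod _)
    have ma := hm' a'' left_mem_uIcc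
    have mb := hm' b'' right_mem_uIcc
    -- The image of the path after the gap crosses the annulus again and serves as the initial path
    -- for the remaining humps.
    obtain ⟨s, hsm, d, hd, hd0, t, ht, hdt⟩ := ih (fun i => q (i + 1)) (fun i => r (i + 1))
      (fun i => lap (i + 1)) (fun i => mid (i + 1)) (fun i => next (i + 1)) hZm
      (fun i hi => hqr (i + 1) (Nat.succ_lt_succ hi)) (fun i hi => hlap (i + 1) (Nat.succ_le_succ hi))
      c' φ' a'' b'' hc' hφ' (fun t ht => ⟨(hm' t ht).1, (hm' t ht).2.1⟩)
      (h.amp_eq ma.1 m1 (by rw [ma.2.2]; exact f1)) (h.amp_eq mb.1 m2 (by rw [mb.2.2]; exact f2))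
    have hsm' := hs (hs' hsm)
    have hpt : gap ν (hump (-ν ^ 2) p μ κ₀ (c s) (φ s) τ) ς =
        point (-ν ^ 2) p μ κ₀ (d 0).1 (d 0).2 := by
      rw [hd0]; exact ((hm' s hsm).2.2).symm
    let d' : ℕ → ℝ × ℝ := fun i => Nat.casesOn i (c s, φ s) d
    refine ⟨s, hsm', d', ⟨fun i hi => ?_, fun i hi => ?_, fun i hi => ?_, fun i hi => ?_,
      fun i hi => ?_, fun i hi => ?_⟩, rfl, t, ht, hdt⟩
    · cases i with
      | zero => exact (hm s hsm').1
      | succ i => exact hd.amplitude i (by omega)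
    · cases i with
      | zero => exact (hm s hsm').2
      | succ i => exact hd.start i (by omega)
    · cases i with
      | zero => exact hθm s (hs' hsm)
      | succ i => exact hd.finish i (by omega)
    · cases i with
      | zero => rw [hr0]; exact (hgm s hsm).1
      | succ i => exact hd.finish_mem i (by omega)
    · cases i with
      | zero => exact hpt
      | succ i => exact hd.gap_eq i (by omega)
    · cases i with
      | zero =>
        change point (-ν ^ 2) p μ κ₀ (d 0).1 (d 0).2 ∈ _
        rw [← hpt, hq1]
        exact (hgm s hsm).2.2
      | succ i => exact hd.next_mem i (by omega)

end Itineraries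

/-! ### From orbits to solutions -/

section Solutions

variable {ν p μ x₁ x₂ κ₀ τ ς : ℝ} {β m : ℕ}

/-- A trajectory which follows an orbit. -/
theorem IsOrbit.exists_trajectory (h : IsRing (-ν ^ 2) p μ x₁ x₂ κ₀) (hν : ν ≠ 0) (hτ : 0 < τ)
    (hς : 0 < ς) {q r : ℕ → Quadrant} {lap : ℕ → ℕ} {d : ℕ → ℝ × ℝ}
    (hd : IsOrbit ν p μ x₁ x₂ κ₀ τ ς m q r lap d) :
    ∃ z, IsTrajectory (-ν ^ 2) p (weight μ τ ς m) 0 (len τ ς m) z ∧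
      (∀ i ≤ m, ∀ t ∈ Icc (humpStart τ ς i) (humpEnd τ ς i),
        z t = hump (-ν ^ 2) p μ κ₀ (d i).1 (d i).2 (t - humpStart τ ς i)) ∧
      ∀ i < m, ∀ t ∈ Icc (humpEnd τ ς i) (humpStart τ ς (i + 1)),
        z t = gap ν (hump (-ν ^ 2) p μ κ₀ (d i).1 (d i).2 τ) (t - humpEnd τ ς i) := by
  refine MooreNehari.exists_trajectory (m := m) (n := m) h.p_pos hτ hς
    (H := fun i t => hump (-ν ^ 2) p μ κ₀ (d i).1 (d i).2 (t - humpStart τ ς i))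
    (G := fun i t => gap ν (hump (-ν ^ 2) p μ κ₀ (d i).1 (d i).2 τ) (t - humpEnd τ ς i))
    (fun i hi => (h.isFlow_hump (hd.amplitude i hi) _).comp_sub _)
    (fun i _ => (isFlow_gap hν p _).comp_sub _) (fun i _ => ?_) (fun i hi => ?_) le_rfl
  · simp only [sub_self, gap_zero]
    congr 1
    simp [humpEnd]
  · have h1 : humpStart τ ς (i + 1) - humpEnd τ ς i = ς := by rw [humpStart_succ]; ring
    simp only [h1, sub_self, hump, angle, h.isSpeed.turn_zero]
    exact hd.gap_eq i hi

theorem hump_zero (h : IsRing (-ν ^ 2) p μ x₁ x₂ κ₀) (c φ : ℝ) :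
    hump (-ν ^ 2) p μ κ₀ c φ 0 = point (-ν ^ 2) p μ κ₀ c φ := by
  rw [hump, angle, h.isSpeed.turn_zero]

theorem len_pos (hτ : 0 < τ) (hς : 0 < ς) (m : ℕ) : 0 < len τ ς m := by
  have := humpStart_nonneg hτ hς m
  simp only [len, humpEnd]; linarith

theorem hump_subset (hτ : 0 < τ) (hς : 0 < ς) {i : ℕ} (hi : i ≤ m) :
    Icc (humpStart τ ς i) (humpEnd τ ς i) ⊆ Icc 0 (len τ ς m) :=
  Icc_subset_Icc (humpStart_nonneg hτ hς i) (humpEnd_mono hτ hς hi)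

theorem gap_subset (hτ : 0 < τ) (hς : 0 < ς) {i : ℕ} (hi : i < m) :
    Icc (humpEnd τ ς i) (humpStart τ ς (i + 1)) ⊆ Icc 0 (len τ ς m) := by
  refine Icc_subset_Icc ?_ ?_
  · have := humpStart_nonneg hτ hς i
    simp only [humpEnd]; linarith
  · have := humpStart_mono hτ hς (Nat.succ_le_of_lt hi)
    simp only [len, humpEnd]
    simp only [Nat.succ_eq_add_one] at this
    linarith

theorem exists_solution (h : IsRing (-ν ^ 2) p μ x₁ x₂ κ₀) (hT : IsLongGap ν p μ x₁ x₂ ς)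
    (hτ : 0 < τ) (hς : 0 < ς)
    (htwist : IsSlow (-ν ^ 2) p μ κ₀ τ x₁ ∧ IsFast (-ν ^ 2) p μ κ₀ τ (4 * β + 3) x₂ ∨
      IsFast (-ν ^ 2) p μ κ₀ τ (4 * β + 3) x₁ ∧ IsSlow (-ν ^ 2) p μ κ₀ τ x₂)
    {q₀ q₁ : Quadrant} {r₀ r₁ : Set (ℝ × ℝ)} (hr₀ : IsUnboundedArc r₀) (hq₀ : r₀ ⊆ q₀.closed)
    (hr₁ : IsUnboundedArc r₁) (hq₁ : r₁ ⊆ q₁.closed) (J : Itinerary m β) :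
    ∃ u, SolvesProblem (-ν ^ 2) p (weight μ τ ς m) (len τ ς m) r₀ r₁ u ∧
      Follows τ ς (annulus (-ν ^ 2) p μ x₁ x₂) q₀ q₁ J u := by
  have hp := h.p_pos
  have hμ := h.μ_pos
  have m1 : x₁ ∈ Icc x₁ x₂ := ⟨le_rfl, h.lt.le⟩
  have m2 : x₂ ∈ Icc x₁ x₂ := ⟨h.lt.le, le_rfl⟩
  obtain ⟨Z₀, a, b, hZ₀, ea, eb, hm₀⟩ := hr₀.exists_crossing hp hμ h.isAnnulus hq₀
  obtain ⟨Z₁, a₁, b₁, hZ₁, ea₁, eb₁, hm₁⟩ := hr₁.exists_crossing hp hμ h.isAnnulus hq₁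
  obtain ⟨c, φ, hc, hφ, hm⟩ := h.exists_lift hZ₀ (fun t ht => (hm₀ t ht).1) q₀.index_mod
  have ma := hm a left_mem_uIcc
  have mb := hm b right_mem_uIcc
  -- The itinerary is extended to all of `ℕ` by irrelevant default values, so that the induction can
  -- shift indices.
  let q : ℕ → Quadrant := fun i => if hi : i < m + 1 then J.source q₀ ⟨i, hi⟩ else .I
  let r : ℕ → Quadrant := fun i => if hi : i < m + 1 then J.target q₁ ⟨i, hi⟩ else .I
  let lap : ℕ → ℕ := fun i => if hi : i < m + 1 then J.lap ⟨i, hi⟩ else 0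
  let mid : ℕ → Bool := fun i => if hi : i < m then J.mid ⟨i, hi⟩ else true
  let next : ℕ → Bool := fun i => if hi : i < m then J.next ⟨i, hi⟩ else true
  have hq : ∀ i : Fin (m + 1), q i = J.source q₀ i := fun i => dif_pos i.2
  have hr : ∀ i : Fin (m + 1), r i = J.target q₁ i := fun i => dif_pos i.2
  have hlap : ∀ i : Fin (m + 1), lap i = J.lap i := fun i => dif_pos i.2
  have hr' : ∀ i : Fin m, r i = J.midQuadrant i := fun i => by
    have := hr i.castSucc
    rwa [Itinerary.target, Fin.snoc_castSucc] at this
  have hq' : ∀ i : Fin m, q (i + 1) = J.nextQuadrant i := fun i => by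
    have := hq i.succ
    rwa [Itinerary.source, Fin.cons_succ] at this
  have hrm : r m = q₁ := by
    have := hr (Fin.last m)
    rwa [Itinerary.target, Fin.snoc_last] at this
  have hq0 : q 0 = q₀ := by
    have := hq 0
    rwa [Itinerary.source, Fin.cons_zero] at this
  have hmid : ∀ i : Fin m, J.midQuadrant i = midOf (J.mid i) := fun i => rfl
  have hnext : ∀ i : Fin m, J.nextQuadrant i = nextOf (J.next i) := fun i => rfl
  obtain ⟨s, hs, d, hd, hd0, t, ht, hdt⟩ := exists_orbit h hT hτ htwist hZ₁ ea₁ eb₁ m q r lap mid next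
    (fun t ht => by rw [hrm]; exact (hm₁ t ht).1)
    (fun i hi => by
      have e1 : mid i = J.mid ⟨i, hi⟩ := dif_pos hi
      have e2 : next i = J.next ⟨i, hi⟩ := dif_pos hi
      rw [e1, e2]
      exact ⟨hr' ⟨i, hi⟩, hq' ⟨i, hi⟩⟩)
    (fun i hi => by
      have := hlap ⟨i, Nat.lt_succ_of_le hi⟩
      simp only at this
      rw [this]
      exact Fin.is_lt _)
    c φ a b hc hφ (fun t ht => ⟨(hm t ht).1, by rw [hq0]; exact (hm t ht).2.1⟩)
    (h.amp_eq ma.1 m1 (by rw [ma.2.2, ea])) (h.amp_eq mb.1 m2 (by rw [mb.2.2, eb]))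
  obtain ⟨z, hz, hzH, hzG⟩ := hd.exists_trajectory h hT.pos.ne' hτ hς
  have hL := len_pos hτ hς m
  have hle : ∀ i : Fin (m + 1), (i : ℕ) ≤ m := fun i => Nat.lt_succ_iff.1 i.2
  have hse : ∀ i, humpStart τ ς i ≤ humpEnd τ ς i := fun i => by simp only [humpEnd]; linarith
  have hstart : ∀ i ≤ m, phase (len τ ς m) (fun t => (z t).1) (humpStart τ ς i) =
      point (-ν ^ 2) p μ κ₀ (d i).1 (d i).2 := fun i hi => by
    have h1 : humpStart τ ς i ∈ Icc (humpStart τ ς i) (humpEnd τ ς i) := ⟨le_rfl, hse i⟩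
    rw [hz.phase_eq hL (hump_subset hτ hς hi h1), hzH i hi _ h1, sub_self, hump_zero h]
  have hend : ∀ i ≤ m, phase (len τ ς m) (fun t => (z t).1) (humpEnd τ ς i) =
      hump (-ν ^ 2) p μ κ₀ (d i).1 (d i).2 τ := fun i hi => by
    have h1 : humpEnd τ ς i ∈ Icc (humpStart τ ς i) (humpEnd τ ς i) := ⟨hse i, le_rfl⟩
    have h2 : humpEnd τ ς i - humpStart τ ς i = τ := by simp [humpEnd]
    rw [hz.phase_eq hL (hump_subset hτ hς hi h1), hzH i hi _ h1, h2]
  have hgapT : ∀ i < m, gap ν (hump (-ν ^ 2) p μ κ₀ (d i).1 (d i).2 τ) ς ∈ (q (i + 1)).opened :=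
    fun i hi => by rw [hd.gap_eq i hi]; exact hd.next_mem i hi
  have hslope : ∀ t ∈ Icc 0 (len τ ς m), slope (len τ ς m) (fun t => (z t).1) t = (z t).2 :=
    fun t ht => hz.slope_eq hL ht
  have hnod : ∀ i : Fin m, _ := fun i => gap_nodal (s := humpEnd τ ς i) hT.pos hς
    (z := hump (-ν ^ 2) p μ κ₀ (d i).1 (d i).2 τ) (b := J.mid i) (n := J.next i)
    (by rw [← hmid, ← hr']; exact hd.finish_mem i i.2)
    (by rw [← hnext, ← hq']; exact hgapT i i.2)
  refine ⟨fun t => (z t).1, ⟨hz.solvesEquation hL, ?_, ?_⟩, ⟨fun i => ?_, fun i => ?_, fun i => ?_,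
    fun i => ?_, fun i => ?_, fun i => ?_, fun i => ?_, fun i => ?_⟩⟩
  · have := hstart 0 (Nat.zero_le m)
    rw [humpStart_zero] at this
    rw [this, hd0, (hm s hs).2.2]
    exact (hm₀ s hs).2
  · change phase (len τ ς m) (fun t => (z t).1) (humpEnd τ ς m) ∈ r₁
    rw [hend m le_rfl, hdt]
    exact (hm₁ t ht).2
  · rw [hstart i (hle i), ← hq]
    exact ⟨h.point_mem_annulus (hd.amplitude i (hle i)) _,
      h.point_mem_closed (hd.amplitude i (hle i)) (Quadrant.index_mod _) (hd.start i (hle i))⟩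
  · rw [hend i (hle i), ← hr]
    exact ⟨h.point_mem_annulus (hd.amplitude i (hle i)) _,
      h.point_mem_closed (hd.amplitude i (hle i))
        (add_crossings_mod (Quadrant.index_mod _) _) (hd.finish i (hle i))⟩
  · rw [hend i i.2.le, ← hr']
    exact hd.finish_mem i i.2
  · rw [hstart (i + 1) i.2, ← hq']
    exact hd.next_mem i i.2
  · rw [← hq, ← hr, ← hlap]
    exact h.hump_zeros (hd.amplitude i (hle i)) hτ (Quadrant.index_mod _) (hd.start i (hle i))
      (hd.finish i (hle i)) fun t ht => congrArg Prod.fst (hzH i (hle i) t ht)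
  · rw [← hq, ← hr, ← hlap]
    exact h.hump_critical (hd.amplitude i (hle i)) hτ (Quadrant.index_mod _) (hd.start i (hle i))
      (hd.finish i (hle i)) fun t ht =>
        (hslope t (hump_subset hτ hς (hle i) ht)).trans (congrArg Prod.snd (hzH i (hle i) t ht))
  · rw [← (hnod i).1, ← humpStart_succ]
    congr 1
    refine sep_ext_iff.2 fun t ht => ?_
    rw [hzG i i.2 t (Ioo_subset_Icc_self ht)]
  · rw [← (hnod i).2, ← humpStart_succ]
    congr 1
    refine sep_ext_iff.2 fun t ht => ?_
    rw [hslope t (gap_subset hτ hς i.2 (Ioo_subset_Icc_self ht)),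
      hzG i i.2 t (Ioo_subset_Icc_self ht)]

/-! ### Distinctness and number of the solutions. -/

theorem slope_congr {L : ℝ} {u v : ℝ → ℝ} (huv : EqOn u v (Icc 0 L)) {t : ℝ} (ht : t ∈ Icc 0 L) :
    slope L u t = slope L v t :=
  derivWithin_congr huv (huv ht)

theorem zerosIn_congr {f g : ℝ → ℝ} {c d : ℝ} (hfg : EqOn f g (Icc c d)) (P Q : Prop) :
    zerosIn f c d P Q = zerosIn g c d P Q := by
  ext t
  simp only [zerosIn, mem_ofPred_eq]
  exact and_congr_right fun ht => by rw [hfg ht]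

theorem midOf_injective {b b' : Bool} {z : ℝ × ℝ} (h : z ∈ (midOf b).opened)
    (h' : z ∈ (midOf b').opened) : b = b' := by
  cases b <;> cases b' <;> simp only [midOf, Bool.false_eq_true, if_false, if_true, reduceCtorEq]
    at h h' ⊢
  · exact absurd h.1 (not_lt.2 h'.1.le)
  · exact absurd h.1 (not_lt.2 h'.1.le)

theorem nextOf_injective {b b' : Bool} {z : ℝ × ℝ} (h : z ∈ (nextOf b).opened)
    (h' : z ∈ (nextOf b').opened) : b = b' := by
  cases b <;> cases b' <;> simp only [nextOf, Bool.false_eq_true, if_false, if_true, reduceCtorEq]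
    at h h' ⊢
  · exact absurd h.1 (not_lt.2 h'.1.le)
  · exact absurd h.1 (not_lt.2 h'.1.le)

/-- A solution determines the itinerary which it follows. -/
theorem Follows.unique (hτ : 0 < τ) (hς : 0 < ς) {A : Set (ℝ × ℝ)} {q₀ q₁ : Quadrant}
    {J J' : Itinerary m β} {u u' : ℝ → ℝ} (h : Follows τ ς A q₀ q₁ J u)
    (h' : Follows τ ς A q₀ q₁ J' u') (he : EqOn u u' (Icc 0 (len τ ς m))) : J = J' := by
  have hph : ∀ t ∈ Icc 0 (len τ ς m), phase (len τ ς m) u t = phase (len τ ς m) u' t :=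
    fun t ht => Prod.ext (he ht) (slope_congr he ht)
  have hse : ∀ i, humpStart τ ς i ≤ humpEnd τ ς i := fun i => by simp only [humpEnd]; linarith
  have hmid : J.mid = J'.mid := funext fun i => by
    have h1 := h.mid_mem i
    rw [hph _ (hump_subset hτ hς i.2.le ⟨hse i, le_rfl⟩)] at h1
    exact midOf_injective h1 (h'.mid_mem i)
  have hnext : J.next = J'.next := funext fun i => by
    have h1 := h.next_mem i
    rw [hph _ (hump_subset hτ hς (i := i + 1) i.2 ⟨le_rfl, hse _⟩)] at h1
    exact nextOf_injective h1 (h'.next_mem i)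
  have hsrc : J.source q₀ = J'.source q₀ := by
    unfold Itinerary.source Itinerary.nextQuadrant; rw [hnext]
  have htgt : J.target q₁ = J'.target q₁ := by
    unfold Itinerary.target Itinerary.midQuadrant; rw [hmid]
  have hlap : J.lap = J'.lap := funext fun i => by
    have h1 := h.hump_zeros i
    rw [zerosIn_congr (he.mono (hump_subset hτ hς (Nat.lt_succ_iff.1 i.2))), hsrc, htgt,
      h'.hump_zeros i] at h1
    exact Fin.ext (crossingsY_injective _ _ (by exact_mod_cast h1)).symm
  cases J
  cases J'
  simp only at hmid hnext hlap
  subst hmid hnext hlap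
  rfl

/-- Itineraries as triples of functions. -/
def itineraryEquiv (m β : ℕ) :
    Itinerary m β ≃ (Fin (m + 1) → Fin β) × (Fin m → Bool) × (Fin m → Bool) where
  toFun J := (J.lap, J.mid, J.next)
  invFun f := ⟨f.1, f.2.1, f.2.2⟩
  left_inv _ := rfl
  right_inv _ := rfl

theorem card_itinerary (m β : ℕ) : ENat.card (Itinerary m β) = (4 ^ m * β ^ (m + 1) : ℕ) := by
  rw [ENat.card_congr (itineraryEquiv m β), ENat.card_eq_coe_fintype_card]
  congr 1
  simp only [Fintype.card_prod, Fintype.card_fun, Fintype.card_fin, Fintype.card_bool]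
  rw [show 4 = 2 * 2 from rfl, mul_pow]
  ring

theorem exists_solutions (h : IsRing (-ν ^ 2) p μ x₁ x₂ κ₀) (hT : IsLongGap ν p μ x₁ x₂ ς)
    (hτ : 0 < τ) (hς : 0 < ς)
    (htwist : IsSlow (-ν ^ 2) p μ κ₀ τ x₁ ∧ IsFast (-ν ^ 2) p μ κ₀ τ (4 * β + 3) x₂ ∨
      IsFast (-ν ^ 2) p μ κ₀ τ (4 * β + 3) x₁ ∧ IsSlow (-ν ^ 2) p μ κ₀ τ x₂)
    {q₀ q₁ : Quadrant} {r₀ r₁ : Set (ℝ × ℝ)} (hr₀ : IsUnboundedArc r₀) (hq₀ : r₀ ⊆ q₀.closed)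
    (hr₁ : IsUnboundedArc r₁) (hq₁ : r₁ ⊆ q₁.closed) (m : ℕ) :
    ((4 ^ m * β ^ (m + 1) : ℕ) : ℕ∞) ≤
        (nontrivialSolutions (-ν ^ 2) p (weight μ τ ς m) (len τ ς m) r₀ r₁).encard ∧
      ∃ U : Itinerary m β → ℝ → ℝ,
        (∀ J, SolvesProblem (-ν ^ 2) p (weight μ τ ς m) (len τ ς m) r₀ r₁ (U J) ∧
          Follows τ ς (annulus (-ν ^ 2) p μ x₁ x₂) q₀ q₁ J (U J)) ∧
        ∀ J J', EqOn (U J) (U J') (Icc 0 (len τ ς m)) → J = J' := by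
  choose U hU using fun J : Itinerary m β => exists_solution h hT hτ hς htwist hr₀ hq₀ hr₁ hq₁ J
  have hinj : ∀ J J', EqOn (U J) (U J') (Icc 0 (len τ ς m)) → J = J' := fun J J' he =>
    (hU J).2.unique hτ hς (hU J').2 he
  refine ⟨?_, U, hU, hinj⟩
  have hL := len_pos hτ hς m
  have hinj' : Function.Injective fun J => (Icc 0 (len τ ς m)).domRestrict (U J) :=
    fun J J' he => hinj J J' fun t ht => congrFun he ⟨t, ht⟩
  rw [← card_itinerary, ← encard_univ, ← hinj'.encard_image]
  refine encard_le_encard ?_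
  rintro _ ⟨J, -, rfl⟩
  refine ⟨⟨U J, (hU J).1, rfl⟩, fun h0 => ?_⟩
  have hz : EqOn (U J) (fun _ => 0) (Icc 0 (len τ ς m)) := fun t ht => congrFun h0 ⟨t, ht⟩
  -- The zero solution is excluded, since the origin has energy `0 < F(x₁)` and so is not in the
  -- annulus.
  have h1 := ((hU J).2.mem_start 0).1
  rw [Fin.val_zero, humpStart_zero] at h1
  have m0 : (0 : ℝ) ∈ Icc 0 (len τ ς m) := ⟨le_rfl, hL.le⟩
  have h2 : phase (len τ ς m) (U J) 0 = (0, 0) := by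
    refine Prod.ext (hz m0) ((slope_congr hz m0).trans ?_)
    simp [slope]
  rw [h2] at h1
  have h3 := h1.2.1
  simp only [energy, potential_zero h.p_pos] at h3
  linarith [h.isAnnulus.energy_pos]

end Solutions

/-! ### Slow and fast orbits -/

/-- A speed of at most `A + B φ` costs a time that grows like `log (1/A)`; this delays orbits near a
saddle connection. -/
theorem log_le_integral {g : ℝ → ℝ} (hg : Continuous g) {A B h : ℝ} (hA : 0 < A) (hB : 0 < B)
    (hh : 0 ≤ h) (hle : ∀ φ ∈ Icc 0 h, (A + B * φ)⁻¹ ≤ g φ) :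
    Real.log ((A + B * h) / A) / B ≤ ∫ φ in (0 : ℝ)..h, g φ := by
  have hpos : ∀ φ ∈ Icc 0 h, A + B * φ ≠ 0 := fun φ hφ => by
    have := mul_nonneg hB.le hφ.1
    linarith
  have hd : ∀ φ ∈ uIcc 0 h, HasDerivAt (fun φ => Real.log (A + B * φ) / B) (A + B * φ)⁻¹ φ := by
    intro φ hφ
    rw [uIcc_of_le hh] at hφ
    refine (((((hasDerivAt_id φ).const_mul B).const_add A).log (hpos φ hφ)).div_const B).congr_deriv
      ?_
    simp only [id]; field_simp
  have hi : IntervalIntegrable (fun φ => (A + B * φ)⁻¹) volume 0 h :=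
    ContinuousOn.intervalIntegrable_of_Icc hh
      (ContinuousOn.inv₀ (by fun_prop) hpos)
  have h1 := intervalIntegral.integral_eq_sub_of_hasDerivAt hd hi
  rw [Real.log_div (hpos h ⟨hh, le_rfl⟩) hA.ne', sub_div]
  calc _ = ∫ φ in (0 : ℝ)..h, (A + B * φ)⁻¹ := by rw [h1]; simp
    _ ≤ _ := intervalIntegral.integral_mono_on hh hi (hg.intervalIntegrable _ _) hle

/-- The greatest lower bound of `shape`. -/
def shapeMin (p : ℝ) : ℝ := min 1 (2 / (p + 1))

theorem shapeMin_pos {p : ℝ} (hp : 0 < p) : 0 < shapeMin p := by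
  unfold shapeMin; positivity

theorem shapeMin_le {p : ℝ} (hp : 0 < p) (φ : ℝ) : shapeMin p ≤ shape p φ := by
  rcases le_total p 1 with h | h
  · exact (min_le_left _ _).trans (one_le_shape hp h φ)
  · exact (min_le_right _ _).trans (two_div_le_shape h φ)

theorem sqrt_add_sq_le {a b : ℝ} (ha : 0 ≤ a) (hb : 0 ≤ b) : √(a ^ 2 + b ^ 2) ≤ a + b := by
  rw [Real.sqrt_le_left (by positivity)]
  nlinarith [mul_nonneg ha hb]

/-- As `κ` decreases to `ν² / shapeMin p`, the least speed tends to `0`. The limit orbits pass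
through a saddle: the origin if `p > 1`, the equilibria with `u ≠ 0` if `p < 1`. -/
theorem exists_slow {ν p τ : ℝ} (hν : 0 < ν) (hp : 0 < p) : ∃ κ, 0 < κ ∧
    (∃ m > 0, ∀ φ, m ≤ κ * shape p φ + -ν ^ 2) ∧
      τ < clock (speed (-ν ^ 2) p κ) κ (Real.pi / 2) := by
  have hσ := shapeMin_pos hp
  have hσ1 : shapeMin p ≤ 1 := min_le_left _ _
  have hpi := Real.pi_pos
  set σ := shapeMin p
  -- At the distance `x` from the minimum, the squared speed is at most `A² + 4 κ x²`. Since `A ≤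
  -- 1`, this `B` satisfies `4 κ ≤ B²` and does not depend on `A`, so `A` can then be chosen small
  -- in terms of `B` and `τ`.
  set B := 2 * √(ν ^ 2 / σ + 1) with hB
  have hB0 : 0 < B := by positivity
  set A := min 1 (B * (Real.pi / 2) / Real.exp (B * τ)) with hA
  have hA0 : 0 < A := by positivity
  have hA1 : A ≤ 1 := min_le_left _ _
  set κ := ν ^ 2 / σ + A ^ 2 with hκ
  have hκ0 : 0 < κ := by positivity
  have hκσ : κ * σ - ν ^ 2 = A ^ 2 * σ := by rw [hκ]; field_simp; ring
  have hκB : 4 * κ ≤ B ^ 2 := by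
    rw [hB, mul_pow, Real.sq_sqrt (by positivity), hκ]
    nlinarith
  have hsq : ∀ φ, A ^ 2 * σ ≤ κ * shape p φ + -ν ^ 2 := fun φ => by
    have := mul_le_mul_of_nonneg_left (shapeMin_le hp φ) hκ0.le
    linarith
  have hspeed : ∀ φ x, 0 ≤ x → shape p φ ≤ σ + 4 * x ^ 2 → speed (-ν ^ 2) p κ κ φ ≤ A + B * x := by
    intro φ x hx hs
    refine le_trans (Real.sqrt_le_sqrt ?_) (sqrt_add_sq_le hA0.le (by positivity))
    rw [max_self]
    have h1 := mul_le_mul_of_nonneg_left hs hκ0.le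
    have h2 : 4 * κ * x ^ 2 ≤ B ^ 2 * x ^ 2 := by gcongr
    have h3 : A ^ 2 * σ ≤ A ^ 2 := mul_le_of_le_one_right (by positivity) hσ1
    nlinarith
  have hpos : ∀ φ, 0 < speed (-ν ^ 2) p κ κ φ := fun φ =>
    Real.sqrt_pos.2 (by rw [max_self]; exact lt_of_lt_of_le (by positivity) (hsq φ))
  have hcont : Continuous fun φ => (speed (-ν ^ 2) p κ κ φ)⁻¹ :=
    Continuous.inv₀ (((continuous_shape hp).const_mul _).add continuous_const).sqrt
      fun φ => (hpos φ).ne'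
  have hτ : τ < Real.log ((A + B * (Real.pi / 2)) / A) / B := by
    rw [lt_div_iff₀ hB0, Real.lt_log_iff_exp_lt (by positivity), lt_div_iff₀ hA0, mul_comm τ]
    have h1 : A ≤ B * (Real.pi / 2) / Real.exp (B * τ) := min_le_right _ _
    rw [le_div_iff₀ (Real.exp_pos _)] at h1
    linarith
  refine ⟨κ, hκ0, ⟨A ^ 2 * σ, by positivity, hsq⟩, hτ.trans_le ?_⟩
  rw [clock]
  rcases le_total p 1 with h1 | h1
  · have hσe : σ = 1 := min_eq_left (by rw [one_le_div (by linarith)]; linarith)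
    -- For `p ≤ 1` the slowest angle is `π/2`, so the quarter is measured from its other end.
    have := intervalIntegral.integral_comp_sub_left (a := 0) (b := Real.pi / 2)
      (fun φ => (speed (-ν ^ 2) p κ κ φ)⁻¹) (Real.pi / 2)
    rw [sub_self, sub_zero] at this
    rw [← this]
    refine log_le_integral (hcont.comp (continuous_const.sub continuous_id)) hA0 hB0
      (by positivity) fun φ hφ => inv_anti₀ (hpos _) (hspeed _ _ hφ.1 ?_)
    have h2 := shape_le_one_add hp (Real.pi / 2 - φ)
    rw [Real.cos_pi_div_two_sub] at h2
    have h3 : Real.sin φ ^ 2 ≤ φ ^ 2 :=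
      pow_le_pow_left₀ (Real.sin_nonneg_of_nonneg_of_le_pi hφ.1 (by linarith [hφ.2]))
        (Real.sin_le hφ.1) 2
    have h4 : shape p (Real.pi / 2 - φ) ≤ 1 + 4 * φ ^ 2 := by nlinarith [sq_nonneg φ]
    rwa [hσe]
  · have hσe : σ = 2 / (p + 1) := min_eq_right (by rw [div_le_one (by linarith)]; linarith)
    refine log_le_integral hcont hA0 hB0 (by positivity)
      fun φ hφ => inv_anti₀ (hpos _) (hspeed _ _ hφ.1 ?_)
    have h2 := shape_le_of_one_le h1 φ
    have h3 : Real.sin φ ^ 2 ≤ φ ^ 2 :=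
      pow_le_pow_left₀ (Real.sin_nonneg_of_nonneg_of_le_pi hφ.1 (by linarith [hφ.2]))
        (Real.sin_le hφ.1) 2
    rw [hσe]
    linarith

theorem exists_fast (ν : ℝ) {p : ℝ} (hp : 0 < p) (κ₀ M : ℝ) :
    ∃ κ, κ₀ < κ ∧ ∀ φ, M ≤ speed (-ν ^ 2) p κ₀ κ φ := by
  have hσ := shapeMin_pos hp
  set κ := max (κ₀ + 1) ((ν ^ 2 + M ^ 2) / shapeMin p) with hκ
  have h0 : κ₀ < κ := (lt_add_one κ₀).trans_le (le_max_left _ _)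
  have h1 : ν ^ 2 + M ^ 2 ≤ κ * shapeMin p := by
    rw [← div_le_iff₀ hσ]; exact le_max_right _ _
  have hκ0 : 0 ≤ κ := by
    by_contra! h
    nlinarith [mul_pos_of_neg_of_neg (neg_lt_zero.2 hσ) h, sq_nonneg ν, sq_nonneg M]
  refine ⟨κ, h0, fun φ => ?_⟩
  rw [speed, max_eq_left h0.le]
  refine Real.le_sqrt_of_sq_le ?_
  have := mul_le_mul_of_nonneg_left (shapeMin_le hp φ) hκ0
  linarith

/-! ### The dependence on `μ` -/

/-- The amplitude `c` with `μ c ^ (p - 1) = κ`. -/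
def amplitude (p μ κ : ℝ) : ℝ := (κ / μ) ^ (p - 1)⁻¹

theorem amplitude_pos {p μ κ : ℝ} (hμ : 0 < μ) (hκ : 0 < κ) : 0 < amplitude p μ κ :=
  Real.rpow_pos_of_pos (div_pos hκ hμ) _

theorem param_amplitude {p μ κ : ℝ} (hp1 : p ≠ 1) (hμ : 0 < μ) (hκ : 0 < κ) :
    μ * amplitude p μ κ ^ (p - 1) = κ := by
  rw [amplitude, Real.rpow_inv_rpow (div_pos hκ hμ).le (sub_ne_zero.2 hp1)]
  field_simp

theorem amplitude_eq_mul {p μ κ₁ κ₂ : ℝ} (hμ : 0 < μ) (h₁ : 0 < κ₁) (h₂ : 0 < κ₂) :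
    amplitude p μ κ₂ = (κ₂ / κ₁) ^ (p - 1)⁻¹ * amplitude p μ κ₁ := by
  rw [amplitude, amplitude, ← Real.mul_rpow (div_pos h₂ h₁).le (div_pos h₁ hμ).le]
  congr 1
  field_simp

/-- Together with `amplitude_eq_mul` this makes every condition of `IsLongGap` homogeneous in the
amplitude, so that `μ` cancels. -/
theorem potential_amplitude {ν p μ κ : ℝ} (hp1 : p ≠ 1) (hμ : 0 < μ) (hκ : 0 < κ) :
    potential (-ν ^ 2) p μ (amplitude p μ κ) =
      amplitude p μ κ ^ 2 * (κ / (p + 1) - ν ^ 2 / 2) := by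
  have h1 := amplitude_pos (p := p) hμ hκ
  have h2 : amplitude p μ κ ^ (p + 1) = amplitude p μ κ ^ 2 * amplitude p μ κ ^ (p - 1) := by
    rw [← Real.rpow_natCast, ← Real.rpow_add h1]; congr 1; push_cast; ring
  rw [potential, abs_of_pos h1, h2]
  conv_rhs => rw [← param_amplitude hp1 hμ hκ]
  rw [param_amplitude hp1 hμ hκ]
  have h3 := param_amplitude hp1 hμ hκ
  linear_combination amplitude p μ κ ^ 2 / (p + 1) * h3

/-- Since `s ≤ sinh s < cosh s` for `s > 0`, both functions exceed `C` at `ν T`, and the three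
conditions become the two inequalities on `C`. -/
theorem isLongGap {ν p μ κ₁ κ₂ R C T : ℝ} (hν : 0 < ν) (hp1 : p ≠ 1) (hμ : 0 < μ) (h₁ : 0 < κ₁)
    (h₂ : 0 < κ₂) (hR : R = (κ₂ / κ₁) ^ (p - 1)⁻¹) (he₁ : 0 < κ₁ / (p + 1) - ν ^ 2 / 2)
    (he₂ : 0 < κ₂ / (p + 1) - ν ^ 2 / 2) (hRC : R ≤ C)
    (hC : (2 * (κ₂ / (p + 1) - ν ^ 2 / 2) + ν ^ 2) * R ^ 2 ≤
      2 * (κ₁ / (p + 1) - ν ^ 2 / 2) * C ^ 2) (hT : C / ν < T) :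
    IsLongGap ν p μ (amplitude p μ κ₁) (amplitude p μ κ₂) T := by
  have hR0 : 0 < R := by rw [hR]; exact Real.rpow_pos_of_pos (div_pos h₂ h₁) _
  have hC0 : 0 < C := hR0.trans_le hRC
  rw [div_lt_iff₀ hν, mul_comm] at hT
  have hsinh : C < Real.sinh (ν * T) := hT.trans_le (Real.self_le_sinh_iff.2 (hC0.trans hT).le)
  have hcosh : C < Real.cosh (ν * T) := hsinh.trans (Real.sinh_lt_cosh _)
  have hx := amplitude_pos (p := p) hμ h₁
  have hx2 := amplitude_eq_mul (p := p) hμ h₁ h₂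
  rw [← hR] at hx2
  set x := amplitude p μ κ₁
  have hs2 : C ^ 2 < Real.sinh (ν * T) ^ 2 := pow_lt_pow_left₀ hsinh hC0.le two_ne_zero
  have hc2 : C ^ 2 < Real.cosh (ν * T) ^ 2 := pow_lt_pow_left₀ hcosh hC0.le two_ne_zero
  have hx2' : 0 < x ^ 2 := by positivity
  refine ⟨hν, hC0.trans hsinh, ?_, ?_, ?_⟩
  · rw [hx2, mul_comm x]
    gcongr
    exact hRC.trans_lt hcosh
  · rw [potential_amplitude hp1 hμ h₁, hx2]
    have h1 : ν ^ 2 * R ^ 2 ≤ 2 * (κ₁ / (p + 1) - ν ^ 2 / 2) * C ^ 2 := by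
      refine le_trans ?_ hC
      gcongr
      linarith
    calc (ν * (R * x)) ^ 2 = x ^ 2 * (ν ^ 2 * R ^ 2) := by ring
      _ ≤ x ^ 2 * (2 * (κ₁ / (p + 1) - ν ^ 2 / 2) * C ^ 2) := by gcongr
      _ < x ^ 2 * (2 * (κ₁ / (p + 1) - ν ^ 2 / 2) * Real.sinh (ν * T) ^ 2) := by gcongr
      _ = _ := by ring
  · rw [potential_amplitude hp1 hμ h₁, potential_amplitude hp1 hμ h₂, hx2]
    calc 2 * ((R * x) ^ 2 * (κ₂ / (p + 1) - ν ^ 2 / 2)) + (ν * (R * x)) ^ 2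
        = x ^ 2 * ((2 * (κ₂ / (p + 1) - ν ^ 2 / 2) + ν ^ 2) * R ^ 2) := by ring
      _ ≤ x ^ 2 * (2 * (κ₁ / (p + 1) - ν ^ 2 / 2) * C ^ 2) := by gcongr
      _ < x ^ 2 * (2 * (κ₁ / (p + 1) - ν ^ 2 / 2) * Real.cosh (ν * T) ^ 2) := by gcongr
      _ = _ := by ring

/-- `c^(p-1)` is monotone, so the bound has to be checked only at one end of the interval, which
depends on whether `p ≤ 1`. -/
theorem le_param_of_mem {p μ κ₀ x₁ x₂ c : ℝ} (hμ : 0 < μ) (hx₁ : 0 < x₁)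
    (h₁ : κ₀ ≤ μ * x₁ ^ (p - 1)) (h₂ : κ₀ ≤ μ * x₂ ^ (p - 1)) (hc : c ∈ Icc x₁ x₂) :
    κ₀ ≤ μ * c ^ (p - 1) := by
  have hc0 := hx₁.trans_le hc.1
  rcases le_total p 1 with h | h
  · refine h₂.trans (mul_le_mul_of_nonneg_left ?_ hμ.le)
    exact Real.rpow_le_rpow_of_nonpos hc0 hc.2 (by linarith)
  · refine h₁.trans (mul_le_mul_of_nonneg_left ?_ hμ.le)
    exact Real.rpow_le_rpow hx₁.le hc.1 (by linarith)

/-- The parameters of the two boundary orbits of the annulus. -/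
theorem exists_params {ν p τ : ℝ} (hν : 0 < ν) (hp : 0 < p) (hp1 : p ≠ 1) (M : ℝ) :
    ∃ κ₀ κ₁ κ₂ : ℝ, 0 < κ₀ ∧ κ₀ ≤ κ₁ ∧ κ₀ ≤ κ₂ ∧ 1 < (κ₂ / κ₁) ^ (p - 1)⁻¹ ∧
      (∃ m > 0, ∀ φ, m ≤ κ₀ * shape p φ + -ν ^ 2) ∧
      (τ < clock (speed (-ν ^ 2) p κ₀) κ₁ (Real.pi / 2) ∧ (∀ φ, M ≤ speed (-ν ^ 2) p κ₀ κ₂ φ) ∨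
        (∀ φ, M ≤ speed (-ν ^ 2) p κ₀ κ₁ φ) ∧
          τ < clock (speed (-ν ^ 2) p κ₀) κ₂ (Real.pi / 2)) := by
  obtain ⟨κ, hκ, hsq, hslow⟩ := exists_slow (τ := τ) hν hp
  obtain ⟨κ', hκ', hfast⟩ := exists_fast ν hp κ M
  -- The amplitude decreases with `κ` if `p < 1` and increases if `p > 1`. Hence the slow orbit is
  -- the outer boundary in the first case and the inner one in the second.
  rcases hp1.lt_or_gt with h | h
  · exact ⟨κ, κ', κ, hκ, hκ'.le, le_rfl, Real.one_lt_rpow_of_pos_of_lt_one_of_neg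
      (div_pos hκ (hκ.trans hκ')) ((div_lt_one (hκ.trans hκ')).2 hκ')
      (inv_lt_zero.2 (by linarith)), hsq, .inr ⟨hfast, hslow⟩⟩
  · exact ⟨κ, κ, κ', hκ, le_rfl, hκ'.le, Real.one_lt_rpow ((one_lt_div hκ).2 hκ')
      (inv_pos.2 (by linarith)), hsq, .inl ⟨hslow, hfast⟩⟩

end MooreNehari

/-! ### Choice of the constants and conclusion. -/

theorem corollary7p3 (lam p τ : ℝ) (hlam : lam < 0) (hp : 0 < p) (hp1 : p ≠ 1) (hτ : 0 < τ)
    (β : ℕ) (hβ : 1 ≤ β) :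
    ∃ Λ : ℝ, 0 < Λ ∧ ∀ μ : ℝ, 0 < μ →
      ∃ x₁ x₂ : ℝ, MooreNehari.IsAnnulus lam p μ x₁ x₂ ∧
        ∀ (m : ℕ) (ς : ℝ), Λ < ς →
          ∀ (q₀ q₁ : MooreNehari.Quadrant) (r₀ r₁ : Set (ℝ × ℝ)),
            MooreNehari.IsUnboundedArc r₀ → r₀ ⊆ q₀.closed →
            MooreNehari.IsUnboundedArc r₁ → r₁ ⊆ q₁.closed →
              ((4 ^ m * β ^ (m + 1) : ℕ) : ℕ∞) ≤
                (MooreNehari.nontrivialSolutions lam p (MooreNehari.weight μ τ ς m)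
                  (MooreNehari.len τ ς m) r₀ r₁).encard ∧
              ∃ U : MooreNehari.Itinerary m β → ℝ → ℝ,
                (∀ J, MooreNehari.SolvesProblem lam p (MooreNehari.weight μ τ ς m)
                    (MooreNehari.len τ ς m) r₀ r₁ (U J) ∧
                  MooreNehari.Follows τ ς (MooreNehari.annulus lam p μ x₁ x₂) q₀ q₁ J (U J)) ∧
                ∀ J J', Set.EqOn (U J) (U J') (Set.Icc 0 (MooreNehari.len τ ς m)) → J = J' := by
  open MooreNehari in
  obtain ⟨ν, hν, rfl⟩ : ∃ ν : ℝ, 0 < ν ∧ lam = -ν ^ 2 :=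
    ⟨√(-lam), Real.sqrt_pos.2 (by linarith), by rw [Real.sq_sqrt (by linarith)]; ring⟩
  obtain ⟨κ₀, κ₁, κ₂, hκ₀, h₁, h₂, hR1, hsq, htwist⟩ := exists_params (τ := τ) hν hp hp1
    ((4 * β + 3 : ℕ) * (Real.pi / 2) / τ)
  have hκ₁ := hκ₀.trans_le h₁
  have hκ₂ := hκ₀.trans_le h₂
  -- Positive energy of the orbits: this is the positivity of the squared speed at `φ = 0`, where
  -- `shape` equals `2 / (p + 1)`.
  have he : ∀ κ, κ₀ ≤ κ → 0 < κ / (p + 1) - ν ^ 2 / 2 := by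
    obtain ⟨m, hm, hl⟩ := hsq
    intro κ hκ
    have h0 := hl 0
    have h1 := cos_sq_mul_shape hp 0
    have hp' : p + 1 ≠ 0 := by linarith
    simp only [Real.cos_zero, Real.sin_zero, abs_zero, Real.zero_rpow hp', one_pow, one_mul,
      sub_zero] at h1
    rw [h1] at h0
    have h2 : κ₀ / (p + 1) ≤ κ / (p + 1) := by gcongr
    have h3 : κ₀ * (2 * (1 / (p + 1))) = 2 * (κ₀ / (p + 1)) := by ring
    linarith
  have he₁ := he κ₁ h₁
  have he₂ := he κ₂ h₂
  set R := (κ₂ / κ₁) ^ (p - 1)⁻¹ with hR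
  -- `D` is the least value allowed for `C²` in `isLongGap`; `C = R + D` works because `R > 1` gives
  -- `D ≤ (R + D)²`, which avoids a square root.
  set D := (2 * (κ₂ / (p + 1) - ν ^ 2 / 2) + ν ^ 2) * R ^ 2 /
    (2 * (κ₁ / (p + 1) - ν ^ 2 / 2)) with hD
  have hD0 : 0 ≤ D := by positivity
  have hC : D ≤ (R + D) ^ 2 := by nlinarith
  refine ⟨(R + D) / ν, by positivity, fun μ hμ => ?_⟩
  have hx₁ := amplitude_pos (p := p) hμ hκ₁
  have hp₁ := param_amplitude hp1 hμ hκ₁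
  have hp₂ := param_amplitude hp1 hμ hκ₂
  have hring : IsRing (-ν ^ 2) p μ (amplitude p μ κ₁) (amplitude p μ κ₂) κ₀ :=
    ⟨hlam, hp, hμ, hx₁, by
      rw [amplitude_eq_mul hμ hκ₁ hκ₂]; exact lt_mul_of_one_lt_left hx₁ hR1,
      fun c hc => le_param_of_mem hμ hx₁ (by rwa [hp₁]) (by rwa [hp₂]) hc, hκ₀, hsq⟩
  refine ⟨_, _, hring.isAnnulus, fun m ς hς q₀ q₁ r₀ r₁ hr₀ hq₀ hr₁ hq₁ => ?_⟩
  have hς0 : 0 < ς := lt_trans (by positivity) hς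
  refine exists_solutions hring (isLongGap hν hp1 hμ hκ₁ hκ₂ hR he₁ he₂ (by linarith) ?_ hς)
    hτ hς0 ?_ hr₀ hq₀ hr₁ hq₁ m
  · rwa [hD, div_le_iff₀ (by positivity), mul_comm ((R + D) ^ 2)] at hC
  · unfold IsSlow IsFast
    rwa [hp₁, hp₂]
end
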